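/- **Setting.** Fix integers $d\ge 0$, $n\ge 1$, widths $N_0,N_1,\dots\ge 1$ and kernel extents $1\le K_l\le n$ ($l\ge 1$). A tensor with $C$ channels is an array $v\in\mathbb R^{n\times\cdots\times n\times C}$ indexed by a position $\alpha\in(\mathbb Z/n)^d$ and a channel $c$. Given kernels $\omega^l$ (with $K_l^dN_{l-1}N_l$ entries), a *vanilla net* propagates an input signal $x^0=x$ and an input noise $dx^0=dx$ by $$y^l=\omega^l*x^{l-1}+\beta^l,\qquad x^l=\phi(y^l),\qquad dx^l=\phi'(y^l)\odot(\omega^l*dx^{l-1}),\qquad l\ge 1,$$ where $*$ is the convolution with periodic boundary conditions, $\beta^l$ is the bias $b^l\in\mathbb R^{N_l}$ repeated at all positions, $\phi=\max(\cdot,0)$, $\phi'(t)=0$ for $t<0$, $\phi'(t)=1$ for $t>0$ and $\phi'(0)=1/2$. (Fully-connected nets are the case $n=1$.) At initialization (He) all entries of all $\omega^l$ are independent, those of $\omega^l$ have law $\mathcal N\big(0,2/(K_l^dN_{l-1})\big)$, and all biases are $0$; $\Theta^l$ denotes the parameters of layers $1,\dots,l$. The input $x$ is random, has finite second moments, and is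 not trivially zero: $\mathbb E_{x,\alpha,c}[x_{\alpha,c}^2]>0$. The noise $dx$ is independent of $x$ and has iid centered components of variance $\sigma^2\in(0,\infty)$. For fixed parameters, and with $\alpha$, $c$ uniform, put $$\nu_2(x^l)=\mathbb E_{x,\alpha,c}\big[(x^l_{\alpha,c})^2\big],\qquad \mu_2(dx^l)=\mathbb E_c\,\mathbb E_{x,dx,\alpha}\big[(dx^l_{\alpha,c}-\mathbb E_{x,dx,\alpha}[dx^l_{\alpha,c}])^2\big].$$ **Theorem 1 (moments of vanilla nets).** For every $\varepsilon>0$ there is $N_*$, depending only on $\varepsilon$, such that for all $d$, $n$, $N_{\max}$ there are constants $0<m_{\min}\le m_{\max}<\varepsilon$ and $0<v_{\min}\le v_{\max}<\varepsilon$, depending only on $\varepsilon,d,n,N_{\max}$, with the following property. Consider any such net with $N_l\ge N_*$ for $l\ge 1$ and $N_l\le N_{\max}$ for all $l\ge 0$, and any distributions of $x$ and $dx$ as above. (i) There are random variables $m_l,s_l$ and events $A_l$ ($l\ge 1$), all depending on $\Theta^l$ only, with $\mathbb P[A_l]=\prod_{k=1}^l(1-2^{-N_k})$, such that for all $l\ge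 1$: under $A_l$ one has $\nu_2(x^l)>0$, $$\log\nu_2(x^l)=-l\,m_l+\sqrt l\,s_l+\log\nu_2(x^0)\quad\text{and}\quad m_{\min}\le m_l\le m_{\max};$$ moreover $s_l$ is square integrable conditionally on $A_l$, with $\mathbb E[s_l\mid A_l]=0$ and $v_{\min}\le\mathrm{Var}[s_l\mid A_l]\le v_{\max}$. (ii) Suppose in addition that the feature vector $x_{\alpha,:}$ is a.s. non-zero for every position $\alpha$. Then the same holds, with the same constants, for the noise: there are $m'_l,s'_l$ and events $A'_l$, all depending on $\Theta^l$ only, with $\mathbb P[A'_l]=\prod_{k=1}^l(1-2^{-N_k})$, such that for all $l\ge 1$: under $A'_l$ one has $\mu_2(dx^l)>0$, $\log\mu_2(dx^l)=-l\,m'_l+\sqrt l\,s'_l+\log\mu_2(dx^0)$ and $m_{\min}\le m'_l\le m_{\max}$; moreover $s'_l$ is square integrable conditionally on $A'_l$, with $\mathbb E[s'_l\mid A'_l]=0$ and $v_{\min}\le\mathrm{Var}[s'_l\mid A'_l]\le v_{\max}$. -/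

import Mathlib

open MeasureTheory ProbabilityTheory
open scoped BigOperators NNReal

noncomputable section

namespace VanillaNet

/-- Spatial positions of a `d`-dimensional periodic grid of extent `n`. -/
abbrev Pos (d n : ℕ) : Type := Fin d → ZMod n

/-- Tensors with spatial extent `n` in each of `d` dimensions and `C` channels. -/
abbrev Tensor (d n C : ℕ) : Type := Pos d n → Fin C → ℝ

/-- Convolution kernels of spatial extent `k`, with `C` input and `C'` output channels. -/
abbrev Kernel (d k C C' : ℕ) : Type := (Fin d → Fin k) → Fin C → Fin C' → ℝ

/-- The position read by the kernel entry `κ` when the kernel is centered at `α`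
(periodic boundary conditions). -/
def shift {d n k : ℕ} (α : Pos d n) (κ : Fin d → Fin k) : Pos d n :=
  fun i => α i + ((κ i : ℕ) : ZMod n) - (((k - 1) / 2 : ℕ) : ZMod n)

/-- The convolution `ω ∗ v` with periodic boundary conditions. -/
def conv {d n k C C' : ℕ} (ω : Kernel d k C C') (v : Tensor d n C) : Tensor d n C' :=
  fun α c => ∑ κ : Fin d → Fin k, ∑ c' : Fin C, ω κ c' c * v (shift α κ) c'

/-- The activation function. -/
def relu (t : ℝ) : ℝ := max t 0

/-- The derivative of the activation function, with the convention that it is `1 / 2` at `0`. -/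
def reluDeriv (t : ℝ) : ℝ := if t < 0 then 0 else if t = 0 then 1 / 2 else 1

/-- The weights of all layers: the entry with index `l` is the kernel from layer `l` to
layer `l + 1`; `N l` is the width of layer `l` and `K (l + 1)` the extent of that kernel. -/
abbrev Weights (d : ℕ) (N K : ℕ → ℕ) : Type :=
  (l : ℕ) → Kernel d (K (l + 1)) (N l) (N (l + 1))

/-- The biases of all layers, indexed as the weights. -/
abbrev Biases (N : ℕ → ℕ) : Type := (l : ℕ) → Fin (N (l + 1)) → ℝ

section Propagation

variable {d n : ℕ} {N K : ℕ → ℕ}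

/-- One affine step: `ω ∗ v + β`, the bias being repeated at each position. -/
def affine (ω : Weights d N K) (b : Biases N) (l : ℕ) (v : Tensor d n (N l)) :
    Tensor d n (N (l + 1)) :=
  fun α c => conv (ω l) v α c + b l c

/-- The signal `x^l` propagated from the input signal `x`. -/
def signal (ω : Weights d N K) (b : Biases N) (x : Tensor d n (N 0)) :
    (l : ℕ) → Tensor d n (N l)
  | 0 => x
  | l + 1 => fun α c => relu (affine ω b l (signal ω b x l) α c)

/-- The noise `dx^l` propagated at first order from the input signal `x` and the input
noise `dx`. -/
def noise (ω : Weights d N K) (b : Biases N) (x dx : Tensor d n (N 0)) :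
    (l : ℕ) → Tensor d n (N l)
  | 0 => dx
  | l + 1 => fun α c =>
      reluDeriv (affine ω b l (signal ω b x l) α c) * conv (ω l) (noise ω b x dx l) α c

end Propagation

section Moments

variable {d n : ℕ} [NeZero n] {C : ℕ} {D : Type*} [MeasurableSpace D]

/-- Non-central moment of order `p` of channel `c`: expectation over the data `z` and over a
uniform position. -/
def nuC (Q : Measure D) (p : ℕ) (v : D → Tensor d n C) (c : Fin C) : ℝ :=
  Finset.expect Finset.univ fun α : Pos d n => ∫ z, v z α c ^ p ∂Q

/-- Non-central moment of order `p`, averaged over the channels. -/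
def nu (Q : Measure D) (p : ℕ) (v : D → Tensor d n C) : ℝ :=
  Finset.expect Finset.univ fun c : Fin C => nuC Q p v c

/-- Central moment of order `p` of channel `c`; the mean is over the data and the position. -/
def muC (Q : Measure D) (p : ℕ) (v : D → Tensor d n C) (c : Fin C) : ℝ :=
  Finset.expect Finset.univ fun α : Pos d n => ∫ z, (v z α c - nuC Q 1 v c) ^ p ∂Q

/-- Central moment of order `p`, averaged over the channels. -/
def mu (Q : Measure D) (p : ℕ) (v : D → Tensor d n C) : ℝ :=
  Finset.expect Finset.univ fun c : Fin C => muC Q p v c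

end Moments

/-- The law of a noise tensor with iid components of law `ρ`. -/
def iidNoise (d n : ℕ) [NeZero n] (C : ℕ) (ρ : Measure ℝ) : Measure (Tensor d n C) :=
  Measure.pi fun _ : Pos d n => Measure.pi fun _ : Fin C => ρ

/-- The law of the data `(x, dx)`: the signal has law `Px`, and the noise is independent of it
with iid components of law `ρ`. -/
def dataLaw {d n : ℕ} [NeZero n] {C : ℕ} (Px : Measure (Tensor d n C)) (ρ : Measure ℝ) :
    Measure (Tensor d n C × Tensor d n C) :=
  Px.prod (iidNoise d n C ρ)

section Initialization

/-- The He initialization of one layer: independent entries of law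
`𝒩(0, 2 / (k ^ d * C))`. -/
def heLayer (d k C C' : ℕ) : Measure (Kernel d k C C') :=
  Measure.pi fun _ : Fin d → Fin k => Measure.pi fun _ : Fin C => Measure.pi fun _ : Fin C' =>
    gaussianReal 0 (2 / ((k : ℝ≥0) ^ d * (C : ℝ≥0)))

instance (d k C C' : ℕ) : IsProbabilityMeasure (heLayer d k C C') := by
  unfold heLayer; infer_instance

/-- The He initialization of the weights: independent layers. -/
def heLaw (d : ℕ) (N K : ℕ → ℕ) : Measure (Weights d N K) :=
  Measure.infinitePi fun l => heLayer d (K (l + 1)) (N l) (N (l + 1))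

/-- The biases are initialized with zeros. -/
def zeroBiases (N : ℕ → ℕ) : Biases N := fun _ _ => 0

/-- The σ-algebra generated by the parameters of layers `1, …, l`. -/
abbrev paramSigma (d : ℕ) (N K : ℕ → ℕ) (l : ℕ) : MeasurableSpace (Weights d N K) :=
  MeasurableSpace.comap (fun (ω : Weights d N K) (k : Fin l) => ω k) MeasurableSpace.pi

end Initialization

section RandomMoments

variable {d n : ℕ} [NeZero n] {N K : ℕ → ℕ}

/-- `ν₂(x^l)` as a function of the weights (with zero biases). -/
def nuSignal (Px : Measure (Tensor d n (N 0))) (ρ : Measure ℝ) (l : ℕ) (ω : Weights d N K) : ℝ :=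
  nu (dataLaw Px ρ) 2 fun z => signal ω (zeroBiases N) z.1 l

/-- `μ₂(dx^l)` as a function of the weights (with zero biases). -/
def muNoise (Px : Measure (Tensor d n (N 0))) (ρ : Measure ℝ) (l : ℕ) (ω : Weights d N K) : ℝ :=
  mu (dataLaw Px ρ) 2 fun z => noise ω (zeroBiases N) z.1 z.2 l

end RandomMoments

/-- The sequence `q l` of nonnegative random variables diffuses in log-space: there are events
`A l` of probability `∏ k ∈ {1, …, l}, (1 - 2 ^ (-N k))` and random variables `m l`, `s l`, all
depending on the parameters of layers `1, …, l` only, such that under `A l` one has `0 < q l`,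
`log (q l) = - l * m l + √l * s l + log (q 0)` and `m_min ≤ m l ≤ m_max`, and such that,
conditionally on `A l`, `s l` is square integrable and centered with variance in
`[v_min, v_max]`. -/
def LogDiffusion {d : ℕ} {N K : ℕ → ℕ} (q : ℕ → Weights d N K → ℝ)
    (m_min m_max v_min v_max : ℝ) : Prop :=
  ∃ (A : ℕ → Set (Weights d N K)) (m s : ℕ → Weights d N K → ℝ), ∀ l : ℕ, 1 ≤ l →
    MeasurableSet[paramSigma d N K l] (A l) ∧
    Measurable[paramSigma d N K l] (m l) ∧
    Measurable[paramSigma d N K l] (s l) ∧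
    (heLaw d N K).real (A l) = ∏ k ∈ Finset.range l, (1 - (2 : ℝ)⁻¹ ^ N (k + 1)) ∧
    (∀ ω ∈ A l, 0 < q l ω ∧
      Real.log (q l ω) = - (l : ℝ) * m l ω + √(l : ℝ) * s l ω + Real.log (q 0 ω) ∧
      m_min ≤ m l ω ∧ m l ω ≤ m_max) ∧
    MemLp (s l) 2 (cond (heLaw d N K) (A l)) ∧
    ∫ ω, s l ω ∂(cond (heLaw d N K) (A l)) = 0 ∧
    v_min ≤ variance (s l) (cond (heLaw d N K) (A l)) ∧
    variance (s l) (cond (heLaw d N K) (A l)) ≤ v_max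

end VanillaNet

end

set_option linter.unusedSectionVars false

/-! Without biases, the second moment `q` of the noise is multiplied at each layer by an average
over the output channels of energies `Z (w c)`. Given the earlier layers, the `w c` are independent
Gaussian vectors, and `Z` depends only on the data law seen through those layers. He's variance
makes `Z` of mean one: `w` and `-w` share the energy of a linear channel, because the squares of
`φ'(t)` and `φ'(-t)` sum to one for `t ≠ 0`. This requires the noise to vanish wherever the
receptive field of the signal vanishes, a property that almost surely passes from layer to layer.
The signal needs no separate treatment: since `relu t = φ'(t) t`, it is the noise started from `dx =
x`.

Hence `log q` is a sum of increments, each the logarithm of a mean of `N` iid variables of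
expectation one. Concavity makes its conditional mean negative, and a large `N` makes its
conditional second moment small. Averaging the conditional drifts gives `m`; the remaining
martingale, divided by `√l`, gives `s` (`logDiffusion_of_isLogWalk`).

The mean energy may be tiny or zero, so an event of probability exactly `2 ^ (-N)` is discarded in
each layer (`exceptional`). Among the `2 ^ N` sign choices of the channels it removes the one where
all channels are weak, if every channel has a weak sign, and otherwise the one where all are strong.
Off this event some channel is not weak, which controls negative moments (`exists_le_avgEnergy`); an
exponential tilt then bounds the lower tail of the mean energy (`sq_log_avgEnergy_le`).

Discarding weak configurations raises the conditional mean of the energy. With `a = E|Z - 1|`, the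
rule above keeps this rise below a multiple of `a² 2 ^ (-N)` (`setIntegral_compl_exceptional_le`),
whereas concavity gains a multiple of `a² / N²` (`setIntegral_log_avgEnergy_le`). The common factor
`a²` is essential: `a` is only bounded below in terms of `d`, `n`, `N_max`, while the threshold on
the widths may depend on `ε` alone. For the same reason the moments of `Z` of orders `2` and `-1/4`
are bounded by absolute constants, by writing the linear energy as a mean of squared standard
Gaussian variables (`linearEnergy_moments`).

As the discarded event has the same conditional probability whatever the past, conditioning on the
good event of all the layers preserves the martingale structure (`setIntegral_slice`). -/

namespace VanillaNet

/-! ### Channel energies and the exceptional event of a layer. -/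

/-- The energy `Z` of a channel with random weights of law `γ`, normalized to have mean one, with
a set `T` used to break ties between opposite weights, and a symmetric set `S` of small weights. -/
structure IsChannel {W : Type*} [MeasurableSpace W] [InvolutiveNeg W] (γ : Measure W)
    (Z : W → ℝ) (T S : Set W) (C₂ C₄ s₀ : ℝ) : Prop where
  neg : MeasurePreserving (fun w : W => -w) γ γ
  measurable : Measurable Z
  nonneg : ∀ w, 0 ≤ Z w
  integral_eq : ∫ w, Z w ∂γ = 1
  memLp : MemLp Z 2 γ
  integral_sq_le : ∫ w, Z w ^ 2 ∂γ ≤ C₂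
  pos : ∀ᵐ w ∂γ, 0 < Z w + Z (-w)
  integrable_inv : Integrable (fun w => (Z w + Z (-w)) ^ (-(1 / 4) : ℝ)) γ
  integral_inv_le : ∫ w, (Z w + Z (-w)) ^ (-(1 / 4) : ℝ) ∂γ ≤ C₄
  measurableSet_tie : MeasurableSet T
  tie : ∀ᵐ w ∂γ, -w ∈ T ↔ w ∉ T
  measurableSet_small : MeasurableSet S
  neg_mem_small : ∀ w ∈ S, -w ∈ S
  pos_small : 0 < s₀
  le_measure_small : s₀ ≤ γ.real S
  le_of_mem_small : ∀ w ∈ S, Z w ≤ 1 / 8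

section Events

variable {W : Type*} [Neg W] (Z : W → ℝ) (T : Set W) (N : ℕ)

/-- The weights whose energy is less than a third of the energy of the opposite weights. -/
def weakSet : Set W := {w | 3 * Z w < Z (-w)}

/-- The weights whose energy dominates the energy of the opposite weights. -/
def strongSet : Set W := {w | Z (-w) < Z w ∨ (Z w = Z (-w) ∧ w ∈ T)}

/-- The weights whose opposite is weak. -/
def antiWeakSet : Set W := {w | 3 * Z (-w) < Z w}

/-- The exceptional event of a layer: for each choice of the channel weights up to signs, it
contains exactly one choice of signs. -/
def exceptional : Set (Fin N → W) :=
  (Set.univ.pi fun _ => weakSet Z) ∪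
    ((Set.univ.pi fun _ => strongSet Z T) \ (Set.univ.pi fun _ => antiWeakSet Z))

/-- The energy averaged over the channels. -/
noncomputable def avgEnergy {N : ℕ} (w : Fin N → W) : ℝ := (∑ c, Z (w c)) / N

end Events

/-! ### Integrals over boxes of a product measure. -/

section Box

variable {W : Type*} [MeasurableSpace W] {γ : Measure W} [IsProbabilityMeasure γ] {N : ℕ}

lemma pi_real_box (A : Fin N → Set W) :
    (Measure.pi fun _ : Fin N => γ).real (Set.univ.pi A) = ∏ c, γ.real (A c) := by
  simp [measureReal_def, Measure.pi_pi, ENNReal.toReal_prod]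

lemma integral_pi_box (A : Fin N → Set W) (f : W → ℝ) (hf : AEStronglyMeasurable f γ)
    (c : Fin N) :
    ∫ w in Set.univ.pi A, f (w c) ∂(Measure.pi fun _ : Fin N => γ) =
      (∏ j ∈ Finset.univ.erase c, γ.real (A j)) * ∫ x in A c, f x ∂γ := by
  have h := Measure.restrict_pi_pi (fun _ : Fin N => γ) A
  rw [h]
  have h2 := Measure.pi_map_eval (μ := fun j : Fin N => γ.restrict (A j)) c
  have h3 : ∫ w, f (w c) ∂(Measure.pi fun j : Fin N => γ.restrict (A j)) =
      ∫ x, f x ∂((Measure.pi fun j : Fin N => γ.restrict (A j)).map (Function.eval c)) := by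
    rw [integral_map (measurable_pi_apply c).aemeasurable]
    rw [h2]
    exact (hf.restrict (s := A c)).smul_measure _
  rw [h3, h2, integral_smul_measure]
  simp [measureReal_def, ENNReal.toReal_prod]

lemma integrable_pi_eval {f : W → ℝ} (hf : Integrable f γ) (c : Fin N) :
    Integrable (fun w => f (w c)) (Measure.pi fun _ : Fin N => γ) :=
  (measurePreserving_eval (fun _ : Fin N => γ) c).integrable_comp_of_integrable hf

lemma integral_pi_eval {f : W → ℝ} (hf : AEStronglyMeasurable f γ) (c : Fin N) :
    ∫ w, f (w c) ∂(Measure.pi fun _ : Fin N => γ) = ∫ x, f x ∂γ := by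
  have h := measurePreserving_eval (fun _ : Fin N => γ) c
  have h2 := integral_map (μ := Measure.pi fun _ : Fin N => γ) (φ := Function.eval c) (f := f)
    h.measurable.aemeasurable (by rw [h.map_eq]; exact hf)
  rw [h.map_eq] at h2
  exact h2.symm

end Box

/-! ### Sign symmetry of a single channel. -/

namespace IsChannel

variable {W : Type*} [MeasurableSpace W] [InvolutiveNeg W] {γ : Measure W}
  [IsProbabilityMeasure γ] {Z : W → ℝ} {T S : Set W} {C₂ C₄ s₀ : ℝ}

lemma integrable (h : IsChannel γ Z T S C₂ C₄ s₀) : Integrable Z γ :=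
  h.memLp.integrable (by norm_num)

lemma measurable_comp_neg (h : IsChannel γ Z T S C₂ C₄ s₀) : Measurable fun w => Z (-w) :=
  h.measurable.comp h.neg.measurable

lemma integrable_comp_neg (h : IsChannel γ Z T S C₂ C₄ s₀) : Integrable (fun w => Z (-w)) γ :=
  h.neg.integrable_comp_of_integrable h.integrable

lemma neg_involutive : Function.Involutive (fun w : W => -w) := neg_neg

lemma measure_neg_preimage (h : IsChannel γ Z T S C₂ C₄ s₀) {A : Set W} (hA : MeasurableSet A) :
    γ.real {w | -w ∈ A} = γ.real A := by
  have := h.neg.measure_preimage hA.nullMeasurableSet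
  simp only [measureReal_def]
  exact congrArg _ this

lemma measurableSet_weakSet (h : IsChannel γ Z T S C₂ C₄ s₀) : MeasurableSet (weakSet Z) :=
  measurableSet_lt (h.measurable.const_mul 3) h.measurable_comp_neg

lemma measurableSet_strongSet (h : IsChannel γ Z T S C₂ C₄ s₀) :
    MeasurableSet (strongSet Z T) :=
  (measurableSet_lt h.measurable_comp_neg h.measurable).union
    ((measurableSet_eq_fun h.measurable h.measurable_comp_neg).inter h.measurableSet_tie)

lemma measurableSet_antiWeakSet (h : IsChannel γ Z T S C₂ C₄ s₀) :
    MeasurableSet (antiWeakSet Z) :=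
  measurableSet_lt (h.measurable_comp_neg.const_mul 3) h.measurable

lemma measurableSet_exceptional (h : IsChannel γ Z T S C₂ C₄ s₀) (N : ℕ) :
    MeasurableSet (exceptional Z T N) :=
  (MeasurableSet.univ_pi fun _ => h.measurableSet_weakSet).union
    ((MeasurableSet.univ_pi fun _ => h.measurableSet_strongSet).diff
      (MeasurableSet.univ_pi fun _ => h.measurableSet_antiWeakSet))

lemma antiWeakSet_subset (h : IsChannel γ Z T S C₂ C₄ s₀) : antiWeakSet Z ⊆ strongSet Z T := by
  intro w hw
  simp only [antiWeakSet, Set.mem_ofPred_eq] at hw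
  have := h.nonneg (-w)
  exact Or.inl (by linarith)

lemma not_mem_weakSet (h : IsChannel γ Z T S C₂ C₄ s₀) {w : W} (hw : w ∈ strongSet Z T) :
    w ∉ weakSet Z := by
  intro hw'
  simp only [weakSet, Set.mem_ofPred_eq] at hw'
  have := h.nonneg w
  rcases hw with hw | hw <;> linarith [hw]

lemma measure_antiWeakSet (h : IsChannel γ Z T S C₂ C₄ s₀) :
    γ.real (antiWeakSet Z) = γ.real (weakSet Z) := by
  rw [← h.measure_neg_preimage h.measurableSet_weakSet]
  congr 1
  ext w
  simp [antiWeakSet, weakSet]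

/-- Negation reverses a strict comparison of `Z w` with `Z (-w)`, and in case of equality `T`
selects exactly one of the two opposite weights. -/
lemma neg_mem_strongSet (h : IsChannel γ Z T S C₂ C₄ s₀) :
    ∀ᵐ w ∂γ, -w ∈ strongSet Z T ↔ w ∉ strongSet Z T := by
  filter_upwards [h.tie] with w hw
  simp only [strongSet, Set.mem_ofPred_eq, neg_neg, hw, not_or, not_lt, not_and]
  constructor
  · rintro (h1 | ⟨h1, h2⟩)
    · exact ⟨h1.le, fun h2 => absurd h2 h1.ne⟩
    · exact ⟨h1.ge, fun _ => h2⟩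
  · rintro ⟨h1, h2⟩
    rcases h1.lt_or_eq with h3 | h3
    · exact Or.inl h3
    · exact Or.inr ⟨h3.symm, h2 h3⟩

/-- Negation preserves `γ` and `A` and exchanges the strong part of `A` with the rest. -/
lemma measure_strongSet_inter (h : IsChannel γ Z T S C₂ C₄ s₀) {A : Set W} (hA : MeasurableSet A)
    (hneg : ∀ w, -w ∈ A ↔ w ∈ A) :
    γ.real (strongSet Z T ∩ A) = γ.real A / 2 ∧ γ.real (A \ strongSet Z T) = γ.real A / 2 := by
  have h1 := h.measure_neg_preimage (h.measurableSet_strongSet.inter hA)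
  have h2 : γ.real {w | -w ∈ strongSet Z T ∩ A} = γ.real (A \ strongSet Z T) := by
    apply measureReal_congr
    filter_upwards [h.neg_mem_strongSet] with w hw
    apply propext
    change (-w ∈ strongSet Z T ∩ A) ↔ w ∈ A \ strongSet Z T
    simp only [Set.mem_inter_iff, Set.mem_sdiff, hw, hneg]
    tauto
  have h3 := measureReal_inter_add_sdiff (μ := γ) (s := A) h.measurableSet_strongSet
  rw [Set.inter_comm] at h3
  constructor <;> linarith

lemma measure_strongSet (h : IsChannel γ Z T S C₂ C₄ s₀) : γ.real (strongSet Z T) = 1 / 2 := by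
  have := (h.measure_strongSet_inter MeasurableSet.univ (by simp)).1
  simpa using this

lemma measure_compl_strongSet (h : IsChannel γ Z T S C₂ C₄ s₀) :
    γ.real (strongSet Z T)ᶜ = 1 / 2 := by
  have := (h.measure_strongSet_inter MeasurableSet.univ (by simp)).2
  simpa [Set.compl_eq_univ_sdiff] using this

lemma measure_weakSet_le (h : IsChannel γ Z T S C₂ C₄ s₀) : γ.real (weakSet Z) ≤ 1 / 2 := by
  rw [← h.measure_antiWeakSet, ← h.measure_strongSet]
  exact measureReal_mono h.antiWeakSet_subset

/-- Anti-weak weights are the opposites of weak ones, so the all-weak box has the mass of the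
all-anti-weak box that is cut out of the all-strong box. The union therefore has the mass of the
latter. With `N = 0` the two pieces would not be disjoint. -/
lemma measure_exceptional (h : IsChannel γ Z T S C₂ C₄ s₀) {N : ℕ} (hN : 0 < N) :
    (Measure.pi fun _ : Fin N => γ).real (exceptional Z T N) = (2 : ℝ)⁻¹ ^ N := by
  have h1 : Disjoint (Set.univ.pi fun _ : Fin N => weakSet Z)
      ((Set.univ.pi fun _ : Fin N => strongSet Z T) \
        (Set.univ.pi fun _ : Fin N => antiWeakSet Z)) := by
    rw [Set.disjoint_left]
    intro w hw hw'
    exact h.not_mem_weakSet (hw'.1 ⟨0, hN⟩ trivial) (hw ⟨0, hN⟩ trivial)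
  rw [exceptional, measureReal_union h1
    ((MeasurableSet.univ_pi fun _ => h.measurableSet_strongSet).diff
      (MeasurableSet.univ_pi fun _ => h.measurableSet_antiWeakSet)),
    measureReal_sdiff (Set.pi_mono fun _ _ => h.antiWeakSet_subset)
      (MeasurableSet.univ_pi fun _ => h.measurableSet_antiWeakSet)]
  simp only [pi_real_box, h.measure_antiWeakSet, h.measure_strongSet]
  simp

/-- Of two opposite weights, the strong one carries at least half of their joint energy. -/
lemma integral_strongSet_ge (h : IsChannel γ Z T S C₂ C₄ s₀) :
    1 / 2 ≤ ∫ w in strongSet Z T, Z w ∂γ := by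
  have h1 := integral_add_compl h.measurableSet_strongSet h.integrable
  rw [h.integral_eq] at h1
  have h2 : ∫ w in (strongSet Z T)ᶜ, Z w ∂γ = ∫ w in strongSet Z T, Z (-w) ∂γ := by
    rw [← integral_indicator h.measurableSet_strongSet.compl,
      ← integral_indicator h.measurableSet_strongSet,
      ← h.neg.integral_comp (MeasurableEquiv.ofInvolutive _ neg_involutive
        h.neg.measurable).measurableEmbedding]
    apply integral_congr_ae
    filter_upwards [h.neg_mem_strongSet] with w hw
    by_cases hs : w ∈ strongSet Z T
    · simp [Set.indicator, hw, hs]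
    · simp [Set.indicator, hw, hs]
  have h3 : ∫ w in strongSet Z T, Z (-w) ∂γ ≤ ∫ w in strongSet Z T, Z w ∂γ := by
    apply setIntegral_mono_on h.integrable_comp_neg.integrableOn h.integrable.integrableOn
      h.measurableSet_strongSet
    rintro w (hw | hw)
    · exact hw.le
    · exact hw.1.ge
  linarith

/-- For a weak `w`, either `Z w ≤ 1 / 2` or `Z (-w) > 3 / 2`, so `|Z w - 1| + |Z (-w) - 1| ≥ 1 / 2`;
then Markov's inequality applies, both deviations having the same mean. -/
lemma measure_weakSet_le_deviation (h : IsChannel γ Z T S C₂ C₄ s₀) :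
    γ.real (weakSet Z) ≤ 4 * ∫ w, |Z w - 1| ∂γ := by
  have hint : Integrable (fun w => |Z w - 1|) γ := (h.integrable.sub (integrable_const 1)).abs
  have hint' : Integrable (fun w => |Z (-w) - 1|) γ :=
    (h.integrable_comp_neg.sub (integrable_const 1)).abs
  have h2 : ∫ w, |Z (-w) - 1| ∂γ = ∫ w, |Z w - 1| ∂γ :=
    h.neg.integral_comp (MeasurableEquiv.ofInvolutive _ neg_involutive
        h.neg.measurable).measurableEmbedding (fun w => |Z w - 1|)
  have h3 : γ.real (weakSet Z) ≤ ∫ w, (2 * |Z w - 1| + 2 * |Z (-w) - 1|) ∂γ := by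
    rw [← integral_indicator_one h.measurableSet_weakSet]
    apply integral_mono ((integrable_const (1 : ℝ)).indicator h.measurableSet_weakSet)
      ((hint.const_mul 2).add (hint'.const_mul 2))
    intro w
    change _ ≤ 2 * |Z w - 1| + 2 * |Z (-w) - 1|
    by_cases hw : w ∈ weakSet Z
    · simp only [Set.indicator_of_mem hw]
      have hw' : 3 * Z w < Z (-w) := hw
      have h4 := neg_abs_le (Z w - 1)
      have h5 := le_abs_self (Z (-w) - 1)
      have h6 := abs_nonneg (Z w - 1)
      have h7 := abs_nonneg (Z (-w) - 1)
      linarith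
    · simp only [Set.indicator_of_notMem hw]
      positivity
  rw [integral_add (hint.const_mul 2) (hint'.const_mul 2), integral_const_mul,
    integral_const_mul, h2] at h3
  linarith

lemma deviation_ge (h : IsChannel γ Z T S C₂ C₄ s₀) : s₀ / 2 ≤ ∫ w, |Z w - 1| ∂γ := by
  have hint : Integrable (fun w => |Z w - 1|) γ := (h.integrable.sub (integrable_const 1)).abs
  have h1 : ∫ w in S, (1 / 2 : ℝ) ∂γ ≤ ∫ w in S, |Z w - 1| ∂γ := by
    apply setIntegral_mono_on (integrable_const _).integrableOn hint.integrableOn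
      h.measurableSet_small
    intro w hw
    have h2 := h.le_of_mem_small w hw
    have h3 := neg_abs_le (Z w - 1)
    linarith
  have h2 : ∫ w in S, |Z w - 1| ∂γ ≤ ∫ w, |Z w - 1| ∂γ :=
    setIntegral_le_integral hint (Filter.Eventually.of_forall fun w => abs_nonneg _)
  rw [setIntegral_const, smul_eq_mul] at h1
  linarith [h.le_measure_small]

/-- Since `Z - 1` is centered, its positive and negative parts have the same integral. -/
lemma integral_posPart (h : IsChannel γ Z T S C₂ C₄ s₀) :
    ∫ w in {w | 1 ≤ Z w}, (Z w - 1) ∂γ = (∫ w, |Z w - 1| ∂γ) / 2 := by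
  have hm : MeasurableSet {w | 1 ≤ Z w} := measurableSet_le measurable_const h.measurable
  have hi : Integrable (fun w => Z w - 1) γ := h.integrable.sub (integrable_const 1)
  have h1 := integral_add_compl hm hi
  have h2 := integral_add_compl hm hi.abs
  have h3 : ∫ w, (Z w - 1) ∂γ = 0 := by
    rw [integral_sub h.integrable (integrable_const 1), h.integral_eq]; simp
  have h4 : ∫ w in {w | 1 ≤ Z w}, |Z w - 1| ∂γ = ∫ w in {w | 1 ≤ Z w}, (Z w - 1) ∂γ := by
    apply setIntegral_congr_fun hm
    intro w hw
    have hw' : 1 ≤ Z w := hw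
    exact abs_of_nonneg (by linarith)
  have h5 : ∫ w in {w | 1 ≤ Z w}ᶜ, |Z w - 1| ∂γ = ∫ w in {w | 1 ≤ Z w}ᶜ, -(Z w - 1) ∂γ := by
    apply setIntegral_congr_fun hm.compl
    intro w hw
    have hw' : ¬ 1 ≤ Z w := hw
    exact abs_of_neg (by linarith)
  rw [integral_neg] at h5
  linarith

end IsChannel

/-! ### The energy averaged over the channels, on and off the exceptional event. -/

namespace IsChannel

variable {W : Type*} [MeasurableSpace W] [InvolutiveNeg W] {γ : Measure W}
  [IsProbabilityMeasure γ] {Z : W → ℝ} {T S : Set W} {C₂ C₄ s₀ : ℝ} {N : ℕ}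

lemma avgEnergy_nonneg (h : IsChannel γ Z T S C₂ C₄ s₀) (w : Fin N → W) :
    0 ≤ avgEnergy Z w :=
  div_nonneg (Finset.sum_nonneg fun c _ => h.nonneg (w c)) (Nat.cast_nonneg N)

lemma measurable_avgEnergy (h : IsChannel γ Z T S C₂ C₄ s₀) :
    Measurable (avgEnergy Z : (Fin N → W) → ℝ) :=
  (Finset.measurable_sum _ fun c _ => h.measurable.comp (measurable_pi_apply c)).div_const _

lemma integrable_avgEnergy (h : IsChannel γ Z T S C₂ C₄ s₀) :
    Integrable (avgEnergy Z) (Measure.pi fun _ : Fin N => γ) :=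
  (integrable_finsetSum _ fun c _ => integrable_pi_eval h.integrable c).div_const _

lemma integral_avgEnergy (h : IsChannel γ Z T S C₂ C₄ s₀) (hN : 0 < N) :
    ∫ w, avgEnergy Z w ∂(Measure.pi fun _ : Fin N => γ) = 1 := by
  have hN' : (N : ℝ) ≠ 0 := by positivity
  simp only [avgEnergy]
  rw [integral_div, integral_finsetSum _ fun c _ => integrable_pi_eval h.integrable c]
  simp only [integral_pi_eval h.integrable.aestronglyMeasurable, h.integral_eq]
  simp [hN']

lemma memLp_avgEnergy (h : IsChannel γ Z T S C₂ C₄ s₀) :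
    MemLp (avgEnergy Z) 2 (Measure.pi fun _ : Fin N => γ) := by
  have := memLp_finsetSum (μ := Measure.pi fun _ : Fin N => γ) Finset.univ
    (f := fun (c : Fin N) (w : Fin N → W) => Z (w c)) (p := 2)
    fun c _ => h.memLp.comp_measurePreserving (measurePreserving_eval (fun _ : Fin N => γ) c)
  have h2 := this.const_mul (N : ℝ)⁻¹
  refine h2.congr_norm h.measurable_avgEnergy.aestronglyMeasurable ?_
  filter_upwards with w
  simp [avgEnergy, div_eq_inv_mul]

lemma variance_avgEnergy_le (h : IsChannel γ Z T S C₂ C₄ s₀) (hN : 0 < N) :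
    ∫ w, (avgEnergy Z w - 1) ^ 2 ∂(Measure.pi fun _ : Fin N => γ) ≤ C₂ / N := by
  have hN' : (0 : ℝ) < N := by positivity
  have h1 := variance_eq_integral (μ := Measure.pi fun _ : Fin N => γ)
    (h.measurable_avgEnergy (N := N)).aemeasurable
  rw [h.integral_avgEnergy hN] at h1
  rw [← h1]
  have h2 : (avgEnergy Z : (Fin N → W) → ℝ) =
      fun w => (N : ℝ)⁻¹ * (∑ c, fun w : Fin N → W => Z (w c)) w := by
    funext w
    simp [avgEnergy, div_eq_inv_mul]
  rw [h2, variance_const_mul, variance_sum_pi fun _ => h.memLp]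
  have h3 : variance Z γ ≤ C₂ := by
    refine (variance_le_expectation_sq h.measurable.aestronglyMeasurable).trans ?_
    simpa using h.integral_sq_le
  simp only [Finset.sum_const, Finset.card_univ, Fintype.card_fin, nsmul_eq_mul]
  rw [div_eq_mul_inv, sq]
  calc (N : ℝ)⁻¹ * (N : ℝ)⁻¹ * (N * variance Z γ) = (N : ℝ)⁻¹ * variance Z γ := by field_simp
    _ ≤ (N : ℝ)⁻¹ * C₂ := by gcongr
    _ = C₂ * (N : ℝ)⁻¹ := mul_comm _ _

lemma setIntegral_avgEnergy_box (h : IsChannel γ Z T S C₂ C₄ s₀) (A : Fin N → Set W) :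
    ∫ w in Set.univ.pi A, avgEnergy Z w ∂(Measure.pi fun _ : Fin N => γ) =
      (∑ c, (∏ j ∈ Finset.univ.erase c, γ.real (A j)) * ∫ x in A c, Z x ∂γ) / N := by
  simp only [avgEnergy]
  rw [integral_div, integral_finsetSum _ fun c _ =>
    (integrable_pi_eval h.integrable c).integrableOn]
  simp only [integral_pi_box A Z h.measurable.aestronglyMeasurable]

lemma setIntegral_avgEnergy_pow (h : IsChannel γ Z T S C₂ C₄ s₀) (hN : 0 < N) (A : Set W) :
    ∫ w in Set.univ.pi (fun _ => A), avgEnergy Z w ∂(Measure.pi fun _ : Fin N => γ) =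
      γ.real A ^ (N - 1) * ∫ x in A, Z x ∂γ := by
  have hN' : (N : ℝ) ≠ 0 := by positivity
  rw [h.setIntegral_avgEnergy_box]
  simp only [Finset.prod_const, Finset.card_erase_of_mem (Finset.mem_univ _), Finset.card_univ,
    Fintype.card_fin, Finset.sum_const, nsmul_eq_mul]
  field_simp

/-- The exceptional event carries nearly its fair share `2 ^ (-N)` of the energy. The all-strong box
alone carries at least that much, and cutting out the all-anti-weak box costs at most `P(weak) ^ (N
- 1)`; the energy on the all-weak box is simply dropped. -/
lemma setIntegral_avgEnergy_exceptional_ge (h : IsChannel γ Z T S C₂ C₄ s₀) (hN : 0 < N) :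
    (2 : ℝ)⁻¹ ^ N - γ.real (weakSet Z) ^ (N - 1) ≤
      ∫ w in exceptional Z T N, avgEnergy Z w ∂(Measure.pi fun _ : Fin N => γ) := by
  set P := Measure.pi fun _ : Fin N => γ
  have hi : Integrable (avgEnergy Z) P := h.integrable_avgEnergy
  have hsub : ((Set.univ.pi fun _ : Fin N => strongSet Z T) \
        (Set.univ.pi fun _ : Fin N => antiWeakSet Z)) ⊆ exceptional Z T N :=
    Set.subset_union_right
  have h1 : ∫ w in ((Set.univ.pi fun _ : Fin N => strongSet Z T) \
        (Set.univ.pi fun _ : Fin N => antiWeakSet Z)), avgEnergy Z w ∂P ≤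
      ∫ w in exceptional Z T N, avgEnergy Z w ∂P :=
    setIntegral_mono_set hi.integrableOn (Filter.Eventually.of_forall h.avgEnergy_nonneg)
      hsub.eventuallyLE
  have h2 := setIntegral_sdiff (μ := P) (f := avgEnergy Z)
    (MeasurableSet.univ_pi fun _ : Fin N => h.measurableSet_antiWeakSet) hi.integrableOn
    (Set.pi_mono fun _ _ => h.antiWeakSet_subset :
      (Set.univ.pi fun _ : Fin N => antiWeakSet Z) ⊆ Set.univ.pi fun _ => strongSet Z T)
  rw [h2, h.setIntegral_avgEnergy_pow hN, h.setIntegral_avgEnergy_pow hN, h.measure_strongSet,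
    h.measure_antiWeakSet] at h1
  have h3 : ∫ x in antiWeakSet Z, Z x ∂γ ≤ 1 := by
    rw [← h.integral_eq]
    exact setIntegral_le_integral h.integrable (Filter.Eventually.of_forall h.nonneg)
  have h4 : γ.real (weakSet Z) ^ (N - 1) * ∫ x in antiWeakSet Z, Z x ∂γ ≤
      γ.real (weakSet Z) ^ (N - 1) * 1 := by gcongr
  have h5 : (1 / 2 : ℝ) ^ (N - 1) * (1 / 2) ≤
      (1 / 2 : ℝ) ^ (N - 1) * ∫ w in strongSet Z T, Z w ∂γ := by
    gcongr
    exact h.integral_strongSet_ge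
  have h6 : (1 / 2 : ℝ) ^ (N - 1) * (1 / 2) = (2 : ℝ)⁻¹ ^ N := by
    rw [← pow_succ, Nat.sub_add_cancel hN, one_div]
  linarith

/-- The deviation `avgEnergy - 1` has total integral zero, so its integral off the exceptional event
is the deficit on that event, at most `P(weak) ^ (N - 1)`. The bound is quadratic in `a`, in order
to compete with the gain from concavity even when `a` is small. -/
lemma setIntegral_compl_exceptional_le (h : IsChannel γ Z T S C₂ C₄ s₀) (hN : 3 ≤ N) :
    ∫ w in (exceptional Z T N)ᶜ, (avgEnergy Z w - 1) ∂(Measure.pi fun _ : Fin N => γ) ≤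
      128 * (∫ w, |Z w - 1| ∂γ) ^ 2 * (2 : ℝ)⁻¹ ^ N := by
  set P := Measure.pi fun _ : Fin N => γ
  set a := ∫ w, |Z w - 1| ∂γ
  have hi : Integrable (avgEnergy Z) P := h.integrable_avgEnergy
  have h1 := integral_add_compl (μ := P) (h.measurableSet_exceptional N)
    (hi.sub (integrable_const 1))
  have h2 : ∫ w, (avgEnergy Z w - 1) ∂P = 0 := by
    rw [integral_sub hi (integrable_const 1), h.integral_avgEnergy (by omega)]; simp
  have h3 : ∫ w in exceptional Z T N, (avgEnergy Z w - 1) ∂P =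
      (∫ w in exceptional Z T N, avgEnergy Z w ∂P) - (2 : ℝ)⁻¹ ^ N := by
    rw [integral_sub hi.integrableOn (integrable_const _).integrableOn, setIntegral_const,
      h.measure_exceptional (by omega)]
    simp
  have h4 := h.setIntegral_avgEnergy_exceptional_ge (N := N) (by omega)
  have hp0 : 0 ≤ γ.real (weakSet Z) := measureReal_nonneg
  have hp1 := h.measure_weakSet_le
  have hp2 := h.measure_weakSet_le_deviation
  have h5 : γ.real (weakSet Z) ^ (N - 1) ≤ 128 * a ^ 2 * (2 : ℝ)⁻¹ ^ N := by
    -- Of the `N - 1 = M + 2` factors, `M` are bounded by `1 / 2` and two by `4 * a`; the constant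
    -- is `128 = 16 * 2 ^ 3`.
    obtain ⟨M, rfl⟩ : ∃ M, N = M + 3 := ⟨N - 3, by omega⟩
    have h6 : γ.real (weakSet Z) ^ M ≤ (1 / 2) ^ M := pow_le_pow_left₀ hp0 hp1 M
    have h7 : γ.real (weakSet Z) ^ 2 ≤ (4 * a) ^ 2 := pow_le_pow_left₀ hp0 hp2 2
    calc γ.real (weakSet Z) ^ (M + 3 - 1) = γ.real (weakSet Z) ^ M * γ.real (weakSet Z) ^ 2 := by
          rw [← pow_add]; rfl
      _ ≤ (1 / 2) ^ M * (4 * a) ^ 2 := by gcongr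
      _ = 128 * a ^ 2 * (2 : ℝ)⁻¹ ^ (M + 3) := by rw [pow_add]; ring
  simp only [Pi.sub_apply] at h1
  linarith

/-- The signed deviation is integrated over a box that avoids the exceptional event: channel `i`
strong, `j` not strong, `k` of energy at least one, the others free. The contributions of `i` and
`j` cancel and free channels contribute zero, so only `k` remains: `(a / 2) * (1 / 2) * (1 / 2) /
N`. -/
lemma setIntegral_abs_compl_exceptional_ge (h : IsChannel γ Z T S C₂ C₄ s₀) (hN : 3 ≤ N) :
    (∫ w, |Z w - 1| ∂γ) / (8 * N) ≤
      ∫ w in (exceptional Z T N)ᶜ, |avgEnergy Z w - 1| ∂(Measure.pi fun _ : Fin N => γ) := by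
  set P := Measure.pi fun _ : Fin N => γ with hP
  set a := ∫ w, |Z w - 1| ∂γ with ha
  have hN' : (0 : ℝ) < N := by positivity
  have hi : Integrable (avgEnergy Z) P := h.integrable_avgEnergy
  have hi1 : Integrable (fun w => avgEnergy Z w - 1) P := hi.sub (integrable_const 1)
  have hiZ : Integrable (fun w => Z w - 1) γ := h.integrable.sub (integrable_const 1)
  let i : Fin N := ⟨0, by omega⟩
  let j : Fin N := ⟨1, by omega⟩
  let k : Fin N := ⟨2, by omega⟩
  have hij : i ≠ j := by simp [i, j]
  have hik : i ≠ k := by simp [i, k]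
  have hjk : j ≠ k := by simp [j, k]
  set L := strongSet Z T with hL
  set U := {w | 1 ≤ Z w} with hU
  have hUm : MeasurableSet U := measurableSet_le measurable_const h.measurable
  let A : Fin N → Set W := fun c => if c = i then L else if c = j then Lᶜ else
    if c = k then U else Set.univ
  have hAi : A i = L := by simp [A]
  have hAj : A j = Lᶜ := by simp [A, hij.symm]
  have hAk : A k = U := by simp [A, hik.symm, hjk.symm]
  have hA : ∀ c, c ≠ i → c ≠ j → c ≠ k → A c = Set.univ := by
    intro c h1 h2 h3; simp [A, h1, h2, h3]
  have hAm : ∀ c, MeasurableSet (A c) := by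
    intro c
    simp only [A]
    split_ifs
    exacts [h.measurableSet_strongSet, h.measurableSet_strongSet.compl, hUm, MeasurableSet.univ]
  have hsub : Set.univ.pi A ⊆ (exceptional Z T N)ᶜ := by
    intro w hw hw'
    have h1 : w i ∈ L := by have := hw i trivial; rwa [hAi] at this
    have h2 : w j ∈ Lᶜ := by have := hw j trivial; rwa [hAj] at this
    rcases hw' with hw' | hw'
    · exact h.not_mem_weakSet h1 (hw' i trivial)
    · exact h2 (hw'.1 j trivial)
  have h1 : ∫ w in Set.univ.pi A, (avgEnergy Z w - 1) ∂P ≤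
      ∫ w in (exceptional Z T N)ᶜ, |avgEnergy Z w - 1| ∂P := by
    calc _ ≤ ∫ w in Set.univ.pi A, |avgEnergy Z w - 1| ∂P :=
          integral_mono hi1.integrableOn hi1.abs.integrableOn fun w => le_abs_self _
      _ ≤ _ := setIntegral_mono_set hi1.abs.integrableOn
          (Filter.Eventually.of_forall fun w => abs_nonneg _) hsub.eventuallyLE
  have h2 : ∫ w in Set.univ.pi A, (avgEnergy Z w - 1) ∂P =
      (∑ c, (∏ j ∈ Finset.univ.erase c, γ.real (A j)) * ∫ x in A c, (Z x - 1) ∂γ) / N := by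
    have h3 : ∀ w : Fin N → W, avgEnergy Z w - 1 = (∑ c, (Z (w c) - 1)) / N := by
      intro w
      simp only [avgEnergy, Finset.sum_sub_distrib, Finset.sum_const, Finset.card_univ,
        Fintype.card_fin, nsmul_eq_mul, mul_one]
      field_simp
    simp only [h3]
    rw [integral_div, integral_finsetSum _ fun c _ =>
      (integrable_pi_eval hiZ c).integrableOn]
    simp only [integral_pi_box A (fun x => Z x - 1) hiZ.aestronglyMeasurable]
  have hz : ∫ x, (Z x - 1) ∂γ = 0 := by
    rw [integral_sub h.integrable (integrable_const 1), h.integral_eq]; simp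
  have prod2 : ∀ c x y : Fin N, x ≠ y → c ≠ x → c ≠ y →
      (∀ z, z ≠ c → z ≠ x → z ≠ y → A z = Set.univ) →
      ∏ z ∈ Finset.univ.erase c, γ.real (A z) = γ.real (A x) * γ.real (A y) := by
    intro c x y hxy hcx hcy hz
    apply Finset.prod_eq_mul x y hxy
    · intro z hz1 hz2
      rw [hz z (Finset.ne_of_mem_erase hz1) hz2.1 hz2.2]
      simp
    · intro hx; exact absurd (Finset.mem_erase.2 ⟨hcx.symm, Finset.mem_univ _⟩) hx
    · intro hx; exact absurd (Finset.mem_erase.2 ⟨hcy.symm, Finset.mem_univ _⟩) hx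
  have h4 : ∑ c, (∏ j ∈ Finset.univ.erase c, γ.real (A j)) * ∫ x in A c, (Z x - 1) ∂γ =
      γ.real (A j) * γ.real (A k) * ∫ x in A i, (Z x - 1) ∂γ +
      γ.real (A i) * γ.real (A k) * ∫ x in A j, (Z x - 1) ∂γ +
      γ.real (A i) * γ.real (A j) * ∫ x in A k, (Z x - 1) ∂γ := by
    rw [← prod2 i j k hjk hij hik fun z a b c => hA z a b c,
      ← prod2 j i k hik hij.symm hjk fun z a b c => hA z b a c,
      ← prod2 k i j hij hik.symm hjk.symm fun z a b c => hA z b c a]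
    rw [← Finset.sum_subset (Finset.subset_univ {i, j, k})]
    · rw [Finset.sum_insert (by simp [hij, hik]), Finset.sum_insert (by simp [hjk]),
        Finset.sum_singleton, add_assoc]
    · intro c _ hc
      simp only [Finset.mem_insert, Finset.mem_singleton, not_or] at hc
      rw [hA c hc.1 hc.2.1 hc.2.2, Measure.restrict_univ, hz, mul_zero]
  rw [hAi, hAj, hAk, h.measure_strongSet, h.measure_compl_strongSet, h.integral_posPart] at h4
  have h5 := integral_add_compl h.measurableSet_strongSet hiZ
  rw [hz] at h5
  have h6 : ∫ w in Set.univ.pi A, (avgEnergy Z w - 1) ∂P = a / (8 * N) := by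
    rw [h2, h4]
    have : ∫ x in Lᶜ, (Z x - 1) ∂γ = - ∫ x in L, (Z x - 1) ∂γ := by linarith
    rw [this]
    field_simp
    ring
  linarith

end IsChannel

/-! ### Elementary inequalities for the exponential and the logarithm. -/

lemma exp_neg_le_quadratic {x : ℝ} (hx : 0 ≤ x) : Real.exp (-x) ≤ 1 - x + x ^ 2 / 2 := by
  have h1 := Real.quadratic_le_exp_of_nonneg hx
  rw [Real.exp_neg]
  -- The product of `1 + x + x ^ 2 / 2` and `1 - x + x ^ 2 / 2` is `1 + x ^ 4 / 4`.
  have h2 : (1 + x + x ^ 2 / 2)⁻¹ ≤ 1 - x + x ^ 2 / 2 := by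
    rw [inv_le_iff_one_le_mul₀ (by positivity)]
    nlinarith [sq_nonneg (x ^ 2)]
  exact (inv_anti₀ (by positivity) h1).trans h2

lemma sq_log_le_rpow {x : ℝ} (hx : 0 < x) (hx1 : x ≤ 1) :
    Real.log x ^ 2 ≤ 64 * x ^ (-(1 / 4) : ℝ) := by
  have h1 := Real.log_le_rpow_div (x := x⁻¹) (by positivity) (ε := 1 / 8) (by norm_num)
  rw [Real.log_inv] at h1
  have h2 := Real.log_nonpos hx.le hx1
  have h3 : x ^ (-(1 / 4) : ℝ) = (x⁻¹ ^ (1 / 8 : ℝ)) ^ 2 := by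
    rw [← Real.rpow_natCast, ← Real.rpow_mul (by positivity), Real.inv_rpow hx.le,
      ← Real.rpow_neg hx.le]
    norm_num
  rw [h3]
  have h4 : (-Real.log x) ^ 2 ≤ (x⁻¹ ^ (1 / 8 : ℝ) / (1 / 8)) ^ 2 :=
    pow_le_pow_left₀ (by linarith) h1 2
  calc Real.log x ^ 2 = (-Real.log x) ^ 2 := by ring
    _ ≤ _ := h4
    _ = _ := by ring

lemma sq_log_le_sq {x : ℝ} (hx : 1 / 2 ≤ x) : Real.log x ^ 2 ≤ 4 * (x - 1) ^ 2 := by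
  have h0 : 0 < x := by linarith
  have h1 := Real.log_le_sub_one_of_pos h0
  have h2 := Real.one_sub_inv_le_log_of_pos h0
  have h3 : -(2 * |x - 1|) ≤ 1 - x⁻¹ := by
    have h4 : 1 - x⁻¹ = (x - 1) / x := by field_simp
    rw [h4, le_div_iff₀ h0]
    have h5 := neg_abs_le (x - 1)
    nlinarith [abs_nonneg (x - 1)]
  have h4 := le_abs_self (x - 1)
  have h5 := abs_nonneg (x - 1)
  have h6 : |Real.log x| ≤ |2 * (x - 1)| := by
    rw [abs_mul, abs_two, abs_le]
    constructor <;> linarith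
  calc Real.log x ^ 2 ≤ (2 * (x - 1)) ^ 2 := sq_le_sq.2 h6
    _ = _ := by ring

/-- A quantitative form of concavity that needs only a first absolute moment. With `y = √x`, one has
`2 log y ≤ 2 (y - 1) = (x - 1) - (y - 1)²`. Expanding `(|y - 1| - l (y + 1))² ≥ 0` bounds `(y - 1)²`
below by `2 l |x - 1| - l² (y + 1)²`, where `(y + 1)² ≤ 2 (x + 1)`. The parameter `l` is left free
for optimization. -/
lemma log_le_of_pos {x : ℝ} (hx : 0 < x) (l : ℝ) :
    Real.log x ≤ (x - 1) - 2 * l * |x - 1| + 2 * l ^ 2 * (x + 1) := by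
  obtain ⟨y, hy, rfl⟩ : ∃ y : ℝ, 0 < y ∧ x = y ^ 2 :=
    ⟨√x, Real.sqrt_pos.2 hx, (Real.sq_sqrt hx.le).symm⟩
  have h1 := Real.log_le_sub_one_of_pos hy
  rw [Real.log_pow]
  push_cast
  have h2 : |y ^ 2 - 1| = |y - 1| * (y + 1) := by
    rw [show y ^ 2 - 1 = (y - 1) * (y + 1) by ring, abs_mul, abs_of_pos (by linarith : 0 < y + 1)]
  rw [h2]
  have h3 := sq_nonneg (|y - 1| - l * (y + 1))
  have h4 := sq_abs (y - 1)
  nlinarith [mul_nonneg (sq_nonneg l) (sq_nonneg (y - 1))]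

/-! ### Lower tail of the averaged energy and second moment of its logarithm. -/

/-- The bound on the second moment of the logarithm of the averaged energy. -/
noncomputable def logSqBound (C₂ C₄ : ℝ) (N : ℕ) : ℝ :=
  4 * C₂ / N + 512 * C₄ * (N : ℝ) ^ 2 * Real.exp (-(1 / (8 * C₂)) * (N - 1 : ℕ))

namespace IsChannel

variable {W : Type*} [MeasurableSpace W] [InvolutiveNeg W] {γ : Measure W}
  [IsProbabilityMeasure γ] {Z : W → ℝ} {T S : Set W} {C₂ C₄ s₀ : ℝ} {N : ℕ}

lemma one_le_sq (h : IsChannel γ Z T S C₂ C₄ s₀) : 1 ≤ C₂ := by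
  have h1 := variance_eq_sub h.memLp
  have h2 := variance_nonneg Z γ
  rw [h.integral_eq] at h1
  have := h.integral_sq_le
  simp only [Pi.pow_apply] at h1
  linarith

/-- Off the all-weak box some channel has `Z (-w) ≤ 3 * Z w`, so its symmetrized energy, whose
negative moment is under control, is at most `4 * Z (w c)`, hence at most four times the total
energy. -/
lemma exists_le_avgEnergy (h : IsChannel γ Z T S C₂ C₄ s₀) (hN : 0 < N) :
    ∀ᵐ w ∂(Measure.pi fun _ : Fin N => γ), w ∉ exceptional Z T N →
      ∃ c, 0 < Z (w c) + Z (-(w c)) ∧ Z (w c) + Z (-(w c)) ≤ 4 * N * avgEnergy Z w := by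
  have h1 : ∀ᵐ w ∂(Measure.pi fun _ : Fin N => γ), ∀ c, 0 < Z (w c) + Z (-(w c)) := by
    rw [ae_all_iff]
    intro c
    exact (measurePreserving_eval (fun _ : Fin N => γ) c).quasiMeasurePreserving.ae h.pos
  filter_upwards [h1] with w hw hw'
  have h2 : ∃ c, w c ∉ weakSet Z := by
    by_contra! h2
    exact hw' (Or.inl fun c _ => h2 c)
  obtain ⟨c, hc⟩ := h2
  refine ⟨c, hw c, ?_⟩
  have h3 : Z (-(w c)) ≤ 3 * Z (w c) := not_lt.1 hc
  have h4 : Z (w c) ≤ ∑ c, Z (w c) :=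
    Finset.single_le_sum (fun c _ => h.nonneg (w c)) (Finset.mem_univ c)
  have h5 : (N : ℝ) * avgEnergy Z w = ∑ c, Z (w c) := by
    have hN' : (N : ℝ) ≠ 0 := by positivity
    simp only [avgEnergy]
    field_simp
  linarith

lemma avgEnergy_pos (h : IsChannel γ Z T S C₂ C₄ s₀) (hN : 0 < N) :
    ∀ᵐ w ∂(Measure.pi fun _ : Fin N => γ), w ∉ exceptional Z T N → 0 < avgEnergy Z w := by
  filter_upwards [h.exists_le_avgEnergy hN] with w hw hw'
  obtain ⟨c, h1, h2⟩ := hw hw'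
  have hN' : (0 : ℝ) < N := by positivity
  by_contra! h3
  nlinarith

section LowerTail

variable (Z C₂) in
/-- An exponential weight used to control the lower tail of the averaged energy. -/
noncomputable def tilt (w : W) : ℝ := Real.exp (-(1 / (2 * C₂)) * (Z w - 1 / 2))

lemma measurable_tilt (h : IsChannel γ Z T S C₂ C₄ s₀) : Measurable (tilt Z C₂) :=
  Real.measurable_exp.comp ((h.measurable.sub_const _).const_mul _)

lemma tilt_le (h : IsChannel γ Z T S C₂ C₄ s₀) (w : W) : tilt Z C₂ w ≤ 2 := by
  have h1 := h.one_le_sq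
  have h2 : -(1 / (2 * C₂)) * (Z w - 1 / 2) ≤ 1 / 4 := by
    have h3 : 1 / (2 * C₂) ≤ 1 / 2 := one_div_le_one_div_of_le (by norm_num) (by linarith)
    have h4 : 0 ≤ 1 / (2 * C₂) := by positivity
    have h5 := h.nonneg w
    nlinarith [mul_nonneg h4 h5]
  have h3 : Real.exp (1 / 4) ≤ 2 := by
    have := Real.exp_one_lt_d9
    have h4 : Real.exp (1 / 4) ^ 4 = Real.exp 1 := by rw [← Real.exp_nat_mul]; norm_num
    by_contra! h5
    have : (2 : ℝ) ^ 4 < Real.exp (1 / 4) ^ 4 := pow_lt_pow_left₀ h5 (by norm_num) (by norm_num)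
    linarith
  exact (Real.exp_le_exp.2 h2).trans h3

lemma integrable_tilt (h : IsChannel γ Z T S C₂ C₄ s₀) : Integrable (tilt Z C₂) γ :=
  Integrable.of_bound h.measurable_tilt.aestronglyMeasurable 2
    (Filter.Eventually.of_forall fun w => by
      rw [Real.norm_eq_abs, tilt, Real.abs_exp]
      exact h.tilt_le w)

/-- A Chernoff bound for a nonnegative variable of mean one: only the second moment is needed,
because `exp (-x)` is at most quadratic for `x ≥ 0`. -/
lemma integral_tilt_le (h : IsChannel γ Z T S C₂ C₄ s₀) :
    ∫ w, tilt Z C₂ w ∂γ ≤ Real.exp (-(1 / (8 * C₂))) := by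
  have h1 := h.one_le_sq
  -- With this `t` the quadratic term is at most `t / 4`, and the total exponent is `t / 2 - 3 * t /
  -- 4 = -1 / (8 * C₂)`.
  set t := 1 / (2 * C₂) with ht
  have ht0 : 0 < t := by positivity
  have h2 : ∀ w, tilt Z C₂ w ≤ Real.exp (t / 2) * (1 - t * Z w + t ^ 2 / 2 * Z w ^ 2) := by
    intro w
    have h3 := exp_neg_le_quadratic (mul_nonneg ht0.le (h.nonneg w))
    rw [tilt, show -(1 / (2 * C₂)) * (Z w - 1 / 2) = t / 2 + -(t * Z w) by rw [ht]; ring,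
      Real.exp_add]
    gcongr
    linarith
  have hi' : Integrable (fun w => 1 - t * Z w) γ :=
    (integrable_const 1).sub (h.integrable.const_mul t)
  have hi : Integrable (fun w => 1 - t * Z w + t ^ 2 / 2 * Z w ^ 2) γ :=
    hi'.add (h.memLp.integrable_sq.const_mul _)
  have h3 : ∫ w, (1 - t * Z w + t ^ 2 / 2 * Z w ^ 2) ∂γ = 1 - t + t ^ 2 / 2 * ∫ w, Z w ^ 2 ∂γ := by
    rw [integral_add hi' (h.memLp.integrable_sq.const_mul _),
      integral_sub (integrable_const 1) (h.integrable.const_mul t), integral_const_mul,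
      integral_const_mul, h.integral_eq]
    simp
  have h4 : t ^ 2 / 2 * ∫ w, Z w ^ 2 ∂γ ≤ t / 4 := by
    calc t ^ 2 / 2 * ∫ w, Z w ^ 2 ∂γ ≤ t ^ 2 / 2 * C₂ := by
          gcongr
          exact h.integral_sq_le
      _ = t / 4 := by rw [ht]; field_simp; norm_num
  calc ∫ w, tilt Z C₂ w ∂γ
      ≤ ∫ w, Real.exp (t / 2) * (1 - t * Z w + t ^ 2 / 2 * Z w ^ 2) ∂γ :=
        integral_mono h.integrable_tilt (hi.const_mul _) h2
    _ = Real.exp (t / 2) * (1 - t + t ^ 2 / 2 * ∫ w, Z w ^ 2 ∂γ) := by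
        rw [integral_const_mul, h3]
    _ ≤ Real.exp (t / 2) * (1 - 3 * t / 4) := by
        gcongr
        linarith
    _ ≤ Real.exp (t / 2) * Real.exp (-(3 * t / 4)) := by
        gcongr
        have := Real.add_one_le_exp (-(3 * t / 4))
        linarith
    _ = Real.exp (-(1 / (8 * C₂))) := by
        rw [← Real.exp_add]
        congr 1
        rw [ht]
        field_simp
        norm_num

variable (Z C₂) in
/-- A product of functions of the channel weights whose sum over `c` dominates the lower tail. -/
noncomputable def tailFactor (c c' : Fin N) (w : W) : ℝ :=
  if c' = c then (Z w + Z (-w)) ^ (-(1 / 4) : ℝ) * tilt Z C₂ w else tilt Z C₂ w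

lemma integrable_rpow_mul_tilt (h : IsChannel γ Z T S C₂ C₄ s₀) :
    Integrable (fun w => (Z w + Z (-w)) ^ (-(1 / 4) : ℝ) * tilt Z C₂ w) γ :=
  h.integrable_inv.mul_bdd (c := 2) h.measurable_tilt.aestronglyMeasurable
    (Filter.Eventually.of_forall fun w => by
      rw [Real.norm_eq_abs, tilt, Real.abs_exp]
      exact h.tilt_le w)

lemma integrable_tailFactor (h : IsChannel γ Z T S C₂ C₄ s₀) (c c' : Fin N) :
    Integrable (tailFactor Z C₂ c c') γ := by
  unfold tailFactor
  split_ifs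
  · exact h.integrable_rpow_mul_tilt
  · exact h.integrable_tilt

lemma integrable_prod_tailFactor (h : IsChannel γ Z T S C₂ C₄ s₀) (c : Fin N) :
    Integrable (fun w => ∏ c', tailFactor Z C₂ c c' (w c')) (Measure.pi fun _ : Fin N => γ) :=
  Integrable.fintype_prod fun c' => h.integrable_tailFactor c c'

/-- The integral factorizes by independence. In the marked channel the tilt is just bounded by `2`;
each of the other `N - 1` channels contributes a factor `exp (-1 / (8 * C₂))`. -/
lemma integral_prod_tailFactor_le (h : IsChannel γ Z T S C₂ C₄ s₀) (c : Fin N) :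
    ∫ w, ∏ c', tailFactor Z C₂ c c' (w c') ∂(Measure.pi fun _ : Fin N => γ) ≤
      2 * C₄ * Real.exp (-(1 / (8 * C₂)) * (N - 1 : ℕ)) := by
  have hnn : ∀ w : W, 0 ≤ (Z w + Z (-w)) ^ (-(1 / 4) : ℝ) := fun w =>
    Real.rpow_nonneg (add_nonneg (h.nonneg _) (h.nonneg _)) _
  rw [integral_fintype_prod_eq_prod, ← Finset.mul_prod_erase _ _ (Finset.mem_univ c)]
  have h1 : ∫ w, tailFactor Z C₂ c c w ∂γ ≤ 2 * C₄ := by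
    calc ∫ w, tailFactor Z C₂ c c w ∂γ ≤ ∫ w, (Z w + Z (-w)) ^ (-(1 / 4) : ℝ) * 2 ∂γ := by
          apply integral_mono (h.integrable_tailFactor c c) (h.integrable_inv.mul_const 2)
          intro w
          simp only [tailFactor, if_true]
          exact mul_le_mul_of_nonneg_left (h.tilt_le w) (hnn w)
      _ ≤ 2 * C₄ := by
          rw [integral_mul_const, mul_comm]
          linarith [h.integral_inv_le]
  have hC₄ : 0 ≤ C₄ := (integral_nonneg hnn).trans h.integral_inv_le
  have h2 : ∏ c' ∈ Finset.univ.erase c, ∫ w, tailFactor Z C₂ c c' w ∂γ ≤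
      Real.exp (-(1 / (8 * C₂)) * (N - 1 : ℕ)) := by
    have h3 : ∏ c' ∈ Finset.univ.erase c, ∫ w, tailFactor Z C₂ c c' w ∂γ =
        ∏ c' ∈ Finset.univ.erase c, ∫ w, tilt Z C₂ w ∂γ := by
      apply Finset.prod_congr rfl
      intro c' hc'
      simp only [tailFactor, if_neg (Finset.ne_of_mem_erase hc')]
    rw [h3, Finset.prod_const, Finset.card_erase_of_mem (Finset.mem_univ _), Finset.card_univ,
      Fintype.card_fin, mul_comm, Real.exp_nat_mul]
    exact pow_le_pow_left₀ (integral_nonneg fun w => (Real.exp_pos _).le) h.integral_tilt_le _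
  have h3 : 0 ≤ ∏ c' ∈ Finset.univ.erase c, ∫ w, tailFactor Z C₂ c c' w ∂γ := by
    apply Finset.prod_nonneg
    intro c' _
    apply integral_nonneg
    intro w
    simp only [tailFactor]
    have h4 : 0 < tilt Z C₂ w := Real.exp_pos _
    have := hnn w
    split_ifs
    · exact mul_nonneg this h4.le
    · exact h4.le
  exact mul_le_mul h1 h2 h3 (by positivity)

/-- When the mean energy is at least `1 / 2`, the logarithm is Lipschitz. Below `1 / 2`, `log ^ 2`
is dominated by the power `-1/4`, which is controlled by the symmetrized energy of a channel that is
not weak; the product of the tilts is then at least one and can be inserted for free. That channel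
depends on the weights, whence the sum over `c`. -/
lemma sq_log_avgEnergy_le (h : IsChannel γ Z T S C₂ C₄ s₀) (hN : 0 < N) :
    ∀ᵐ w ∂(Measure.pi fun _ : Fin N => γ), w ∉ exceptional Z T N →
      Real.log (avgEnergy Z w) ^ 2 ≤ 4 * (avgEnergy Z w - 1) ^ 2 +
        256 * N * ∑ c, ∏ c', tailFactor Z C₂ c c' (w c') := by
  filter_upwards [h.exists_le_avgEnergy hN] with w hw hw'
  obtain ⟨c, h1, h2⟩ := hw hw'
  have hN' : (0 : ℝ) < N := by positivity
  have hpos : 0 < avgEnergy Z w := by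
    by_contra! h3
    nlinarith
  have hnn : ∀ c c' : Fin N, 0 ≤ tailFactor Z C₂ c c' (w c') := by
    intro c c'
    simp only [tailFactor]
    have h4 : 0 < tilt Z C₂ (w c') := Real.exp_pos _
    have : 0 ≤ (Z (w c') + Z (-(w c'))) ^ (-(1 / 4) : ℝ) :=
      Real.rpow_nonneg (add_nonneg (h.nonneg _) (h.nonneg _)) _
    split_ifs
    · exact mul_nonneg this h4.le
    · exact h4.le
  have hsum : 0 ≤ 256 * N * ∑ c, ∏ c', tailFactor Z C₂ c c' (w c') :=
    mul_nonneg (by positivity)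
      (Finset.sum_nonneg fun c _ => Finset.prod_nonneg fun c' _ => hnn c c')
  rcases le_or_gt (1 / 2) (avgEnergy Z w) with h3 | h3
  · linarith [sq_log_le_sq h3]
  · have h4 := sq_log_le_rpow hpos (by linarith)
    have h5 : avgEnergy Z w ^ (-(1 / 4) : ℝ) ≤
        4 * N * (Z (w c) + Z (-(w c))) ^ (-(1 / 4) : ℝ) := by
      have h6 : (4 * N * avgEnergy Z w) ^ (-(1 / 4) : ℝ) ≤
          (Z (w c) + Z (-(w c))) ^ (-(1 / 4) : ℝ) :=
        Real.rpow_le_rpow_of_nonpos h1 h2 (by norm_num)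
      rw [Real.mul_rpow (by positivity) hpos.le] at h6
      have h7 : (4 * (N : ℝ))⁻¹ ≤ (4 * (N : ℝ)) ^ (-(1 / 4) : ℝ) := by
        rw [← Real.rpow_neg_one]
        apply Real.rpow_le_rpow_of_exponent_le _ (by norm_num)
        have : (1 : ℝ) ≤ N := by exact_mod_cast hN
        linarith
      have h8 : (4 * (N : ℝ))⁻¹ * avgEnergy Z w ^ (-(1 / 4) : ℝ) ≤
          (Z (w c) + Z (-(w c))) ^ (-(1 / 4) : ℝ) :=
        (mul_le_mul_of_nonneg_right h7 (Real.rpow_nonneg hpos.le _)).trans h6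
      rwa [inv_mul_le_iff₀ (by positivity)] at h8
    have h6 : (Z (w c) + Z (-(w c))) ^ (-(1 / 4) : ℝ) ≤ ∏ c', tailFactor Z C₂ c c' (w c') := by
      have h7 : ∏ c', tailFactor Z C₂ c c' (w c') =
          (Z (w c) + Z (-(w c))) ^ (-(1 / 4) : ℝ) * ∏ c', tilt Z C₂ (w c') := by
        rw [← Finset.mul_prod_erase _ _ (Finset.mem_univ c),
          ← Finset.mul_prod_erase _ (fun c' => tilt Z C₂ (w c')) (Finset.mem_univ c), ← mul_assoc]
        congr 1
        · simp [tailFactor]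
        · apply Finset.prod_congr rfl
          intro c' hc'
          simp only [tailFactor, if_neg (Finset.ne_of_mem_erase hc')]
      rw [h7]
      apply le_mul_of_one_le_right
        (Real.rpow_nonneg (add_nonneg (h.nonneg _) (h.nonneg _)) _)
      simp only [tilt]
      rw [← Real.exp_sum, ← Finset.mul_sum]
      apply Real.one_le_exp
      have h8 : ∑ c', (Z (w c') - 1 / 2) ≤ 0 := by
        simp only [Finset.sum_sub_distrib, Finset.sum_const, Finset.card_univ,
          Fintype.card_fin, nsmul_eq_mul]
        simp only [avgEnergy, div_lt_iff₀ hN'] at h3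
        linarith
      have h9 : 0 ≤ 1 / (2 * C₂) := by
        have := h.one_le_sq
        positivity
      nlinarith
    have h7 : ∏ c', tailFactor Z C₂ c c' (w c') ≤ ∑ c, ∏ c', tailFactor Z C₂ c c' (w c') :=
      Finset.single_le_sum (f := fun c => ∏ c', tailFactor Z C₂ c c' (w c'))
        (fun c _ => Finset.prod_nonneg fun c' _ => hnn c c') (Finset.mem_univ c)
    have h8 : 4 * N * (Z (w c) + Z (-(w c))) ^ (-(1 / 4) : ℝ) ≤
        4 * N * ∑ c, ∏ c', tailFactor Z C₂ c c' (w c') := by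
      gcongr
      exact h6.trans h7
    nlinarith [sq_nonneg (avgEnergy Z w - 1)]

lemma integrable_sq_dev (h : IsChannel γ Z T S C₂ C₄ s₀) :
    Integrable (fun w => (avgEnergy Z w - 1) ^ 2) (Measure.pi fun _ : Fin N => γ) :=
  (h.memLp_avgEnergy.sub (memLp_const 1)).integrable_sq

lemma integrableOn_sq_log_avgEnergy (h : IsChannel γ Z T S C₂ C₄ s₀) (hN : 0 < N) :
    IntegrableOn (fun w => Real.log (avgEnergy Z w) ^ 2) (exceptional Z T N)ᶜ
      (Measure.pi fun _ : Fin N => γ) := by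
  have hd : Integrable (fun w => 4 * (avgEnergy Z w - 1) ^ 2 +
        256 * N * ∑ c, ∏ c', tailFactor Z C₂ c c' (w c')) (Measure.pi fun _ : Fin N => γ) :=
    (h.integrable_sq_dev.const_mul 4).add
      ((integrable_finsetSum _ fun c _ => h.integrable_prod_tailFactor c).const_mul _)
  refine hd.integrableOn.mono'
    ((Real.measurable_log.comp h.measurable_avgEnergy).pow_const 2).aestronglyMeasurable ?_
  rw [ae_restrict_iff' (h.measurableSet_exceptional N).compl]
  filter_upwards [h.sq_log_avgEnergy_le hN] with w hw hw'
  rw [Real.norm_of_nonneg (sq_nonneg _)]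
  exact hw hw'

lemma setIntegral_sq_log_avgEnergy_le (h : IsChannel γ Z T S C₂ C₄ s₀) (hN : 0 < N) :
    ∫ w in (exceptional Z T N)ᶜ, Real.log (avgEnergy Z w) ^ 2 ∂(Measure.pi fun _ : Fin N => γ) ≤
      logSqBound C₂ C₄ N := by
  set P := Measure.pi fun _ : Fin N => γ
  have hi1 : Integrable (fun w => 4 * (avgEnergy Z w - 1) ^ 2) P := h.integrable_sq_dev.const_mul 4
  have hi2 : Integrable (fun w => 256 * N * ∑ c, ∏ c', tailFactor Z C₂ c c' (w c')) P :=
    (integrable_finsetSum _ fun c _ => h.integrable_prod_tailFactor c).const_mul _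
  have hnn : ∀ w : Fin N → W, 0 ≤ 4 * (avgEnergy Z w - 1) ^ 2 +
        256 * N * ∑ c, ∏ c', tailFactor Z C₂ c c' (w c') := by
    intro w
    have : 0 ≤ ∑ c, ∏ c', tailFactor Z C₂ c c' (w c') := by
      apply Finset.sum_nonneg
      intro c _
      apply Finset.prod_nonneg
      intro c' _
      simp only [tailFactor]
      have h4 : 0 < tilt Z C₂ (w c') := Real.exp_pos _
      have : 0 ≤ (Z (w c') + Z (-(w c'))) ^ (-(1 / 4) : ℝ) :=
        Real.rpow_nonneg (add_nonneg (h.nonneg _) (h.nonneg _)) _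
      split_ifs
      · exact mul_nonneg this h4.le
      · exact h4.le
    positivity
  calc _ ≤ ∫ w in (exceptional Z T N)ᶜ, (4 * (avgEnergy Z w - 1) ^ 2 +
        256 * N * ∑ c, ∏ c', tailFactor Z C₂ c c' (w c')) ∂P := by
        apply setIntegral_mono_on_ae (h.integrableOn_sq_log_avgEnergy hN)
          (hi1.add hi2).integrableOn (h.measurableSet_exceptional N).compl
        filter_upwards [h.sq_log_avgEnergy_le hN] with w hw hw'
        exact hw hw'
    _ ≤ ∫ w, (4 * (avgEnergy Z w - 1) ^ 2 +
        256 * N * ∑ c, ∏ c', tailFactor Z C₂ c c' (w c')) ∂P :=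
        setIntegral_le_integral (hi1.add hi2) (Filter.Eventually.of_forall hnn)
    _ = 4 * ∫ w, (avgEnergy Z w - 1) ^ 2 ∂P + 256 * N *
        ∑ c, ∫ w, ∏ c', tailFactor Z C₂ c c' (w c') ∂P := by
        rw [integral_add hi1 hi2, integral_const_mul, integral_const_mul,
          integral_finsetSum _ fun c _ => h.integrable_prod_tailFactor c]
    _ ≤ 4 * (C₂ / N) + 256 * N *
        ∑ _c : Fin N, 2 * C₄ * Real.exp (-(1 / (8 * C₂)) * (N - 1 : ℕ)) := by
        gcongr with c
        · exact h.variance_avgEnergy_le hN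
        · exact h.integral_prod_tailFactor_le c
    _ = logSqBound C₂ C₄ N := by
        rw [logSqBound, Finset.sum_const, Finset.card_univ, Fintype.card_fin, nsmul_eq_mul]
        ring

end LowerTail

end IsChannel

/-! ### Negative drift and non-degenerate variance of the logarithm. -/

namespace IsChannel

variable {W : Type*} [MeasurableSpace W] [InvolutiveNeg W] {γ : Measure W}
  [IsProbabilityMeasure γ] {Z : W → ℝ} {T S : Set W} {C₂ C₄ s₀ : ℝ} {N : ℕ}

lemma small_le_one (h : IsChannel γ Z T S C₂ C₄ s₀) : s₀ ≤ 1 :=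
  h.le_measure_small.trans measureReal_le_one

lemma integrableOn_log_avgEnergy (h : IsChannel γ Z T S C₂ C₄ s₀) (hN : 0 < N) :
    IntegrableOn (fun w => Real.log (avgEnergy Z w)) (exceptional Z T N)ᶜ
      (Measure.pi fun _ : Fin N => γ) := by
  have h1 : MemLp (fun w => Real.log (avgEnergy Z w)) 2
      ((Measure.pi fun _ : Fin N => γ).restrict (exceptional Z T N)ᶜ) :=
    (memLp_two_iff_integrable_sq
      (Real.measurable_log.comp h.measurable_avgEnergy).aestronglyMeasurable).2
      (h.integrableOn_sq_log_avgEnergy hN)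
  exact h1.integrable (by norm_num)

/-- The gain from concavity, of order `a² / N²`, beats the rise of the mean caused by discarding the
exceptional event, of order `a² 2 ^ (-N)`. -/
lemma setIntegral_log_avgEnergy_le (h : IsChannel γ Z T S C₂ C₄ s₀) (hN : 3 ≤ N)
    (hN' : 2 ^ 16 * N ^ 2 ≤ 2 ^ N) :
    ∫ w in (exceptional Z T N)ᶜ, Real.log (avgEnergy Z w) ∂(Measure.pi fun _ : Fin N => γ) ≤
      -(s₀ ^ 2 / (2048 * N ^ 2)) := by
  set P := Measure.pi fun _ : Fin N => γ
  set a := ∫ w, |Z w - 1| ∂γ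
  set B := (exceptional Z T N)ᶜ
  have hB : MeasurableSet B := (h.measurableSet_exceptional N).compl
  have hNpos : (0 : ℝ) < N := by positivity
  have ha := h.deviation_ge
  have hs := h.pos_small
  have ha0 : 0 < a := by linarith
  -- This minimizes `-2 * l * a / (8 * N) + 4 * l ^ 2`, with value `-a² / (256 * N²)`. The
  -- conditioning costs at most half of it, and `a ≥ s₀ / 2` turns the remaining `a² / (512 * N²)`
  -- into the claimed bound.
  set l := a / (32 * N)
  have hl : 0 < l := by positivity
  have hi : Integrable (avgEnergy Z) P := h.integrable_avgEnergy
  have hi1 : Integrable (fun w => avgEnergy Z w - 1) P := hi.sub (integrable_const 1)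
  have hi2 : Integrable (fun w => 2 * l * |avgEnergy Z w - 1|) P := hi1.abs.const_mul _
  have hi3 : Integrable (fun w => 2 * l ^ 2 * (avgEnergy Z w + 1)) P :=
    (hi.add (integrable_const 1)).const_mul _
  have hi12 : Integrable (fun w => avgEnergy Z w - 1 - 2 * l * |avgEnergy Z w - 1|) P :=
    hi1.sub hi2
  have h1 : ∫ w in B, Real.log (avgEnergy Z w) ∂P ≤
      ∫ w in B, (avgEnergy Z w - 1 - 2 * l * |avgEnergy Z w - 1| +
        2 * l ^ 2 * (avgEnergy Z w + 1)) ∂P := by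
    apply setIntegral_mono_on_ae (h.integrableOn_log_avgEnergy (by omega))
      (hi12.add hi3).integrableOn hB
    filter_upwards [h.avgEnergy_pos (N := N) (by omega)] with w hw hw'
    exact log_le_of_pos (hw hw') l
  rw [integral_add hi12.integrableOn hi3.integrableOn,
    integral_sub hi1.integrableOn hi2.integrableOn, integral_const_mul] at h1
  have h2 := h.setIntegral_compl_exceptional_le hN
  have h3 := h.setIntegral_abs_compl_exceptional_ge hN
  have h4 : ∫ w in B, 2 * l ^ 2 * (avgEnergy Z w + 1) ∂P ≤ 4 * l ^ 2 := by
    calc _ ≤ ∫ w, 2 * l ^ 2 * (avgEnergy Z w + 1) ∂P := by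
          apply setIntegral_le_integral hi3
          filter_upwards with w
          have := h.avgEnergy_nonneg w
          exact mul_nonneg (by positivity) (by linarith)
      _ = 4 * l ^ 2 := by
          rw [integral_const_mul, integral_add hi (integrable_const 1),
            h.integral_avgEnergy (by omega)]
          simp
          ring
  have h5 : 128 * a ^ 2 * (2 : ℝ)⁻¹ ^ N ≤ a ^ 2 / (512 * N ^ 2) := by
    have h6 : ((2 : ℝ) ^ 16 * (N : ℝ) ^ 2) ≤ 2 ^ N := by exact_mod_cast hN'
    rw [inv_pow, ← div_eq_mul_inv, div_le_div_iff₀ (by positivity) (by positivity)]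
    nlinarith [sq_nonneg a, mul_le_mul_of_nonneg_left h6 (sq_nonneg a)]
  have h6 : 2 * l * (a / (8 * N)) ≤ 2 * l * ∫ w in B, |avgEnergy Z w - 1| ∂P := by gcongr
  have h7 : 2 * l * (a / (8 * N)) = 2 * (a ^ 2 / (256 * N ^ 2)) := by
    simp only [l]; field_simp; norm_num
  have h8 : 4 * l ^ 2 = a ^ 2 / (256 * N ^ 2) := by
    simp only [l]; field_simp; norm_num
  have h9 : a ^ 2 / (256 * N ^ 2) = 2 * (a ^ 2 / (512 * (N : ℝ) ^ 2)) := by field_simp; norm_num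
  have h10 : s₀ ^ 2 / (2048 * N ^ 2) ≤ a ^ 2 / (512 * (N : ℝ) ^ 2) := by
    rw [div_le_div_iff₀ (by positivity) (by positivity)]
    have : (s₀ / 2) ^ 2 ≤ a ^ 2 := pow_le_pow_left₀ (by positivity) ha 2
    have h11 := mul_le_mul_of_nonneg_right this (by positivity : (0 : ℝ) ≤ 2048 * (N : ℝ) ^ 2)
    nlinarith
  linarith

/-- All channels have small weights, one of them strong and another one not strong. The last two
requirements exclude the exceptional event and, `S` being symmetric, cost a factor `1 / 2` each. -/
lemma measure_small_box_ge (h : IsChannel γ Z T S C₂ C₄ s₀) (hN : 2 ≤ N) :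
    s₀ ^ N / 4 ≤ (Measure.pi fun _ : Fin N => γ).real
      ((exceptional Z T N)ᶜ ∩ {w | avgEnergy Z w ≤ 1 / 8}) := by
  have hs := h.pos_small
  let i : Fin N := ⟨0, by omega⟩
  let j : Fin N := ⟨1, by omega⟩
  have hij : i ≠ j := by simp [i, j]
  set L := strongSet Z T
  have hneg : ∀ w, -w ∈ S ↔ w ∈ S := fun w =>
    ⟨fun hw => by simpa using h.neg_mem_small _ hw, h.neg_mem_small w⟩
  have hLS := h.measure_strongSet_inter h.measurableSet_small hneg
  let A : Fin N → Set W := fun c => if c = i then L ∩ S else if c = j then S \ L else S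
  have hAi : A i = L ∩ S := by simp [A]
  have hAj : A j = S \ L := by simp [A, hij.symm]
  have hAS : ∀ c, A c ⊆ S := by
    intro c
    simp only [A]
    split_ifs
    exacts [Set.inter_subset_right, Set.sdiff_subset, subset_rfl]
  have hsub : Set.univ.pi A ⊆ (exceptional Z T N)ᶜ ∩ {w | avgEnergy Z w ≤ 1 / 8} := by
    intro w hw
    constructor
    · intro hw'
      have h1 : w i ∈ L ∩ S := by have := hw i trivial; rwa [hAi] at this
      have h2 : w j ∈ S \ L := by have := hw j trivial; rwa [hAj] at this
      rcases hw' with hw' | hw'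
      · exact h.not_mem_weakSet h1.1 (hw' i trivial)
      · exact h2.2 (hw'.1 j trivial)
    · have hN' : (0 : ℝ) < N := by positivity
      change (∑ c, Z (w c)) / N ≤ 1 / 8
      rw [div_le_iff₀ hN']
      calc ∑ c, Z (w c) ≤ ∑ _c : Fin N, (1 / 8 : ℝ) :=
            Finset.sum_le_sum fun c _ => h.le_of_mem_small _ (hAS c (hw c trivial))
        _ = 1 / 8 * N := by simp; ring
  refine le_trans ?_ (measureReal_mono hsub)
  rw [pi_real_box]
  have h1 : ∏ c : Fin N, (s₀ * ((if c = i then 1 / 2 else 1) * (if c = j then 1 / 2 else 1))) =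
      s₀ ^ N / 4 := by
    rw [Finset.prod_mul_distrib, Finset.prod_mul_distrib, Finset.prod_ite_eq', Finset.prod_ite_eq']
    simp
    ring
  rw [← h1]
  apply Finset.prod_le_prod
  · intro c _
    apply mul_nonneg hs.le
    apply mul_nonneg <;> split_ifs <;> norm_num
  · intro c _
    have := h.le_measure_small
    by_cases hci : c = i
    · subst hci
      rw [hAi, if_pos rfl, if_neg hij, hLS.1]
      linarith
    · by_cases hcj : c = j
      · subst hcj
        rw [hAj, if_pos rfl, if_neg hci, hLS.2]
        linarith
      · simp only [A, if_neg hci, if_neg hcj]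
        linarith

/-- By Chebyshev's inequality the mean energy falls below `1 / 2` with probability at most `4 * C₂ /
N ≤ 1 / 4`, and the exceptional event has probability at most `1 / 4`. -/
lemma measure_large_ge (h : IsChannel γ Z T S C₂ C₄ s₀) (hN : 2 ≤ N) (hN' : 16 * C₂ ≤ N) :
    1 / 2 ≤ (Measure.pi fun _ : Fin N => γ).real
      ((exceptional Z T N)ᶜ ∩ {w | 1 / 2 ≤ avgEnergy Z w}) := by
  set P := Measure.pi fun _ : Fin N => γ
  have hNpos : (0 : ℝ) < N := by positivity
  have hm : MeasurableSet {w : Fin N → W | 1 / 2 ≤ avgEnergy Z w} :=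
    measurableSet_le measurable_const h.measurable_avgEnergy
  have h1 : P.real {w | 1 / 2 ≤ avgEnergy Z w}ᶜ ≤ 1 / 4 := by
    have h2 : P.real {w | 1 / 2 ≤ avgEnergy Z w}ᶜ ≤ ∫ w, 4 * (avgEnergy Z w - 1) ^ 2 ∂P := by
      rw [← integral_indicator_one hm.compl]
      apply integral_mono ((integrable_const (1 : ℝ)).indicator hm.compl)
        (h.integrable_sq_dev.const_mul 4)
      intro w
      by_cases hw : 1 / 2 ≤ avgEnergy Z w
      · rw [Set.indicator_of_notMem (by simpa using hw)]
        positivity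
      · rw [Set.indicator_of_mem (by simpa using hw)]
        push Not at hw
        change (1 : ℝ) ≤ 4 * (avgEnergy Z w - 1) ^ 2
        nlinarith
    rw [integral_const_mul] at h2
    have h3 := h.variance_avgEnergy_le (N := N) (by omega)
    have h4 : C₂ / N ≤ 1 / 16 := by
      rw [div_le_iff₀ hNpos]; linarith
    linarith
  have h2 : P.real (exceptional Z T N) ≤ 1 / 4 := by
    rw [h.measure_exceptional (by omega)]
    calc (2 : ℝ)⁻¹ ^ N ≤ (2 : ℝ)⁻¹ ^ 2 := pow_le_pow_of_le_one (by norm_num) (by norm_num) hN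
      _ = 1 / 4 := by norm_num
  have h3 : P.real ((exceptional Z T N)ᶜ ∩ {w | 1 / 2 ≤ avgEnergy Z w})ᶜ ≤ 1 / 2 := by
    rw [Set.compl_inter, compl_compl]
    linarith [measureReal_union_le (μ := P) (exceptional Z T N) {w | 1 / 2 ≤ avgEnergy Z w}ᶜ]
  rw [probReal_compl_eq_one_sub ((h.measurableSet_exceptional N).compl.inter hm)] at h3
  linarith

/-- The mean energy is at most `1 / 8` with some probability and at least `1 / 2` with some
probability. The midpoint of the two logarithms is `-2 log 2`, so any `c` is at distance at least
`log 2 > 1 / 2` from one of the two ranges. -/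
lemma setIntegral_sq_log_sub_ge (h : IsChannel γ Z T S C₂ C₄ s₀) (hN : 2 ≤ N)
    (hN' : 16 * C₂ ≤ N) (c : ℝ) :
    s₀ ^ N / 16 ≤ ∫ w in (exceptional Z T N)ᶜ, (Real.log (avgEnergy Z w) - c) ^ 2
      ∂(Measure.pi fun _ : Fin N => γ) := by
  set P := Measure.pi fun _ : Fin N => γ
  set B := (exceptional Z T N)ᶜ
  have hB : MeasurableSet B := (h.measurableSet_exceptional N).compl
  have hmeas : Measurable (fun w : Fin N → W => Real.log (avgEnergy Z w)) :=
    Real.measurable_log.comp h.measurable_avgEnergy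
  have h1 : MemLp (fun w => Real.log (avgEnergy Z w)) 2 (P.restrict B) :=
    (memLp_two_iff_integrable_sq hmeas.aestronglyMeasurable).2
      (h.integrableOn_sq_log_avgEnergy (by omega))
  have hi : IntegrableOn (fun w => (Real.log (avgEnergy Z w) - c) ^ 2) B P :=
    (h1.sub (memLp_const c)).integrable_sq
  have hs := h.pos_small
  have hs1 : s₀ ^ N ≤ 1 := pow_le_one₀ hs.le h.small_le_one
  have key : ∀ E : Set (Fin N → W), MeasurableSet E → s₀ ^ N / 4 ≤ P.real (B ∩ E) →
      (∀ w ∈ E, 0 < avgEnergy Z w → 1 / 2 ≤ |Real.log (avgEnergy Z w) - c|) →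
      s₀ ^ N / 16 ≤ ∫ w in B, (Real.log (avgEnergy Z w) - c) ^ 2 ∂P := by
    intro E hE hE1 hE2
    calc s₀ ^ N / 16 ≤ P.real (B ∩ E) * (1 / 4) := by linarith
      _ = ∫ w in B ∩ E, (1 / 4 : ℝ) ∂P := by rw [setIntegral_const, smul_eq_mul]
      _ ≤ ∫ w in B ∩ E, (Real.log (avgEnergy Z w) - c) ^ 2 ∂P := by
          apply setIntegral_mono_on_ae (integrable_const _).integrableOn
            (hi.mono_set Set.inter_subset_left) (hB.inter hE)
          filter_upwards [h.avgEnergy_pos (N := N) (by omega)] with w hw hw'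
          have h3 := hE2 w hw'.2 (hw hw'.1)
          rw [← sq_abs (Real.log _ - c)]
          nlinarith
      _ ≤ ∫ w in B, (Real.log (avgEnergy Z w) - c) ^ 2 ∂P :=
          setIntegral_mono_set hi (Filter.Eventually.of_forall fun w => sq_nonneg _)
            Set.inter_subset_left.eventuallyLE
  have hlog := Real.log_two_gt_d9
  rcases le_total (-(2 * Real.log 2)) c with hc | hc
  · refine key {w | avgEnergy Z w ≤ 1 / 8}
      (measurableSet_le h.measurable_avgEnergy measurable_const) (h.measure_small_box_ge hN) ?_
    intro w hw hpos
    have h3 : Real.log (avgEnergy Z w) ≤ Real.log (1 / 8) := Real.log_le_log hpos hw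
    have h4 : Real.log (1 / 8) = -(3 * Real.log 2) := by
      rw [show (1 / 8 : ℝ) = (2 ^ 3)⁻¹ by norm_num, Real.log_inv, Real.log_pow]; norm_num
    rw [abs_sub_comm]
    exact le_trans (by linarith) (le_abs_self _)
  · refine key {w | 1 / 2 ≤ avgEnergy Z w}
      (measurableSet_le measurable_const h.measurable_avgEnergy)
      (le_trans (by linarith) (h.measure_large_ge hN hN')) ?_
    intro w hw _
    have h3 : Real.log (1 / 2) ≤ Real.log (avgEnergy Z w) := Real.log_le_log (by norm_num) hw
    have h4 : Real.log (1 / 2) = -Real.log 2 := by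
      rw [one_div, Real.log_inv]
    exact le_trans (by linarith) (le_abs_self _)

end IsChannel

/-! ### Scalar products with Gaussian weights, and moments of a standard Gaussian variable. -/

section Gaussian

variable {ι : Type*} [Fintype ι]

/-- The scalar product of weights and features. -/
def dot (w a : ι → ℝ) : ℝ := ∑ i, w i * a i

lemma dot_neg_left (w a : ι → ℝ) : dot (-w) a = -dot w a := by simp [dot]

lemma dot_sq_le (w a : ι → ℝ) : dot w a ^ 2 ≤ (∑ i, w i ^ 2) * ∑ i, a i ^ 2 :=
  Finset.sum_mul_sq_le_sq_mul_sq _ _ _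

lemma measurable_dot {X : Type*} [MeasurableSpace X] {f g : X → ι → ℝ} (hf : Measurable f)
    (hg : Measurable g) : Measurable fun x => dot (f x) (g x) := by
  unfold dot
  fun_prop

lemma map_dot_gaussian (s : ℝ≥0) (a : ι → ℝ) :
    (Measure.pi fun _ : ι => gaussianReal 0 s).map (fun w => dot w a) =
      gaussianReal 0 (s * Real.toNNReal (∑ i, a i ^ 2)) := by
  have hm : Measurable fun w : ι → ℝ => dot w a := measurable_dot measurable_id measurable_const
  have : IsProbabilityMeasure
      ((Measure.pi fun _ : ι => gaussianReal 0 s).map (fun w => dot w a)) :=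
    Measure.isProbabilityMeasure_map hm.aemeasurable
  apply Measure.ext_of_charFun
  funext t
  rw [charFun_gaussianReal, charFun_apply_real, integral_map hm.aemeasurable (by fun_prop)]
  have h1 : ∀ w : ι → ℝ, Complex.exp (t * (dot w a : ℝ) * Complex.I) =
      ∏ i, Complex.exp (((t * a i : ℝ) : ℂ) * (w i : ℝ) * Complex.I) := by
    intro w
    rw [← Complex.exp_sum]
    congr 1
    simp only [dot]
    push_cast
    rw [Finset.mul_sum, Finset.sum_mul]
    apply Finset.sum_congr rfl
    intro i _
    ring
  simp only [h1]
  rw [integral_fintype_prod_eq_prod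
    (f := fun i (x : ℝ) => Complex.exp (((t * a i : ℝ) : ℂ) * (x : ℝ) * Complex.I))]
  simp only [← charFun_apply_real, charFun_gaussianReal]
  rw [← Complex.exp_sum]
  congr 1
  have h2 : ((Real.toNNReal (∑ i, a i ^ 2) : ℝ≥0) : ℝ) = ∑ i, a i ^ 2 :=
    Real.coe_toNNReal _ (Finset.sum_nonneg fun i _ => sq_nonneg _)
  have h3 : (((s * Real.toNNReal (∑ i, a i ^ 2) : ℝ≥0) : ℝ) : ℂ) =
      (s : ℂ) * ∑ i, (a i : ℂ) ^ 2 := by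
    rw [NNReal.coe_mul, h2]; push_cast; rfl
  rw [h3]
  push_cast
  rw [Finset.mul_sum, Finset.sum_mul, Finset.sum_div, mul_zero, zero_mul, zero_sub,
    ← Finset.sum_neg_distrib]
  apply Finset.sum_congr rfl
  intro i _
  ring

lemma integral_dot_sq (s : ℝ≥0) (a : ι → ℝ) :
    Integrable (fun w => dot w a ^ 2) (Measure.pi fun _ : ι => gaussianReal 0 s) ∧
    ∫ w, dot w a ^ 2 ∂(Measure.pi fun _ : ι => gaussianReal 0 s) = s * ∑ i, a i ^ 2 := by
  have hm : Measurable fun w : ι → ℝ => dot w a := measurable_dot measurable_id measurable_const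
  have h2 : ((Real.toNNReal (∑ i, a i ^ 2) : ℝ≥0) : ℝ) = ∑ i, a i ^ 2 :=
    Real.coe_toNNReal _ (Finset.sum_nonneg fun i _ => sq_nonneg _)
  constructor
  · have h3 : Integrable (fun x : ℝ => x ^ 2)
        ((Measure.pi fun _ : ι => gaussianReal 0 s).map (fun w => dot w a)) := by
      rw [map_dot_gaussian]
      exact (memLp_id_gaussianReal' 2 (by simp)).integrable_sq
    exact h3.comp_measurable hm
  · have h3 := integral_map (μ := Measure.pi fun _ : ι => gaussianReal 0 s) hm.aemeasurable
      (f := fun x : ℝ => x ^ 2) (by fun_prop)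
    rw [← h3, map_dot_gaussian]
    have h4 := variance_eq_integral
      (μ := gaussianReal 0 (s * Real.toNNReal (∑ i, a i ^ 2))) (X := id) aemeasurable_id
    rw [variance_id_gaussianReal] at h4
    simp only [id_eq, integral_id_gaussianReal, sub_zero] at h4
    rw [← h4, NNReal.coe_mul, h2]

lemma ae_dot_ne_zero {s : ℝ≥0} (hs : s ≠ 0) {a : ι → ℝ} (ha : a ≠ 0) :
    ∀ᵐ w ∂(Measure.pi fun _ : ι => gaussianReal 0 s), dot w a ≠ 0 := by
  have hm : Measurable fun w : ι → ℝ => dot w a := measurable_dot measurable_id measurable_const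
  have hpos : 0 < ∑ i, a i ^ 2 := by
    obtain ⟨i, hi⟩ := Function.ne_iff.1 ha
    exact Finset.sum_pos' (fun i _ => sq_nonneg _) ⟨i, Finset.mem_univ i, by
      have : a i ≠ 0 := hi
      positivity⟩
  have hv : s * Real.toNNReal (∑ i, a i ^ 2) ≠ 0 :=
    mul_ne_zero hs (Real.toNNReal_pos.2 hpos).ne'
  have h1 : ∀ᵐ x ∂((Measure.pi fun _ : ι => gaussianReal 0 s).map (fun w => dot w a)), x ≠ 0 := by
    rw [map_dot_gaussian]
    have := nullSingletonClass_gaussianReal (μ := 0) hv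
    rw [ae_iff]
    simp
  exact ae_of_ae_map hm.aemeasurable h1

lemma measurePreserving_neg_gaussian (s : ℝ≥0) :
    MeasurePreserving (fun w : ι → ℝ => -w) (Measure.pi fun _ : ι => gaussianReal 0 s)
      (Measure.pi fun _ : ι => gaussianReal 0 s) := by
  have h : ∀ i : ι, MeasurePreserving (fun x : ℝ => -x) (gaussianReal 0 s) (gaussianReal 0 s) :=
    fun _ => ⟨measurable_neg, by rw [gaussianReal_map_neg, neg_zero]⟩
  exact measurePreserving_pi (fun _ : ι => gaussianReal 0 s) (fun _ : ι => gaussianReal 0 s) h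

/-- The fourth moment of a standard Gaussian variable. -/
noncomputable def gaussFourth : ENNReal := ∫⁻ x, ENNReal.ofReal (x ^ 2) ^ 2 ∂gaussianReal 0 1

/-- The moment of order `-1/2` of a standard Gaussian variable. -/
noncomputable def gaussNeg : ENNReal :=
  ∫⁻ x, ENNReal.ofReal (x ^ 2) ^ (-(1 / 4) : ℝ) ∂gaussianReal 0 1

lemma gaussFourth_lt_top : gaussFourth < ⊤ := by
  have h1 : Integrable (fun x : ℝ => ‖id x‖ ^ 4) (gaussianReal 0 1) :=
    (memLp_id_gaussianReal' 4 (by simp)).integrable_norm_pow (by norm_num)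
  have h2 := h1.lintegral_lt_top
  refine lt_of_le_of_lt (lintegral_mono fun x => ?_) h2
  rw [← ENNReal.ofReal_pow (sq_nonneg x)]
  apply ENNReal.ofReal_le_ofReal
  rw [id, Real.norm_eq_abs, ← sq_abs x, ← pow_mul]

/-- The integrand is `|x| ^ (-1/2)`, which is integrable at zero; as the density is even, the
negative half-line reduces to the positive one. -/
lemma gaussNeg_lt_top : gaussNeg < ⊤ := by
  set F : ℝ → ENNReal := fun x => ENNReal.ofReal (x ^ 2) ^ (-(1 / 4) : ℝ) * gaussianPDF 0 1 x
  have hF : Measurable F := by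
    have := measurable_gaussianPDF 0 1
    fun_prop
  have h1 : gaussNeg = ∫⁻ x, F x := by
    rw [gaussNeg, gaussianReal_of_var_ne_zero _ one_ne_zero,
      lintegral_withDensity_eq_lintegral_mul _ (measurable_gaussianPDF 0 1) (by fun_prop)]
    simp only [Pi.mul_apply, F, mul_comm]
  have hpos : ∫⁻ x in Set.Ioi 0, F x < ⊤ := by
    have h2 := ((integrableOn_rpow_mul_exp_neg_mul_sq (b := 1 / 2) (by norm_num)
      (s := -(1 / 2)) (by norm_num)).const_mul (√(2 * Real.pi))⁻¹).lintegral_lt_top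
    refine lt_of_le_of_lt (le_of_eq ?_) h2
    apply setLIntegral_congr_fun measurableSet_Ioi
    intro x hx
    have hx' : (0 : ℝ) < x := hx
    simp only [F, gaussianPDF, gaussianPDFReal]
    rw [ENNReal.ofReal_rpow_of_pos (by positivity), ← ENNReal.ofReal_mul (by positivity)]
    congr 1
    have h3 : (x ^ 2) ^ (-(1 / 4) : ℝ) = x ^ (-(1 / 2) : ℝ) := by
      rw [← Real.rpow_natCast, ← Real.rpow_mul hx'.le]
      norm_num
    rw [h3]
    simp
    ring_nf
  have hneg : ∫⁻ x in Set.Iio 0, F x = ∫⁻ x in Set.Ioi 0, F x := by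
    have h2 := (Measure.measurePreserving_neg (volume : Measure ℝ)).setLIntegral_comp_preimage
      (measurableSet_Ioi (a := (0 : ℝ))) hF
    rw [← h2]
    simp only [Set.neg_preimage, Set.neg_Ioi, neg_zero]
    apply lintegral_congr
    intro x
    simp [F, gaussianPDF, gaussianPDFReal]
  rw [h1, ← setLIntegral_univ, ← Set.Iio_union_Ici (a := (0 : ℝ))]
  refine lt_of_le_of_lt (lintegral_union_le _ _ _) ?_
  rw [hneg, setLIntegral_congr Ioi_ae_eq_Ici.symm]
  exact ENNReal.add_lt_top.2 ⟨hpos, hpos⟩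

end Gaussian

/-! ### Jensen's inequality for the powers `2` and `-1/4`. -/

section Jensen

variable {Y : Type*} [MeasurableSpace Y] {μ : Measure Y} [IsProbabilityMeasure μ]

lemma sq_lintegral_le {f : Y → ENNReal} (hf : AEMeasurable f μ) :
    (∫⁻ y, f y ∂μ) ^ 2 ≤ ∫⁻ y, f y ^ 2 ∂μ := by
  have h := ENNReal.lintegral_mul_le_Lp_mul_Lq μ Real.HolderConjugate.two_two hf
    (aemeasurable_const (b := (1 : ENNReal)))
  simp only [Pi.mul_apply, mul_one, ENNReal.one_rpow, lintegral_const, measure_univ] at h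
  have h2 := ENNReal.rpow_le_rpow h (z := 2) (by norm_num)
  rw [← ENNReal.rpow_mul, one_div, inv_mul_cancel₀ two_ne_zero, ENNReal.rpow_one] at h2
  simpa only [ENNReal.rpow_two] using h2

lemma rpow_neg_lintegral_le {f : Y → ENNReal} (hf : AEMeasurable f μ) (hfin : ∀ y, f y ≠ ⊤) :
    (∫⁻ y, f y ∂μ) ^ (-(1 / 4) : ℝ) ≤ ∫⁻ y, f y ^ (-(1 / 4) : ℝ) ∂μ := by
  by_cases hB : ∫⁻ y, f y ^ (-(1 / 4) : ℝ) ∂μ = ⊤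
  · rw [hB]; exact le_top
  have hpos : ∀ᵐ y ∂μ, f y ≠ 0 := by
    filter_upwards [ae_lt_top' (hf.pow_const _) hB] with y hy h0
    rw [h0, ENNReal.zero_rpow_of_neg (by norm_num)] at hy
    exact lt_irrefl _ hy
  -- Hölder's inequality for `1 = f ^ (1/5) * f ^ (-1/5)` gives `1 ≤ A ^ (1/5) * B ^ (4/5)`; raising
  -- to the power `5/4` yields `A ^ (-1/4) ≤ B`.
  have hconj : Real.HolderConjugate 5 (5 / 4) := by
    rw [Real.holderConjugate_iff]; norm_num
  have h := ENNReal.lintegral_mul_le_Lp_mul_Lq μ hconj (hf.pow_const (1 / 5 : ℝ))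
    (hf.pow_const (-(1 / 5) : ℝ))
  have h1 : ∫⁻ y, ((fun y => f y ^ (1 / 5 : ℝ)) * fun y => f y ^ (-(1 / 5) : ℝ)) y ∂μ = 1 := by
    rw [← measure_univ (μ := μ), ← lintegral_one]
    apply lintegral_congr_ae
    filter_upwards [hpos] with y hy
    simp only [Pi.mul_apply]
    rw [← ENNReal.rpow_add _ _ hy (hfin y)]
    norm_num
  rw [h1] at h
  simp only [← ENNReal.rpow_mul] at h
  norm_num at h
  set A := ∫⁻ y, f y ∂μ
  set B := ∫⁻ y, f y ^ (-(1 / 4) : ℝ) ∂μ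
  by_cases hA : A = ⊤
  · rw [hA, ENNReal.top_rpow_of_neg (by norm_num)]; exact zero_le
  by_cases hA0 : A = 0
  · exfalso
    rw [lintegral_eq_zero_iff' hf] at hA0
    have h3 : ∀ᵐ y ∂μ, False := by
      filter_upwards [hA0, hpos] with y h1 h2
      exact h2 h1
    exact IsProbabilityMeasure.ne_zero μ (by simpa using h3)
  have h2 : A ^ (-(1 / 5) : ℝ) ≤ B ^ (4 / 5 : ℝ) := by
    calc A ^ (-(1 / 5) : ℝ) = A ^ (-(1 / 5) : ℝ) * 1 := (mul_one _).symm
      _ ≤ A ^ (-(1 / 5) : ℝ) * (A ^ (1 / 5 : ℝ) * B ^ (4 / 5 : ℝ)) := by gcongr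
      _ = B ^ (4 / 5 : ℝ) := by
        rw [← mul_assoc, ← ENNReal.rpow_add _ _ hA0 hA]
        norm_num
  have h3 := ENNReal.rpow_le_rpow h2 (z := 5 / 4) (by norm_num)
  rw [← ENNReal.rpow_mul, ← ENNReal.rpow_mul] at h3
  norm_num at h3
  exact h3

end Jensen

/-! ### The derivative of the activation function at opposite points. -/

lemma measurable_reluDeriv : Measurable reluDeriv := by
  unfold reluDeriv
  exact Measurable.ite (measurableSet_lt measurable_id measurable_const) measurable_const
    (Measurable.ite (measurableSet_eq_fun measurable_id measurable_const) measurable_const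
      measurable_const)

lemma reluDeriv_nonneg (t : ℝ) : 0 ≤ reluDeriv t := by
  unfold reluDeriv; split_ifs <;> norm_num

lemma reluDeriv_le_one (t : ℝ) : reluDeriv t ≤ 1 := by
  unfold reluDeriv; split_ifs <;> norm_num

lemma reluDeriv_sq_le_one (t : ℝ) : reluDeriv t ^ 2 ≤ 1 :=
  pow_le_one₀ (reluDeriv_nonneg t) (reluDeriv_le_one t)

lemma half_le_reluDeriv_sq_add (t : ℝ) : 1 / 2 ≤ reluDeriv t ^ 2 + reluDeriv (-t) ^ 2 := by
  unfold reluDeriv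
  rcases lt_trichotomy t 0 with h | h | h
  · simp [h, (neg_pos.2 h).not_gt, (neg_pos.2 h).ne']; norm_num
  · subst h; simp; norm_num
  · simp [h, h.not_gt, h.ne']; norm_num

lemma reluDeriv_sq_add {t : ℝ} (ht : t ≠ 0) : reluDeriv t ^ 2 + reluDeriv (-t) ^ 2 = 1 := by
  unfold reluDeriv
  rcases lt_trichotomy t 0 with h | h | h
  · simp [h, (neg_pos.2 h).not_gt, (neg_pos.2 h).ne']
  · exact absurd h ht
  · simp [h, h.not_gt, h.ne']

/-! ### Gaussian channels satisfy the abstract hypotheses, with universal moment bounds. -/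

section Channel

variable {ι : Type*} [Fintype ι] {Y : Type*} [MeasurableSpace Y] (Q : Measure Y)
  [IsProbabilityMeasure Q] (u v : Y → ι → ℝ)

/-- The energy of the output channel with weights `w`, when the data `y` has law `Q`, the signal
in the receptive field is `u y` and the noise in the receptive field is `v y`. -/
noncomputable def channelEnergy (w : ι → ℝ) : ℝ :=
  ∫ y, reluDeriv (dot w (u y)) ^ 2 * dot w (v y) ^ 2 ∂Q

variable {Q u v}

lemma integrable_normSq (hv2 : ∀ i, MemLp (fun y => v y i) 2 Q) :
    Integrable (fun y => ∑ i, v y i ^ 2) Q :=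
  integrable_finsetSum _ fun i _ => (hv2 i).integrable_sq

lemma integrable_dot_sq (hv : Measurable v) (hv2 : ∀ i, MemLp (fun y => v y i) 2 Q) (w : ι → ℝ) :
    Integrable (fun y => dot w (v y) ^ 2) Q := by
  refine ((integrable_normSq hv2).const_mul (∑ i, w i ^ 2)).mono'
    ((measurable_dot measurable_const hv).pow_const 2).aestronglyMeasurable ?_
  filter_upwards with y
  rw [Real.norm_of_nonneg (sq_nonneg _)]
  exact dot_sq_le w (v y)

lemma integrable_channel (hu : Measurable u) (hv : Measurable v)
    (hv2 : ∀ i, MemLp (fun y => v y i) 2 Q) (w : ι → ℝ) :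
    Integrable (fun y => reluDeriv (dot w (u y)) ^ 2 * dot w (v y) ^ 2) Q := by
  refine (integrable_dot_sq hv hv2 w).mono'
    (((measurable_reluDeriv.comp (measurable_dot measurable_const hu)).pow_const 2).mul
      ((measurable_dot measurable_const hv).pow_const 2)).aestronglyMeasurable ?_
  filter_upwards with y
  rw [Real.norm_of_nonneg (mul_nonneg (sq_nonneg _) (sq_nonneg _))]
  exact mul_le_of_le_one_left (sq_nonneg _) (reluDeriv_sq_le_one _)

lemma channelEnergy_nonneg (w : ι → ℝ) : 0 ≤ channelEnergy Q u v w :=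
  integral_nonneg fun _ => mul_nonneg (sq_nonneg _) (sq_nonneg _)

lemma measurable_channelEnergy (hu : Measurable u) (hv : Measurable v) :
    Measurable (channelEnergy Q u v) := by
  have h1 : Measurable fun p : (ι → ℝ) × Y =>
      reluDeriv (dot p.1 (u p.2)) ^ 2 * dot p.1 (v p.2) ^ 2 :=
    ((measurable_reluDeriv.comp (measurable_dot measurable_fst (hu.comp measurable_snd))).pow_const
      2).mul ((measurable_dot measurable_fst (hv.comp measurable_snd)).pow_const 2)
  exact h1.stronglyMeasurable.integral_prod_right.measurable

lemma channelEnergy_le (hu : Measurable u) (hv : Measurable v)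
    (hv2 : ∀ i, MemLp (fun y => v y i) 2 Q) (w : ι → ℝ) :
    channelEnergy Q u v w ≤ ∫ y, dot w (v y) ^ 2 ∂Q :=
  integral_mono (integrable_channel hu hv hv2 w) (integrable_dot_sq hv hv2 w) fun _ =>
    mul_le_of_le_one_left (sq_nonneg _) (reluDeriv_sq_le_one _)

lemma channelEnergy_add_neg_ge (hu : Measurable u) (hv : Measurable v)
    (hv2 : ∀ i, MemLp (fun y => v y i) 2 Q) (w : ι → ℝ) :
    (∫ y, dot w (v y) ^ 2 ∂Q) / 2 ≤ channelEnergy Q u v w + channelEnergy Q u v (-w) := by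
  rw [channelEnergy, channelEnergy,
    ← integral_add (integrable_channel hu hv hv2 w) (integrable_channel hu hv hv2 (-w)),
    ← integral_div]
  apply integral_mono ((integrable_dot_sq hv hv2 w).div_const 2)
    ((integrable_channel hu hv hv2 w).add (integrable_channel hu hv hv2 (-w)))
  intro y
  simp only [dot_neg_left, neg_sq, Pi.add_apply]
  have := half_le_reluDeriv_sq_add (dot w (u y))
  nlinarith [sq_nonneg (dot w (v y))]

/-- Opposite weights have the same law, and the squared derivatives at opposite points sum to one
outside the null hyperplane orthogonal to `a`, so half of the linear energy passes. If `a = 0` the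
squared derivative is always `1 / 4` instead of `1 / 2` on average, so `b` must vanish too. -/
lemma integral_reluDeriv_dot (s : ℝ≥0) (hs : s ≠ 0) (a b : ι → ℝ) (hab : a = 0 → b = 0) :
    Integrable (fun w => reluDeriv (dot w a) ^ 2 * dot w b ^ 2)
      (Measure.pi fun _ : ι => gaussianReal 0 s) ∧
    ∫ w, reluDeriv (dot w a) ^ 2 * dot w b ^ 2 ∂(Measure.pi fun _ : ι => gaussianReal 0 s) =
      s * (∑ i, b i ^ 2) / 2 := by
  set γ := Measure.pi fun _ : ι => gaussianReal 0 s
  obtain ⟨h1, h2⟩ := integral_dot_sq s b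
  have hneg : MeasurePreserving (fun w : ι → ℝ => -w) γ γ := measurePreserving_neg_gaussian s
  have hi : Integrable (fun w => reluDeriv (dot w a) ^ 2 * dot w b ^ 2) γ := by
    refine h1.mono' (((measurable_reluDeriv.comp
      (measurable_dot measurable_id measurable_const)).pow_const 2).mul
        ((measurable_dot measurable_id measurable_const).pow_const 2)).aestronglyMeasurable ?_
    filter_upwards with y
    rw [Real.norm_of_nonneg (mul_nonneg (sq_nonneg _) (sq_nonneg _))]
    exact mul_le_of_le_one_left (sq_nonneg _) (reluDeriv_sq_le_one _)
  refine ⟨hi, ?_⟩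
  have h3 : ∫ w, reluDeriv (dot (-w) a) ^ 2 * dot (-w) b ^ 2 ∂γ =
      ∫ w, reluDeriv (dot w a) ^ 2 * dot w b ^ 2 ∂γ :=
    hneg.integral_comp (MeasurableEquiv.neg (ι → ℝ)).measurableEmbedding
      (fun w => reluDeriv (dot w a) ^ 2 * dot w b ^ 2)
  have hi' : Integrable (fun w => reluDeriv (dot (-w) a) ^ 2 * dot (-w) b ^ 2) γ :=
    hneg.integrable_comp_of_integrable hi
  have h4 : ∫ w, reluDeriv (dot w a) ^ 2 * dot w b ^ 2 ∂γ +
      ∫ w, reluDeriv (dot (-w) a) ^ 2 * dot (-w) b ^ 2 ∂γ = ∫ w, dot w b ^ 2 ∂γ := by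
    rw [← integral_add hi hi']
    apply integral_congr_ae
    by_cases ha : a = 0
    · filter_upwards with w
      simp [hab ha, dot]
    · filter_upwards [ae_dot_ne_zero hs ha] with w hw
      simp only [dot_neg_left, neg_sq]
      rw [← add_mul, reluDeriv_sq_add hw, one_mul]
  rw [h3, h2] at h4
  linarith

variable [Nonempty ι] {s : ℝ≥0} {ν : ℝ}

/-- The probability that `D` weights of a channel are at most `1 / (4 * D)` in absolute value. -/
noncomputable def smallProb (D : ℕ) : ℝ :=
  (gaussianReal 0 (2 / D : ℝ≥0)).real (Set.Icc (-(1 / (4 * D) : ℝ)) (1 / (4 * D))) ^ D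

lemma smallProb_pos {D : ℕ} (hD : 0 < D) : 0 < smallProb D := by
  have hs : (2 / D : ℝ≥0) ≠ 0 := by positivity
  refine pow_pos ?_ _
  rw [measureReal_def, ENNReal.toReal_pos_iff]
  refine ⟨?_, measure_lt_top _ _⟩
  rw [pos_iff_ne_zero]
  intro h
  have h2 := gaussianReal_absolutelyContinuous' 0 hs h
  rw [Real.volume_Icc, ENNReal.ofReal_eq_zero] at h2
  have : (0 : ℝ) < 1 / (4 * D) := by positivity
  linarith

lemma smallProb_le_one (D : ℕ) : smallProb D ≤ 1 :=
  pow_le_one₀ measureReal_nonneg measureReal_le_one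

/-- The set of small weights of a channel. -/
def smallSet (ι : Type*) [Fintype ι] : Set (ι → ℝ) :=
  Set.univ.pi fun _ => Set.Icc (-(1 / (4 * Fintype.card ι) : ℝ)) (1 / (4 * Fintype.card ι))

/-- The set of weights used to break ties between opposite weights. -/
def tieSet (ι : Type*) [Fintype ι] : Set (ι → ℝ) := {w | 0 < dot w 1}

/-- The energy of a channel without activation function, with a normalization. -/
noncomputable def linearEnergy (Q : Measure Y) (v : Y → ι → ℝ) (ν : ℝ) (w : ι → ℝ) : ℝ :=
  (∫ y, dot w (v y) ^ 2 ∂Q) / (2 * ν)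

/-- Under the law `Q'` with density proportional to `‖v y‖²` with respect to `Q`, the linear energy
is a mean of variables `g w y`, each of which has in `w` the law of a squared standard Gaussian
variable. Jensen's inequality and Fubini's theorem then give bounds free of the data law and of the
dimension. -/
lemma linearEnergy_moments (hv : Measurable v) (hv2 : ∀ i, MemLp (fun y => v y i) 2 Q)
    (hν : 0 < ν) (hτ : ∫ y, ∑ i, v y i ^ 2 ∂Q = Fintype.card ι * ν)
    (hs : s = 2 / (Fintype.card ι : ℝ≥0)) :
    ∫⁻ w, ENNReal.ofReal (linearEnergy Q v ν w) ^ 2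
        ∂(Measure.pi fun _ : ι => gaussianReal 0 s) ≤ gaussFourth ∧
    ∫⁻ w, ENNReal.ofReal (linearEnergy Q v ν w) ^ (-(1 / 4) : ℝ)
        ∂(Measure.pi fun _ : ι => gaussianReal 0 s) ≤ gaussNeg := by
  set γ := Measure.pi fun _ : ι => gaussianReal 0 s
  set D : ℝ := (Fintype.card ι : ℝ) with hD
  have hDpos : 0 < D := by rw [hD]; exact_mod_cast Fintype.card_pos
  have hτpos : 0 < D * ν := by positivity
  set n2 : Y → ℝ := fun y => ∑ i, v y i ^ 2 with hn2
  have hn2nn : ∀ y, 0 ≤ n2 y := fun y => Finset.sum_nonneg fun i _ => sq_nonneg _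
  have hn2m : Measurable n2 := by simp only [hn2]; fun_prop
  set wt : Y → ENNReal := fun y => ENNReal.ofReal (n2 y / (D * ν))
  have hwtm : Measurable wt := (hn2m.div_const _).ennreal_ofReal
  set Q' := Q.withDensity wt
  have hR : IsProbabilityMeasure Q' := by
    constructor
    rw [withDensity_apply _ MeasurableSet.univ, Measure.restrict_univ,
      ← ofReal_integral_eq_lintegral_ofReal ((integrable_normSq hv2).div_const _)
        (Filter.Eventually.of_forall fun y => div_nonneg (hn2nn y) hτpos.le),
      integral_div, hτ, div_self hτpos.ne', ENNReal.ofReal_one]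
  have hRne : ∀ᵐ y ∂Q', n2 y ≠ 0 := by
    rw [ae_withDensity_iff hwtm]
    filter_upwards with y hy h0
    simp [wt, h0] at hy
  set g : (ι → ℝ) → Y → ℝ := fun w y => D / (2 * n2 y) * dot w (v y) ^ 2 with hg
  have hgm : Measurable fun p : (ι → ℝ) × Y => g p.1 p.2 := by
    have h1 : Measurable fun p : (ι → ℝ) × Y => dot p.1 (v p.2) :=
      measurable_dot measurable_fst (hv.comp measurable_snd)
    have h2 : Measurable fun p : (ι → ℝ) × Y => n2 p.2 := hn2m.comp measurable_snd
    exact (measurable_const.div (h2.const_mul 2)).mul (h1.pow_const 2)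
  have hgw : ∀ w, Measurable fun y => ENNReal.ofReal (g w y) := fun w =>
    (hgm.comp (measurable_const.prodMk measurable_id)).ennreal_ofReal
  have hlin : ∀ w, ENNReal.ofReal (linearEnergy Q v ν w) = ∫⁻ y, ENNReal.ofReal (g w y) ∂Q' := by
    intro w
    rw [lintegral_withDensity_eq_lintegral_mul _ hwtm (hgw w), linearEnergy, ← integral_div,
      ofReal_integral_eq_lintegral_ofReal ((integrable_dot_sq hv hv2 w).div_const _)
        (Filter.Eventually.of_forall fun y => div_nonneg (sq_nonneg _) (by positivity))]
    apply lintegral_congr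
    intro y
    simp only [Pi.mul_apply, wt]
    rw [← ENNReal.ofReal_mul (div_nonneg (hn2nn y) hτpos.le)]
    congr 1
    -- Where `v y = 0` the quotient in `g` takes the default value zero, and the scalar product
    -- vanishes by Cauchy–Schwarz, so both sides are zero.
    by_cases h0 : n2 y = 0
    · have h1 := dot_sq_le w (v y)
      change _ ≤ _ * n2 y at h1
      rw [h0, mul_zero] at h1
      have h2 : dot w (v y) ^ 2 = 0 := le_antisymm h1 (sq_nonneg _)
      simp [hg, h0, h2]
    · simp only [hg]
      field_simp
  have hlaw : ∀ y, n2 y ≠ 0 → ∀ F : ℝ → ENNReal, Measurable F →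
      ∫⁻ w, F (g w y) ∂γ = ∫⁻ x, F (x ^ 2) ∂gaussianReal 0 1 := by
    intro y hy F hF
    have hypos : 0 < n2 y := lt_of_le_of_ne (hn2nn y) (Ne.symm hy)
    -- This factor makes the variance of `dot w (r • v y)` equal to `(2 / D) * (D / 2) = 1`.
    set r := √(D / (2 * n2 y)) with hr
    have hr2 : r ^ 2 = D / (2 * n2 y) := Real.sq_sqrt (by positivity)
    have h1 : ∀ w, g w y = dot w (r • v y) ^ 2 := by
      intro w
      have : dot w (r • v y) = r * dot w (v y) := by
        simp only [dot, Pi.smul_apply, smul_eq_mul, Finset.mul_sum]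
        exact Finset.sum_congr rfl fun i _ => by ring
      rw [this, mul_pow, hr2]
    have h2 := map_dot_gaussian s (r • v y)
    have h3 : s * Real.toNNReal (∑ i, (r • v y) i ^ 2) = 1 := by
      apply NNReal.coe_injective
      rw [NNReal.coe_mul, Real.coe_toNNReal _ (Finset.sum_nonneg fun i _ => sq_nonneg _), hs]
      simp only [Pi.smul_apply, smul_eq_mul, mul_pow, ← Finset.mul_sum, hr2]
      change ((2 / (Fintype.card ι : ℝ≥0) : ℝ≥0) : ℝ) * (D / (2 * n2 y) * n2 y) = _
      push_cast
      rw [← hD]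
      field_simp
    rw [h3] at h2
    simp only [h1]
    have h4 : Measurable fun w : ι → ℝ => dot w (r • v y) :=
      measurable_dot measurable_id measurable_const
    have h5 : Measurable fun x : ℝ => F (x ^ 2) := by fun_prop
    rw [← h2, lintegral_map h5 h4]
  have hsw : ∀ F : ENNReal → ENNReal, Measurable F →
      ∫⁻ w, ∫⁻ y, F (ENNReal.ofReal (g w y)) ∂Q' ∂γ =
        ∫⁻ x, F (ENNReal.ofReal (x ^ 2)) ∂gaussianReal 0 1 := by
    intro F hF
    have hm : Measurable (Function.uncurry fun w y => F (ENNReal.ofReal (g w y))) :=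
      hF.comp hgm.ennreal_ofReal
    rw [lintegral_lintegral_swap hm.aemeasurable]
    have : ∫⁻ y, ∫⁻ w, F (ENNReal.ofReal (g w y)) ∂γ ∂Q' =
        ∫⁻ _y, ∫⁻ x, F (ENNReal.ofReal (x ^ 2)) ∂gaussianReal 0 1 ∂Q' := by
      apply lintegral_congr_ae
      filter_upwards [hRne] with y hy
      exact hlaw y hy (fun x => F (ENNReal.ofReal x)) (hF.comp ENNReal.measurable_ofReal)
    rw [this, lintegral_const, measure_univ, mul_one]
  constructor
  · calc _ ≤ ∫⁻ w, ∫⁻ y, ENNReal.ofReal (g w y) ^ 2 ∂Q' ∂γ := by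
          apply lintegral_mono
          intro w
          simp only [hlin]
          exact sq_lintegral_le (hgw w).aemeasurable
      _ = gaussFourth := hsw (fun x => x ^ 2) (by fun_prop)
  · calc _ ≤ ∫⁻ w, ∫⁻ y, ENNReal.ofReal (g w y) ^ (-(1 / 4) : ℝ) ∂Q' ∂γ := by
          apply lintegral_mono
          intro w
          simp only [hlin]
          exact rpow_neg_lintegral_le (hgw w).aemeasurable fun y => ENNReal.ofReal_ne_top
      _ = gaussNeg := hsw (fun x => x ^ (-(1 / 4) : ℝ)) (by fun_prop)

/-- Comparison with the linear energy: `Z w ≤ 2 * linearEnergy`, whence the factor `4` in the second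
moment, and `Z w + Z (-w) ≥ linearEnergy`, whence the negative moment. The second inequality holds
even at the kink, where the squared derivatives sum to `1 / 2`. Mean one follows from Fubini's
theorem and the halving of the energy at each data point. -/
theorem isChannel_channelEnergy (hu : Measurable u) (hv : Measurable v)
    (hv2 : ∀ i, MemLp (fun y => v y i) 2 Q) (huv : ∀ᵐ y ∂Q, u y = 0 → v y = 0)
    (hν : 0 < ν) (hτ : ∫ y, ∑ i, v y i ^ 2 ∂Q = Fintype.card ι * ν)
    (hs : s = 2 / (Fintype.card ι : ℝ≥0)) {s₀ : ℝ} (hs0 : 0 < s₀)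
    (hs0' : s₀ ≤ smallProb (Fintype.card ι)) :
    IsChannel (Measure.pi fun _ : ι => gaussianReal 0 s) (fun w => channelEnergy Q u v w / ν)
      (tieSet ι) (smallSet ι) (4 * gaussFourth.toReal) gaussNeg.toReal s₀ := by
  set γ := Measure.pi fun _ : ι => gaussianReal 0 s
  have hDpos : 0 < (Fintype.card ι : ℝ) := by exact_mod_cast Fintype.card_pos
  have hsne : s ≠ 0 := by
    rw [hs]
    have : (0 : ℝ≥0) < Fintype.card ι := by exact_mod_cast Fintype.card_pos
    positivity
  have hneg : MeasurePreserving (fun w : ι → ℝ => -w) γ γ := measurePreserving_neg_gaussian s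
  set Z : (ι → ℝ) → ℝ := fun w => channelEnergy Q u v w / ν
  have hZm : Measurable Z := (measurable_channelEnergy hu hv).div_const _
  have hZnn : ∀ w, 0 ≤ Z w := fun w => div_nonneg (channelEnergy_nonneg w) hν.le
  have hlinm : Measurable (linearEnergy Q v ν) := by
    have h1 : Measurable fun p : (ι → ℝ) × Y => dot p.1 (v p.2) ^ 2 :=
      (measurable_dot measurable_fst (hv.comp measurable_snd)).pow_const 2
    exact h1.stronglyMeasurable.integral_prod_right.measurable.div_const _
  have hlinnn : ∀ w, 0 ≤ linearEnergy Q v ν w := fun w =>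
    div_nonneg (integral_nonneg fun _ => sq_nonneg _) (by positivity)
  have hZle : ∀ w, Z w ≤ 2 * linearEnergy Q v ν w := by
    intro w
    have h1 := channelEnergy_le hu hv hv2 w
    simp only [Z, linearEnergy]
    rw [div_le_iff₀ hν]
    field_simp
    exact h1
  have hZge : ∀ w, linearEnergy Q v ν w ≤ Z w + Z (-w) := by
    intro w
    have h1 := channelEnergy_add_neg_ge hu hv hv2 w
    simp only [Z, linearEnergy]
    rw [← add_div, div_le_div_iff₀ (by positivity) hν]
    nlinarith
  obtain ⟨hM4, hMneg⟩ := linearEnergy_moments hv hv2 hν hτ hs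
  have hsq : ∫⁻ w, ENNReal.ofReal (Z w ^ 2) ∂γ ≤ 4 * gaussFourth := by
    calc ∫⁻ w, ENNReal.ofReal (Z w ^ 2) ∂γ
        ≤ ∫⁻ w, 4 * ENNReal.ofReal (linearEnergy Q v ν w) ^ 2 ∂γ := by
          apply lintegral_mono
          intro w
          change ENNReal.ofReal (Z w ^ 2) ≤ 4 * ENNReal.ofReal (linearEnergy Q v ν w) ^ 2
          rw [← ENNReal.ofReal_pow (hlinnn w),
            show (4 : ENNReal) = ENNReal.ofReal 4 by simp, ← ENNReal.ofReal_mul (by norm_num)]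
          apply ENNReal.ofReal_le_ofReal
          calc Z w ^ 2 ≤ (2 * linearEnergy Q v ν w) ^ 2 := pow_le_pow_left₀ (hZnn w) (hZle w) 2
            _ = _ := by ring
      _ = 4 * ∫⁻ w, ENNReal.ofReal (linearEnergy Q v ν w) ^ 2 ∂γ :=
          lintegral_const_mul _ (hlinm.ennreal_ofReal.pow_const 2)
      _ ≤ 4 * gaussFourth := by gcongr
  have h4fin : 4 * gaussFourth < ⊤ := ENNReal.mul_lt_top (by simp) gaussFourth_lt_top
  have hZ2i : Integrable (fun w => Z w ^ 2) γ :=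
    (lintegral_ofReal_ne_top_iff_integrable (hZm.pow_const 2).aestronglyMeasurable
      (Filter.Eventually.of_forall fun w => sq_nonneg _)).1 (hsq.trans_lt h4fin).ne
  have hlinpos : ∀ᵐ w ∂γ, 0 < linearEnergy Q v ν w := by
    have h1 := ae_lt_top (hlinm.ennreal_ofReal.pow_const (-(1 / 4) : ℝ))
      (hMneg.trans_lt gaussNeg_lt_top).ne
    filter_upwards [h1] with w hw
    by_contra h0
    rw [ENNReal.ofReal_of_nonpos (not_lt.1 h0), ENNReal.zero_rpow_of_neg (by norm_num)] at hw
    exact lt_irrefl _ hw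
  have hpos : ∀ᵐ w ∂γ, 0 < Z w + Z (-w) := by
    filter_upwards [hlinpos] with w hw
    exact hw.trans_le (hZge w)
  have hinvm : Measurable fun w => (Z w + Z (-w)) ^ (-(1 / 4) : ℝ) :=
    (hZm.add (hZm.comp hneg.measurable)).pow_const _
  have hinvnn : ∀ w, 0 ≤ (Z w + Z (-w)) ^ (-(1 / 4) : ℝ) := fun w =>
    Real.rpow_nonneg (add_nonneg (hZnn _) (hZnn _)) _
  have hinv : ∫⁻ w, ENNReal.ofReal ((Z w + Z (-w)) ^ (-(1 / 4) : ℝ)) ∂γ ≤ gaussNeg := by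
    refine le_trans (lintegral_mono_ae ?_) hMneg
    filter_upwards [hlinpos] with w hw
    rw [ENNReal.ofReal_rpow_of_pos hw]
    apply ENNReal.ofReal_le_ofReal
    exact Real.rpow_le_rpow_of_nonpos hw (hZge w) (by norm_num)
  have hinvi : Integrable (fun w => (Z w + Z (-w)) ^ (-(1 / 4) : ℝ)) γ :=
    (lintegral_ofReal_ne_top_iff_integrable hinvm.aestronglyMeasurable
      (Filter.Eventually.of_forall hinvnn)).1 (hinv.trans_lt gaussNeg_lt_top).ne
  refine ⟨hneg, hZm, hZnn, ?_, ?_, ?_, hpos, hinvi, ?_, ?_, ?_, ?_, ?_, hs0, ?_, ?_⟩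
  · have h1 : ∫⁻ w, ENNReal.ofReal (Z w) ∂γ = 1 := by
      have h2 : ∀ w, ENNReal.ofReal (Z w) = ∫⁻ y, ENNReal.ofReal
          (reluDeriv (dot w (u y)) ^ 2 * dot w (v y) ^ 2 / ν) ∂Q := by
        intro w
        simp only [Z, channelEnergy]
        rw [← integral_div, ofReal_integral_eq_lintegral_ofReal
          ((integrable_channel hu hv hv2 w).div_const _)
          (Filter.Eventually.of_forall fun y =>
            div_nonneg (mul_nonneg (sq_nonneg _) (sq_nonneg _)) hν.le)]
      simp only [h2]
      have hm : Measurable (Function.uncurry fun (w : ι → ℝ) (y : Y) => ENNReal.ofReal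
          (reluDeriv (dot w (u y)) ^ 2 * dot w (v y) ^ 2 / ν)) :=
        ((((measurable_reluDeriv.comp (measurable_dot measurable_fst
          (hu.comp measurable_snd))).pow_const 2).mul ((measurable_dot measurable_fst
            (hv.comp measurable_snd)).pow_const 2)).div_const _).ennreal_ofReal
      rw [lintegral_lintegral_swap hm.aemeasurable]
      have h3 : ∫⁻ y, ∫⁻ w, ENNReal.ofReal
          (reluDeriv (dot w (u y)) ^ 2 * dot w (v y) ^ 2 / ν) ∂γ ∂Q =
          ∫⁻ y, ENNReal.ofReal ((∑ i, v y i ^ 2) / (Fintype.card ι * ν)) ∂Q := by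
        apply lintegral_congr_ae
        filter_upwards [huv] with y hy
        obtain ⟨h4, h5⟩ := integral_reluDeriv_dot s hsne (u y) (v y) hy
        rw [← ofReal_integral_eq_lintegral_ofReal (h4.div_const _)
          (Filter.Eventually.of_forall fun y =>
            div_nonneg (mul_nonneg (sq_nonneg _) (sq_nonneg _)) hν.le), integral_div, h5, hs]
        congr 1
        push_cast
        field_simp
      rw [h3, ← ofReal_integral_eq_lintegral_ofReal ((integrable_normSq hv2).div_const _)
        (Filter.Eventually.of_forall fun y =>
          div_nonneg (Finset.sum_nonneg fun i _ => sq_nonneg _) (by positivity)), integral_div, hτ,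
        div_self (by positivity), ENNReal.ofReal_one]
    rw [integral_eq_lintegral_of_nonneg_ae (Filter.Eventually.of_forall hZnn)
      hZm.aestronglyMeasurable, h1, ENNReal.toReal_one]
  · exact (memLp_two_iff_integrable_sq hZm.aestronglyMeasurable).2 hZ2i
  · rw [integral_eq_lintegral_of_nonneg_ae (Filter.Eventually.of_forall fun w => sq_nonneg _)
      (hZm.pow_const 2).aestronglyMeasurable]
    have h1 := ENNReal.toReal_mono h4fin.ne hsq
    rwa [ENNReal.toReal_mul, ENNReal.toReal_ofNat] at h1
  · rw [integral_eq_lintegral_of_nonneg_ae (Filter.Eventually.of_forall hinvnn)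
      hinvm.aestronglyMeasurable]
    exact ENNReal.toReal_mono gaussNeg_lt_top.ne hinv
  · exact measurableSet_lt measurable_const (measurable_dot measurable_id measurable_const)
  · have h1 : (1 : ι → ℝ) ≠ 0 := one_ne_zero
    filter_upwards [ae_dot_ne_zero hsne h1] with w hw
    simp only [tieSet, Set.mem_ofPred_eq, dot_neg_left]
    rcases lt_or_gt_of_ne hw with h | h
    · exact ⟨fun _ => h.not_gt, fun _ => by linarith⟩
    · exact ⟨fun _ => by linarith, fun h2 => absurd h h2⟩
  · exact MeasurableSet.univ_pi fun _ => measurableSet_Icc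
  · intro w hw i _
    have := hw i trivial
    simp only [Set.mem_Icc, Pi.neg_apply] at this ⊢
    constructor <;> linarith
  · refine hs0'.trans (le_of_eq ?_)
    rw [smallSet, measureReal_def, Measure.pi_pi, ENNReal.toReal_prod, Finset.prod_const,
      Finset.card_univ, hs]
    rfl
  · intro w hw
    -- Entries of size at most `1 / (4 * D)` have squared norm at most `1 / (16 * D)`, so
    -- Cauchy–Schwarz bounds the energy by `ν / 16`.
    have h1 : ∑ i, w i ^ 2 ≤ Fintype.card ι * (1 / (4 * Fintype.card ι)) ^ 2 := by
      have h2 : ∑ i, w i ^ 2 ≤ ∑ _i : ι, (1 / (4 * Fintype.card ι) : ℝ) ^ 2 := by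
        apply Finset.sum_le_sum
        intro i _
        have := hw i trivial
        exact sq_le_sq' this.1 this.2
      simpa using h2
    have h2 : ∫ y, dot w (v y) ^ 2 ∂Q ≤ (∑ i, w i ^ 2) * (Fintype.card ι * ν) := by
      rw [← hτ, ← integral_const_mul]
      exact integral_mono (integrable_dot_sq hv hv2 w) ((integrable_normSq hv2).const_mul _)
        fun y => dot_sq_le w (v y)
    have h3 := (channelEnergy_le hu hv hv2 w).trans h2
    simp only [Z]
    rw [div_le_iff₀ hν]
    refine h3.trans ?_
    calc (∑ i, w i ^ 2) * (Fintype.card ι * ν)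
        ≤ (Fintype.card ι * (1 / (4 * Fintype.card ι)) ^ 2) * (Fintype.card ι * ν) := by gcongr
      _ = 1 / 16 * ν := by field_simp; norm_num
      _ ≤ 1 / 8 * ν := by gcongr; norm_num

end Channel

/-! ### Resampling one coordinate of a sequence of independent variables. -/

section Resampling

variable {X : ℕ → Type*} [∀ k, MeasurableSpace (X k)] (μ : ∀ k, Measure (X k))
  [∀ k, IsProbabilityMeasure (μ k)]

lemma measurable_update_prod (k : ℕ) :
    Measurable fun z : (∀ k, X k) × X k => Function.update z.1 k z.2 := by
  rw [measurable_pi_iff]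
  intro j
  by_cases hj : j = k
  · subst hj
    simpa using measurable_snd
  · simp only [Function.update_of_ne hj]
    exact (measurable_pi_apply j).comp measurable_fst

/-- Resampling one coordinate does not change the law of independent random variables. -/
lemma measurePreserving_update (k : ℕ) :
    MeasurePreserving (fun z : (∀ k, X k) × X k => Function.update z.1 k z.2)
      ((Measure.infinitePi μ).prod (μ k)) (Measure.infinitePi μ) := by
  refine ⟨measurable_update_prod k, ?_⟩
  apply Measure.eq_infinitePi
  intro s t ht
  have hm : MeasurableSet (Set.pi (s : Set ℕ) t) :=
    MeasurableSet.pi s.countable_toSet fun i _ => ht i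
  rw [Measure.map_apply (measurable_update_prod k) hm]
  by_cases hk : k ∈ s
  · have h1 : (fun z : (∀ k, X k) × X k => Function.update z.1 k z.2) ⁻¹' (Set.pi (s : Set ℕ) t) =
        (Set.pi (s.erase k : Finset ℕ) t) ×ˢ t k := by
      ext ⟨ω, w⟩
      simp only [Set.mem_preimage, Set.mem_pi, Finset.mem_coe, Set.mem_prod, Finset.mem_erase]
      constructor
      · intro h
        refine ⟨fun i hi => ?_, ?_⟩
        · have := h i hi.2
          rwa [Function.update_of_ne hi.1] at this
        · have := h k hk
          rwa [Function.update_self] at this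
      · rintro ⟨h1, h2⟩ i hi
        by_cases hik : i = k
        · subst hik; rwa [Function.update_self]
        · rw [Function.update_of_ne hik]; exact h1 i ⟨hik, hi⟩
    rw [h1, Measure.prod_prod, Measure.infinitePi_pi _ fun i _ => ht i,
      Finset.prod_erase_mul _ _ hk]
  · have h1 : (fun z : (∀ k, X k) × X k => Function.update z.1 k z.2) ⁻¹' (Set.pi (s : Set ℕ) t) =
        (Set.pi (s : Set ℕ) t) ×ˢ Set.univ := by
      ext ⟨ω, w⟩
      simp only [Set.mem_preimage, Set.mem_pi, Finset.mem_coe, Set.mem_prod, Set.mem_univ,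
        and_true]
      refine forall₂_congr fun i hi => ?_
      rw [Function.update_of_ne (by rintro rfl; exact hk hi)]
    rw [h1, Measure.prod_prod, Measure.infinitePi_pi _ fun i _ => ht i, measure_univ, mul_one]

lemma dependsOn_update {β : Type*} {f : (∀ k, X k) → β} {k : ℕ} (hf : DependsOn f (Set.Iio k))
    (ω : ∀ k, X k) (w : X k) : f (Function.update ω k w) = f ω :=
  hf fun _ hi => Function.update_of_ne (ne_of_lt hi) _ _

end Resampling

/-! ### Martingale decomposition of a walk restricted to decreasing events. -/

/-- Events `A k` and functions `L k` that depend on the first `k` (resp. `k + 1`) coordinates, such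
that conditionally on `A k` and on the first `k` coordinates, `A (k + 1)` has probability `p k`,
and `L k` has on this event a mean in `[-m₂, -m₁]` and a variance in `[v₁, v₂]`. -/
structure IsLogWalk {X : ℕ → Type*} [∀ k, MeasurableSpace (X k)] (μ : ∀ k, Measure (X k))
    (A : ℕ → Set (∀ k, X k)) (L : ℕ → (∀ k, X k) → ℝ) (p : ℕ → ℝ) (m₁ m₂ v₁ v₂ : ℝ) : Prop where
  zero : A 0 = Set.univ
  subset : ∀ k, A (k + 1) ⊆ A k
  measurableSet : ∀ k, MeasurableSet (A k)
  dependsOn : ∀ k, DependsOn (fun ω => ω ∈ A k) (Set.Iio k)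
  measurable : ∀ k, Measurable (L k)
  dependsOn_log : ∀ k, DependsOn (L k) (Set.Iio (k + 1))
  pos : ∀ k, 0 < p k
  measure_section : ∀ k, ∀ ω ∈ A k, (μ k).real {w | Function.update ω k w ∈ A (k + 1)} = p k
  integrableOn : ∀ k, ∀ ω ∈ A k, IntegrableOn (fun w => L k (Function.update ω k w) ^ 2)
    {w | Function.update ω k w ∈ A (k + 1)} (μ k)
  mean_le : ∀ k, ∀ ω ∈ A k,
    m₁ ≤ -(∫ w in {w | Function.update ω k w ∈ A (k + 1)},
      L k (Function.update ω k w) ∂μ k) / p k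
  le_mean : ∀ k, ∀ ω ∈ A k,
    -(∫ w in {w | Function.update ω k w ∈ A (k + 1)},
      L k (Function.update ω k w) ∂μ k) / p k ≤ m₂
  var_le : ∀ k, ∀ ω ∈ A k,
    v₁ ≤ (∫ w in {w | Function.update ω k w ∈ A (k + 1)},
      L k (Function.update ω k w) ^ 2 ∂μ k) / p k -
      ((∫ w in {w | Function.update ω k w ∈ A (k + 1)},
        L k (Function.update ω k w) ∂μ k) / p k) ^ 2
  le_var : ∀ k, ∀ ω ∈ A k,
    (∫ w in {w | Function.update ω k w ∈ A (k + 1)},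
      L k (Function.update ω k w) ^ 2 ∂μ k) / p k -
      ((∫ w in {w | Function.update ω k w ∈ A (k + 1)},
        L k (Function.update ω k w) ∂μ k) / p k) ^ 2 ≤ v₂

namespace IsLogWalk

variable {X : ℕ → Type*} [∀ k, MeasurableSpace (X k)] {μ : ∀ k, Measure (X k)}
  [∀ k, IsProbabilityMeasure (μ k)] {A : ℕ → Set (∀ k, X k)} {L : ℕ → (∀ k, X k) → ℝ}
  {p : ℕ → ℝ} {m₁ m₂ v₁ v₂ : ℝ}

/-- The weights of a layer that keep the parameters in the events. -/
def slice (A : ℕ → Set (∀ k, X k)) (k : ℕ) (ω : ∀ k, X k) : Set (X k) :=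
  {w | Function.update ω k w ∈ A (k + 1)}

variable (μ A L p) in
/-- The negative of the conditional mean of `L k` given the first `k` coordinates. -/
noncomputable def drift (k : ℕ) (ω : ∀ k, X k) : ℝ :=
  -(∫ w in slice A k ω, L k (Function.update ω k w) ∂μ k) / p k

variable (μ A L p) in
/-- The martingale part of the sum of the `L k`. -/
noncomputable def fluctuation (l : ℕ) (ω : ∀ k, X k) : ℝ :=
  ∑ k ∈ Finset.range l, (L k ω + drift μ A L p k ω)

lemma measurableSet_slice (h : IsLogWalk μ A L p m₁ m₂ v₁ v₂) (k : ℕ) (ω : ∀ k, X k) :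
    MeasurableSet (slice A k ω) :=
  (measurable_update_prod k).comp measurable_prodMk_left (h.measurableSet (k + 1))

lemma mem_of_mem_slice (h : IsLogWalk μ A L p m₁ m₂ v₁ v₂) {k : ℕ} {ω : ∀ k, X k} {w : X k}
    (hw : w ∈ slice A k ω) : ω ∈ A k := by
  have h1 : Function.update ω k w ∈ A k := h.subset k hw
  have h2 := dependsOn_update (h.dependsOn k) ω w
  exact h2 ▸ h1

/-- The tower property: coordinate `k` is resampled independently and integrated first, the others
being frozen. Outside `A k` the inner integral is zero because the events decrease. -/
lemma lintegral_succ (h : IsLogWalk μ A L p m₁ m₂ v₁ v₂) (k : ℕ) {F : (∀ k, X k) → ENNReal}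
    (hF : Measurable F) :
    ∫⁻ ω in A (k + 1), F ω ∂(Measure.infinitePi μ) =
      ∫⁻ ω in A k, ∫⁻ w in slice A k ω, F (Function.update ω k w) ∂μ k
        ∂(Measure.infinitePi μ) := by
  have h1 := measurePreserving_update μ k
  have hm : Measurable ((A (k + 1)).indicator F) := hF.indicator (h.measurableSet (k + 1))
  rw [← lintegral_indicator (h.measurableSet (k + 1)), ← h1.lintegral_comp hm,
    lintegral_prod (fun z : (∀ k, X k) × X k => (A (k + 1)).indicator F (Function.update z.1 k z.2))
      (hm.comp h1.measurable).aemeasurable,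
    ← lintegral_indicator (h.measurableSet k)]
  apply lintegral_congr
  intro ω
  by_cases hω : ω ∈ A k
  · rw [Set.indicator_of_mem hω, ← lintegral_indicator (h.measurableSet_slice k ω)]
    rfl
  · rw [Set.indicator_of_notMem hω]
    have h2 : ∀ w, (A (k + 1)).indicator F (Function.update ω k w) = 0 := by
      intro w
      refine Set.indicator_of_notMem ?_ _
      exact fun hw => hω (h.mem_of_mem_slice hw)
    simp only [h2, lintegral_zero]

lemma integral_succ (h : IsLogWalk μ A L p m₁ m₂ v₁ v₂) (k : ℕ) {F : (∀ k, X k) → ℝ}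
    (hF : IntegrableOn F (A (k + 1)) (Measure.infinitePi μ)) :
    ∫ ω in A (k + 1), F ω ∂(Measure.infinitePi μ) =
      ∫ ω in A k, ∫ w in slice A k ω, F (Function.update ω k w) ∂μ k ∂(Measure.infinitePi μ) := by
  have h1 := measurePreserving_update μ k
  have hi : Integrable ((A (k + 1)).indicator F) (Measure.infinitePi μ) :=
    (integrable_indicator_iff (h.measurableSet (k + 1))).2 hF
  have hi2 := h1.integrable_comp_of_integrable hi
  have h2 := integral_map (μ := (Measure.infinitePi μ).prod (μ k)) h1.measurable.aemeasurable
    (f := (A (k + 1)).indicator F) (by rw [h1.map_eq]; exact hi.aestronglyMeasurable)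
  rw [h1.map_eq] at h2
  rw [← integral_indicator (h.measurableSet (k + 1)), h2, integral_prod
    (fun z : (∀ k, X k) × X k => (A (k + 1)).indicator F (Function.update z.1 k z.2)) hi2,
    ← integral_indicator (h.measurableSet k)]
  congr 1
  funext ω
  by_cases hω : ω ∈ A k
  · rw [Set.indicator_of_mem hω, ← integral_indicator (h.measurableSet_slice k ω)]
    rfl
  · rw [Set.indicator_of_notMem hω]
    have h3 : ∀ w, (A (k + 1)).indicator F (Function.update ω k w) = 0 := by
      intro w
      refine Set.indicator_of_notMem ?_ _
      exact fun hw => hω (h.mem_of_mem_slice hw)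
    simp only [h3, integral_zero]

lemma dependsOn_drift (h : IsLogWalk μ A L p m₁ m₂ v₁ v₂) (k : ℕ) :
    DependsOn (drift μ A L p k) (Set.Iio k) := by
  intro ω ω' hω
  have h1 : ∀ w, ∀ i ∈ Set.Iio (k + 1), Function.update ω k w i = Function.update ω' k w i := by
    intro w i hi
    by_cases hik : i = k
    · subst hik; simp
    · rw [Function.update_of_ne hik, Function.update_of_ne hik]
      exact hω i (lt_of_le_of_ne (Nat.lt_succ_iff.1 hi) hik)
  have h2 : slice A k ω = slice A k ω' := by
    ext w
    exact iff_of_eq (h.dependsOn (k + 1) (h1 w))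
  simp only [drift, h2]
  congr 2
  apply integral_congr_ae
  filter_upwards with w
  exact h.dependsOn_log k (h1 w)

lemma measurable_drift (h : IsLogWalk μ A L p m₁ m₂ v₁ v₂) (k : ℕ) :
    Measurable (drift μ A L p k) := by
  have h1 : Measurable fun z : (∀ k, X k) × X k =>
      (A (k + 1)).indicator (L k) (Function.update z.1 k z.2) :=
    ((h.measurable k).indicator (h.measurableSet (k + 1))).comp (measurable_update_prod k)
  have h2 := (h1.stronglyMeasurable.integral_prod_right' (ν := μ k)).measurable
  have h3 : drift μ A L p k = fun ω =>
      -(∫ w, (A (k + 1)).indicator (L k) (Function.update ω k w) ∂μ k) / p k := by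
    funext ω
    rw [drift, ← integral_indicator (h.measurableSet_slice k ω)]
    rfl
  rw [h3]
  exact h2.neg.div_const _

lemma dependsOn_fluctuation (h : IsLogWalk μ A L p m₁ m₂ v₁ v₂) (l : ℕ) :
    DependsOn (fluctuation μ A L p l) (Set.Iio l) := by
  intro ω ω' hω
  apply Finset.sum_congr rfl
  intro k hk
  have hk' := Finset.mem_range.1 hk
  rw [h.dependsOn_drift k fun i hi => hω i (Set.mem_Iio.2 (lt_trans hi hk')),
    h.dependsOn_log k fun i hi => hω i (Set.mem_Iio.2 (lt_of_lt_of_le hi hk'))]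

lemma measurable_fluctuation (h : IsLogWalk μ A L p m₁ m₂ v₁ v₂) (l : ℕ) :
    Measurable (fluctuation μ A L p l) :=
  Finset.measurable_sum _ fun k _ => (h.measurable k).add (h.measurable_drift k)

lemma fluctuation_update (h : IsLogWalk μ A L p m₁ m₂ v₁ v₂) (k : ℕ) (ω : ∀ k, X k) (w : X k) :
    fluctuation μ A L p (k + 1) (Function.update ω k w) =
      L k (Function.update ω k w) + (fluctuation μ A L p k ω + drift μ A L p k ω) := by
  rw [fluctuation, Finset.sum_range_succ]
  change fluctuation μ A L p k _ + _ = _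
  rw [dependsOn_update (h.dependsOn_fluctuation k), dependsOn_update (h.dependsOn_drift k)]
  ring

lemma measure_eq (h : IsLogWalk μ A L p m₁ m₂ v₁ v₂) (l : ℕ) :
    (Measure.infinitePi μ).real (A l) = ∏ k ∈ Finset.range l, p k := by
  induction l with
  | zero => simp [h.zero]
  | succ k ih =>
    have h1 := h.integral_succ k (F := fun _ => 1) (integrable_const _).integrableOn
    have h2 : ∫ ω in A k, ∫ w in slice A k ω, (1 : ℝ) ∂μ k ∂(Measure.infinitePi μ) =
        ∫ ω in A k, p k ∂(Measure.infinitePi μ) := by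
      apply setIntegral_congr_fun (h.measurableSet k)
      intro ω hω
      simp only [setIntegral_const, smul_eq_mul, mul_one]
      exact h.measure_section k ω hω
    rw [h2] at h1
    simp only [setIntegral_const, smul_eq_mul, mul_one] at h1
    rw [h1, ih, Finset.prod_range_succ]

lemma integrableOn_slice (h : IsLogWalk μ A L p m₁ m₂ v₁ v₂) {k : ℕ} {ω : ∀ k, X k}
    (hω : ω ∈ A k) :
    IntegrableOn (fun w => L k (Function.update ω k w)) (slice A k ω) (μ k) := by
  have hm : Measurable fun w => L k (Function.update ω k w) :=
    (h.measurable k).comp ((measurable_update_prod k).comp measurable_prodMk_left)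
  have h1 : MemLp (fun w => L k (Function.update ω k w)) 2 ((μ k).restrict (slice A k ω)) :=
    (memLp_two_iff_integrable_sq hm.aestronglyMeasurable).2 (h.integrableOn k ω hω)
  exact h1.integrable (by norm_num)

/-- The martingale property: the drift cancels the conditional mean of `L k`. The factor `p k` does
not depend on `ω`, which is why later conditioning does not disturb the earlier steps. -/
lemma setIntegral_slice (h : IsLogWalk μ A L p m₁ m₂ v₁ v₂) {k : ℕ} {ω : ∀ k, X k}
    (hω : ω ∈ A k) :
    ∫ w in slice A k ω, fluctuation μ A L p (k + 1) (Function.update ω k w) ∂μ k =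
      p k * fluctuation μ A L p k ω := by
  have hp := h.pos k
  simp only [h.fluctuation_update]
  rw [integral_add (h.integrableOn_slice hω) (integrable_const _).integrableOn, setIntegral_const,
    smul_eq_mul]
  have h1 : (μ k).real (slice A k ω) = p k := h.measure_section k ω hω
  rw [h1, drift]
  field_simp
  ring

lemma integrableOn_slice_sq (h : IsLogWalk μ A L p m₁ m₂ v₁ v₂) {k : ℕ} {ω : ∀ k, X k}
    (hω : ω ∈ A k) :
    IntegrableOn (fun w => fluctuation μ A L p (k + 1) (Function.update ω k w) ^ 2)
      (slice A k ω) (μ k) := by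
  have hm : Measurable fun w => L k (Function.update ω k w) :=
    (h.measurable k).comp ((measurable_update_prod k).comp measurable_prodMk_left)
  have h1 : MemLp (fun w => L k (Function.update ω k w)) 2 ((μ k).restrict (slice A k ω)) :=
    (memLp_two_iff_integrable_sq hm.aestronglyMeasurable).2 (h.integrableOn k ω hω)
  simp only [h.fluctuation_update]
  exact (h1.add (memLp_const _)).integrable_sq

/-- The increment is conditionally centered, so the cross term vanishes and only its conditional
variance is added to the square. -/
lemma setIntegral_slice_sq (h : IsLogWalk μ A L p m₁ m₂ v₁ v₂) {k : ℕ} {ω : ∀ k, X k}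
    (hω : ω ∈ A k) :
    p k * (fluctuation μ A L p k ω ^ 2 + v₁) ≤
      ∫ w in slice A k ω, fluctuation μ A L p (k + 1) (Function.update ω k w) ^ 2 ∂μ k ∧
    ∫ w in slice A k ω, fluctuation μ A L p (k + 1) (Function.update ω k w) ^ 2 ∂μ k ≤
      p k * (fluctuation μ A L p k ω ^ 2 + v₂) := by
  have hp := h.pos k
  have h1 : (μ k).real (slice A k ω) = p k := h.measure_section k ω hω
  set I := ∫ w in slice A k ω, L k (Function.update ω k w) ∂μ k with hI
  set J := ∫ w in slice A k ω, L k (Function.update ω k w) ^ 2 ∂μ k with hJ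
  set c := fluctuation μ A L p k ω
  have hd : drift μ A L p k ω = -I / p k := rfl
  have h2 : ∀ w, fluctuation μ A L p (k + 1) (Function.update ω k w) ^ 2 =
      L k (Function.update ω k w) ^ 2 + (2 * (c + -I / p k) * L k (Function.update ω k w) +
        (c + -I / p k) ^ 2) := by
    intro w
    rw [h.fluctuation_update, hd]
    ring
  have hi1 : IntegrableOn (fun w => 2 * (c + -I / p k) * L k (Function.update ω k w))
      (slice A k ω) (μ k) := (h.integrableOn_slice hω).const_mul _
  have hi2 : IntegrableOn (fun w => L k (Function.update ω k w) ^ 2) (slice A k ω) (μ k) :=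
    h.integrableOn k ω hω
  have hi3 : IntegrableOn (fun _ => (c + -I / p k) ^ 2) (slice A k ω) (μ k) :=
    (integrable_const _).integrableOn
  have hi4 : IntegrableOn (fun w => 2 * (c + -I / p k) * L k (Function.update ω k w) +
        (c + -I / p k) ^ 2) (slice A k ω) (μ k) := hi1.add hi3
  have h3 : ∫ w in slice A k ω, fluctuation μ A L p (k + 1) (Function.update ω k w) ^ 2 ∂μ k =
      p k * (c ^ 2 + (J / p k - (I / p k) ^ 2)) := by
    simp only [h2]
    rw [integral_add hi2 hi4, integral_add hi1 hi3, integral_const_mul, setIntegral_const, h1,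
      smul_eq_mul, ← hI, ← hJ]
    field_simp
    ring
  rw [h3]
  have h4 := h.var_le k ω hω
  have h5 := h.le_var k ω hω
  constructor
  · gcongr
    exact h4
  · gcongr
    exact h5

lemma integrableOn_fluctuation_sq (h : IsLogWalk μ A L p m₁ m₂ v₁ v₂) (l : ℕ) :
    IntegrableOn (fun ω => fluctuation μ A L p l ω ^ 2) (A l) (Measure.infinitePi μ) := by
  induction l with
  | zero => simp [fluctuation]
  | succ k ih =>
    have hm := (h.measurable_fluctuation (k + 1)).pow_const 2
    -- Integrability is not known yet, so the tower property is applied to a lower Lebesgue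
    -- integral.
    rw [IntegrableOn, ← lintegral_ofReal_ne_top_iff_integrable hm.aestronglyMeasurable
      (Filter.Eventually.of_forall fun _ => sq_nonneg _), h.lintegral_succ k hm.ennreal_ofReal]
    have h1 : ∫⁻ ω in A k, ∫⁻ w in slice A k ω, ENNReal.ofReal
        (fluctuation μ A L p (k + 1) (Function.update ω k w) ^ 2) ∂μ k ∂(Measure.infinitePi μ) ≤
        ∫⁻ ω in A k, ENNReal.ofReal (p k * (fluctuation μ A L p k ω ^ 2 + v₂))
          ∂(Measure.infinitePi μ) := by
      apply setLIntegral_mono' (h.measurableSet k)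
      intro ω hω
      rw [← ofReal_integral_eq_lintegral_ofReal (h.integrableOn_slice_sq hω)
        (Filter.Eventually.of_forall fun _ => sq_nonneg _)]
      exact ENNReal.ofReal_le_ofReal (h.setIntegral_slice_sq hω).2
    have h2 : IntegrableOn (fun ω => p k * (fluctuation μ A L p k ω ^ 2 + v₂)) (A k)
        (Measure.infinitePi μ) := (ih.add (integrable_const v₂).integrableOn).const_mul _
    exact (h1.trans_lt h2.lintegral_lt_top).ne

lemma memLp_fluctuation (h : IsLogWalk μ A L p m₁ m₂ v₁ v₂) (l : ℕ) :
    MemLp (fluctuation μ A L p l) 2 ((Measure.infinitePi μ).restrict (A l)) :=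
  (memLp_two_iff_integrable_sq (h.measurable_fluctuation l).aestronglyMeasurable).2
    (h.integrableOn_fluctuation_sq l)

lemma setIntegral_fluctuation (h : IsLogWalk μ A L p m₁ m₂ v₁ v₂) (l : ℕ) :
    ∫ ω in A l, fluctuation μ A L p l ω ∂(Measure.infinitePi μ) = 0 := by
  induction l with
  | zero => simp [fluctuation]
  | succ k ih =>
    rw [h.integral_succ k ((h.memLp_fluctuation (k + 1)).integrable (by norm_num)),
      setIntegral_congr_fun (h.measurableSet k) fun ω hω => h.setIntegral_slice hω,
      integral_const_mul, ih, mul_zero]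

/-- Each step multiplies the integral by `p k` and adds between `v₁` and `v₂` times `p k * P(A k) =
P(A (k + 1))`. After division by the probability of the event, the second moment thus grows by an
amount in `[v₁, v₂]` per step. -/
lemma setIntegral_fluctuation_sq (h : IsLogWalk μ A L p m₁ m₂ v₁ v₂) (l : ℕ) :
    l * v₁ * (Measure.infinitePi μ).real (A l) ≤
      ∫ ω in A l, fluctuation μ A L p l ω ^ 2 ∂(Measure.infinitePi μ) ∧
    ∫ ω in A l, fluctuation μ A L p l ω ^ 2 ∂(Measure.infinitePi μ) ≤
      l * v₂ * (Measure.infinitePi μ).real (A l) := by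
  induction l with
  | zero => simp [fluctuation]
  | succ k ih =>
    have hp := h.pos k
    have hi := h.integrableOn_fluctuation_sq k
    have hi' := h.integrableOn_fluctuation_sq (k + 1)
    have hprod : (Measure.infinitePi μ).real (A (k + 1)) =
        p k * (Measure.infinitePi μ).real (A k) := by
      rw [h.measure_eq, h.measure_eq, Finset.prod_range_succ, mul_comm]
    have hb : ∀ v : ℝ, IntegrableOn (fun ω => p k * (fluctuation μ A L p k ω ^ 2 + v)) (A k)
        (Measure.infinitePi μ) := fun v =>
      (hi.add (integrable_const v).integrableOn).const_mul _
    have hbe : ∀ v : ℝ, ∫ ω in A k, p k * (fluctuation μ A L p k ω ^ 2 + v)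
        ∂(Measure.infinitePi μ) = p k * (∫ ω in A k, fluctuation μ A L p k ω ^ 2
          ∂(Measure.infinitePi μ) + v * (Measure.infinitePi μ).real (A k)) := by
      intro v
      rw [integral_const_mul, integral_add hi (integrable_const v).integrableOn,
        setIntegral_const, smul_eq_mul, mul_comm v]
    have hmid : IntegrableOn (fun ω => ∫ w in slice A k ω,
        fluctuation μ A L p (k + 1) (Function.update ω k w) ^ 2 ∂μ k) (A k)
        (Measure.infinitePi μ) := by
      have hm : Measurable fun z : (∀ k, X k) × X k => (A (k + 1)).indicator
          (fun ω => fluctuation μ A L p (k + 1) ω ^ 2) (Function.update z.1 k z.2) :=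
        (((h.measurable_fluctuation (k + 1)).pow_const 2).indicator
          (h.measurableSet (k + 1))).comp (measurable_update_prod k)
      have hm2 := hm.stronglyMeasurable.integral_prod_right' (ν := μ k)
      have heq : (fun ω => ∫ w in slice A k ω,
          fluctuation μ A L p (k + 1) (Function.update ω k w) ^ 2 ∂μ k) =
          fun ω => ∫ w, (A (k + 1)).indicator
          (fun ω => fluctuation μ A L p (k + 1) ω ^ 2) (Function.update ω k w) ∂μ k := by
        funext ω
        rw [← integral_indicator (h.measurableSet_slice k ω)]
        rfl
      refine (hb v₂).mono' (heq ▸ hm2.aestronglyMeasurable) ?_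
      rw [ae_restrict_iff' (h.measurableSet k)]
      filter_upwards with ω hω
      rw [Real.norm_of_nonneg (integral_nonneg fun _ => sq_nonneg _)]
      exact (h.setIntegral_slice_sq hω).2
    rw [h.integral_succ k hi', hprod]
    constructor
    · calc _ ≤ ∫ ω in A k, p k * (fluctuation μ A L p k ω ^ 2 + v₁) ∂(Measure.infinitePi μ) := by
            rw [hbe]
            push_cast
            nlinarith [ih.1]
        _ ≤ _ := setIntegral_mono_on (hb v₁) hmid (h.measurableSet k) fun ω hω =>
            (h.setIntegral_slice_sq hω).1
    · calc _ ≤ ∫ ω in A k, p k * (fluctuation μ A L p k ω ^ 2 + v₂) ∂(Measure.infinitePi μ) :=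
            setIntegral_mono_on hmid (hb v₂) (h.measurableSet k) fun ω hω =>
              (h.setIntegral_slice_sq hω).2
        _ ≤ _ := by
            rw [hbe]
            push_cast
            nlinarith [ih.2]

end IsLogWalk

/-! ### Dependence on the first layers, and diffusion in log-space. -/

section ParamSigma

variable {d : ℕ} {N K : ℕ → ℕ}

/-- The weights of the first `l` layers, extended by zero. -/
def extendWeights (l : ℕ) (θ : ∀ k : Fin l, Kernel d (K (k + 1)) (N k) (N (k + 1))) :
    Weights d N K :=
  fun k => if h : k < l then θ ⟨k, h⟩ else 0

lemma measurable_extendWeights (l : ℕ) :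
    Measurable (extendWeights (d := d) (N := N) (K := K) l) := by
  rw [measurable_pi_iff]
  intro k
  by_cases h : k < l
  · simp only [extendWeights, dif_pos h]
    exact measurable_pi_apply (⟨k, h⟩ : Fin l)
  · simp only [extendWeights, dif_neg h]
    exact measurable_const

/-- A function of the first `l` layers is unchanged when the other layers are replaced by zero, so
it factors measurably through the restriction to these layers. -/
lemma measurable_paramSigma {β : Type*} [MeasurableSpace β] {l : ℕ} {f : Weights d N K → β}
    (hf : Measurable f) (hl : DependsOn f (Set.Iio l)) : Measurable[paramSigma d N K l] f := by
  have h1 : f = (f ∘ extendWeights l) ∘ fun (ω : Weights d N K) (k : Fin l) => ω k := by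
    funext ω
    apply hl
    intro k hk
    simp [extendWeights, Set.mem_Iio.1 hk]
  rw [h1]
  have h2 : Measurable[paramSigma d N K l]
      (fun (ω : Weights d N K) (k : Fin l) => ω k) := Measurable.of_comap_le le_rfl
  exact (hf.comp (measurable_extendWeights l)).comp h2

lemma measurableSet_paramSigma {l : ℕ} {A : Set (Weights d N K)} (hA : MeasurableSet A)
    (hl : DependsOn (fun ω => ω ∈ A) (Set.Iio l)) : MeasurableSet[paramSigma d N K l] A :=
  @measurableSet_setOfPred _ (paramSigma d N K l) (fun ω => ω ∈ A) |>.2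
    (measurable_paramSigma (measurable_mem.2 hA) hl)

end ParamSigma

/-- The increments telescope to `log (q l) - log (q 0)`. The average of the drifts is `m l`, and the
martingale divided by `√l` is `s l`: its second moment, between `l * v₁` and `l * v₂` after
conditioning, is thereby normalized. -/
theorem logDiffusion_of_isLogWalk {d : ℕ} {N K : ℕ → ℕ} {q : ℕ → Weights d N K → ℝ}
    {A : ℕ → Set (Weights d N K)} {m₁ m₂ v₁ v₂ : ℝ}
    (h : IsLogWalk (fun l => heLayer d (K (l + 1)) (N l) (N (l + 1))) A
      (fun k ω => Real.log (q (k + 1) ω) - Real.log (q k ω))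
      (fun k => 1 - (2 : ℝ)⁻¹ ^ N (k + 1)) m₁ m₂ v₁ v₂)
    (hq : ∀ l, ∀ ω ∈ A l, 0 < q l ω) : LogDiffusion q m₁ m₂ v₁ v₂ := by
  set μ := fun l => heLayer d (K (l + 1)) (N l) (N (l + 1))
  set L : ℕ → Weights d N K → ℝ := fun k ω => Real.log (q (k + 1) ω) - Real.log (q k ω)
  set p : ℕ → ℝ := fun k => 1 - (2 : ℝ)⁻¹ ^ N (k + 1)
  refine ⟨A, fun l ω => (∑ k ∈ Finset.range l, IsLogWalk.drift μ A L p k ω) / l,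
    fun l ω => IsLogWalk.fluctuation μ A L p l ω / √(l : ℝ), ?_⟩
  intro l hl
  have hlpos : (0 : ℝ) < l := by exact_mod_cast hl
  have hsqrt : 0 < √(l : ℝ) := Real.sqrt_pos.2 hlpos
  have hheq : heLaw d N K = Measure.infinitePi μ := rfl
  have hprob : (heLaw d N K).real (A l) = ∏ k ∈ Finset.range l, p k := h.measure_eq l
  have hprobpos : 0 < (heLaw d N K).real (A l) := by
    rw [hprob]
    exact Finset.prod_pos fun k _ => h.pos k
  have hAne : heLaw d N K (A l) ≠ 0 := by
    intro h0
    rw [measureReal_def, h0] at hprobpos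
    simp at hprobpos
  have hsubset : ∀ k, k ≤ l → A l ⊆ A k := fun k hk =>
    antitone_nat_of_succ_le (f := A) (fun n => h.subset n) hk
  have hprobm : IsProbabilityMeasure (heLaw d N K) := by rw [hheq]; infer_instance
  have hmem : MemLp (fun ω => IsLogWalk.fluctuation μ A L p l ω / √(l : ℝ)) 2
      (cond (heLaw d N K) (A l)) := by
    have h1 := (h.memLp_fluctuation l).const_mul (√(l : ℝ))⁻¹
    have h2 : (fun ω => IsLogWalk.fluctuation μ A L p l ω / √(l : ℝ)) =
        fun ω => (√(l : ℝ))⁻¹ * IsLogWalk.fluctuation μ A L p l ω := by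
      funext ω; rw [div_eq_inv_mul]
    rw [h2]
    exact h1.smul_measure (by simpa using hAne)
  have hcond : ∀ f : Weights d N K → ℝ, ∫ ω, f ω ∂(cond (heLaw d N K) (A l)) =
      ((heLaw d N K).real (A l))⁻¹ * ∫ ω in A l, f ω ∂(heLaw d N K) := by
    intro f
    rw [ProbabilityTheory.cond, integral_smul_measure, ENNReal.toReal_inv, smul_eq_mul, measureReal_def]
  have hmean : ∫ ω, IsLogWalk.fluctuation μ A L p l ω / √(l : ℝ) ∂(cond (heLaw d N K) (A l)) =
      0 := by
    rw [hcond, integral_div, hheq, h.setIntegral_fluctuation, zero_div, mul_zero]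
  have hvar : variance (fun ω => IsLogWalk.fluctuation μ A L p l ω / √(l : ℝ))
      (cond (heLaw d N K) (A l)) = ((heLaw d N K).real (A l))⁻¹ *
        ((∫ ω in A l, IsLogWalk.fluctuation μ A L p l ω ^ 2 ∂(heLaw d N K)) / l) := by
    rw [variance_of_integral_eq_zero hmem.aestronglyMeasurable.aemeasurable hmean, hcond]
    simp only [div_pow, Real.sq_sqrt hlpos.le]
    rw [integral_div]
  obtain ⟨hs1, hs2⟩ := h.setIntegral_fluctuation_sq l
  rw [← hheq] at hs1 hs2
  refine ⟨measurableSet_paramSigma (h.measurableSet l) (h.dependsOn l),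
    measurable_paramSigma ?_ ?_, measurable_paramSigma ?_ ?_, hprob, ?_, hmem, hmean, ?_, ?_⟩
  · exact (Finset.measurable_sum _ fun k _ => h.measurable_drift k).div_const _
  · intro ω ω' hω
    simp only
    congr 1
    apply Finset.sum_congr rfl
    intro k hk
    exact h.dependsOn_drift k fun i hi =>
      hω i (Set.mem_Iio.2 (lt_trans hi (Finset.mem_range.1 hk)))
  · exact (h.measurable_fluctuation l).div_const _
  · intro ω ω' hω
    simp only
    rw [h.dependsOn_fluctuation l hω]
  · intro ω hω
    refine ⟨hq l ω hω, ?_, ?_, ?_⟩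
    · have h1 : IsLogWalk.fluctuation μ A L p l ω = (Real.log (q l ω) - Real.log (q 0 ω)) +
          ∑ k ∈ Finset.range l, IsLogWalk.drift μ A L p k ω := by
        rw [IsLogWalk.fluctuation, Finset.sum_add_distrib,
          Finset.sum_range_sub (fun k => Real.log (q k ω))]
      simp only
      rw [h1]
      field_simp
      ring
    · rw [le_div_iff₀ hlpos]
      calc m₁ * l = ∑ _k ∈ Finset.range l, m₁ := by simp [mul_comm]
        _ ≤ _ := Finset.sum_le_sum fun k hk =>
          h.mean_le k ω (hsubset k (Finset.mem_range.1 hk).le hω)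
    · rw [div_le_iff₀ hlpos]
      calc _ ≤ ∑ _k ∈ Finset.range l, m₂ := Finset.sum_le_sum fun k hk =>
            h.le_mean k ω (hsubset k (Finset.mem_range.1 hk).le hω)
        _ = m₂ * l := by simp [mul_comm]
  · rw [hvar, ← div_eq_inv_mul, le_div_iff₀ hprobpos, le_div_iff₀ hlpos]
    linarith
  · rw [hvar, ← div_eq_inv_mul, div_le_iff₀ hprobpos, div_le_iff₀ hlpos]
    linarith

/-! ### Large widths, and the resulting bounds for one layer. -/

lemma tendsto_logSqBound {C₂ : ℝ} (hC₂ : 0 < C₂) (C₄ : ℝ) :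
    Filter.Tendsto (logSqBound C₂ C₄) Filter.atTop (nhds 0) := by
  have h1 : Filter.Tendsto (fun N : ℕ => 4 * C₂ / (N : ℝ)) Filter.atTop (nhds 0) :=
    tendsto_const_div_atTop_nhds_zero_nat _
  set r := Real.exp (-(1 / (8 * C₂)))
  have hr0 : 0 < r := Real.exp_pos _
  have hr1 : r < 1 := by
    rw [← Real.exp_zero]
    exact Real.exp_lt_exp.2 (by simp only [Left.neg_neg_iff]; positivity)
  have h2 : Filter.Tendsto (fun N : ℕ => (N : ℝ) ^ 2 * r ^ N) Filter.atTop (nhds 0) :=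
    tendsto_pow_const_mul_const_pow_of_lt_one 2 hr0.le hr1
  have h3 := h1.add (h2.const_mul (512 * C₄ * r⁻¹))
  rw [mul_zero, add_zero] at h3
  refine h3.congr' ?_
  filter_upwards [Filter.eventually_ge_atTop 1] with N hN
  obtain ⟨M, rfl⟩ : ∃ M, N = M + 1 := ⟨N - 1, by omega⟩
  have h4 : Real.exp (-(1 / (8 * C₂)) * (M + 1 - 1 : ℕ)) = r ^ M := by
    rw [mul_comm, Real.exp_nat_mul]; rfl
  rw [logSqBound, h4, pow_succ r M]
  field_simp

/-- The widths for which the increments of a layer are controlled up to `ε`. -/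
def LargeWidth (C₂ C₄ ε : ℝ) (N : ℕ) : Prop :=
  3 ≤ N ∧ 2 ^ 16 * N ^ 2 ≤ 2 ^ N ∧ 16 * C₂ ≤ N ∧
    2 * logSqBound C₂ C₄ N ≤ (ε / 2) ^ 2 ∧ 2 * logSqBound C₂ C₄ N ≤ ε / 2

lemma exists_largeWidth {C₂ : ℝ} (hC₂ : 0 < C₂) (C₄ : ℝ) {ε : ℝ} (hε : 0 < ε) :
    ∃ N₀ : ℕ, ∀ N, N₀ ≤ N → LargeWidth C₂ C₄ ε N := by
  rw [← Filter.eventually_atTop]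
  have h1 : Filter.Tendsto (fun N : ℕ => 2 * logSqBound C₂ C₄ N) Filter.atTop (nhds 0) := by
    simpa using (tendsto_logSqBound hC₂ C₄).const_mul 2
  have h2 : Filter.Tendsto (fun N : ℕ => (N : ℝ) ^ 2 / 2 ^ N) Filter.atTop (nhds 0) :=
    tendsto_pow_const_div_const_pow_of_one_lt 2 (by norm_num)
  have h3 : Filter.Tendsto (fun N : ℕ => (N : ℝ)) Filter.atTop Filter.atTop :=
    tendsto_natCast_atTop_atTop
  filter_upwards [Filter.eventually_ge_atTop 3,
    h2.eventually_le_const (by norm_num : (0 : ℝ) < (2 ^ 16)⁻¹),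
    h3.eventually_ge_atTop (16 * C₂),
    h1.eventually_le_const (by positivity : 0 < (ε / 2) ^ 2),
    h1.eventually_le_const (by positivity : 0 < ε / 2)] with N a b c d e
  refine ⟨a, ?_, c, d, e⟩
  rw [div_le_iff₀ (by positivity)] at b
  have h4 : ((2 ^ 16 * N ^ 2 : ℕ) : ℝ) ≤ ((2 ^ N : ℕ) : ℝ) := by
    push_cast
    linarith
  exact_mod_cast h4

namespace IsChannel

variable {W : Type*} [MeasurableSpace W] [InvolutiveNeg W] {γ : Measure W}
  [IsProbabilityMeasure γ] {Z : W → ℝ} {T S : Set W} {C₂ C₄ s₀ : ℝ} {N : ℕ}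

lemma measure_compl_exceptional (h : IsChannel γ Z T S C₂ C₄ s₀) (hN : 0 < N) :
    (Measure.pi fun _ : Fin N => γ).real (exceptional Z T N)ᶜ = 1 - (2 : ℝ)⁻¹ ^ N := by
  rw [probReal_compl_eq_one_sub (h.measurableSet_exceptional N), h.measure_exceptional hN]

/-- The conditional mean and variance of the logarithm of the averaged energy. -/
theorem log_avgEnergy_bounds (h : IsChannel γ Z T S C₂ C₄ s₀) {ε : ℝ} (hε : 0 < ε)
    (hN : LargeWidth C₂ C₄ ε N) {N_max : ℕ} (hN_max : N ≤ N_max) {I J : ℝ}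
    (hI : I = ∫ w in (exceptional Z T N)ᶜ, Real.log (avgEnergy Z w)
      ∂(Measure.pi fun _ : Fin N => γ))
    (hJ : J = ∫ w in (exceptional Z T N)ᶜ, Real.log (avgEnergy Z w) ^ 2
      ∂(Measure.pi fun _ : Fin N => γ)) :
    s₀ ^ 2 / (2048 * N_max ^ 2) ≤ -I / (1 - (2 : ℝ)⁻¹ ^ N) ∧
    -I / (1 - (2 : ℝ)⁻¹ ^ N) ≤ ε / 2 ∧
    s₀ ^ N_max / 16 ≤ J / (1 - (2 : ℝ)⁻¹ ^ N) - (I / (1 - (2 : ℝ)⁻¹ ^ N)) ^ 2 ∧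
    J / (1 - (2 : ℝ)⁻¹ ^ N) - (I / (1 - (2 : ℝ)⁻¹ ^ N)) ^ 2 ≤ ε / 2 := by
  obtain ⟨h1, h2, h3, h4, h5⟩ := hN
  have hs := h.pos_small
  have hNpos : (0 : ℝ) < N := by positivity
  set P := Measure.pi fun _ : Fin N => γ
  set p := 1 - (2 : ℝ)⁻¹ ^ N with hp
  have hPp : P.real (exceptional Z T N)ᶜ = p := h.measure_compl_exceptional (by omega)
  have hp1 : p ≤ 1 := by rw [hp]; linarith [pow_nonneg (by norm_num : (0 : ℝ) ≤ 2⁻¹) N]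
  have hp2 : 1 / 2 ≤ p := by
    have : (2 : ℝ)⁻¹ ^ N ≤ (2 : ℝ)⁻¹ ^ 1 :=
      pow_le_pow_of_le_one (by norm_num) (by norm_num) (by omega)
    rw [hp]
    norm_num at this ⊢
    linarith
  have hp0 : 0 < p := by linarith
  have hIle : I ≤ -(s₀ ^ 2 / (2048 * N ^ 2)) := hI ▸ h.setIntegral_log_avgEnergy_le h1 h2
  have hJle : J ≤ logSqBound C₂ C₄ N := hJ ▸ h.setIntegral_sq_log_avgEnergy_le (by omega)
  -- Conditioning divides by `p ≥ 1 / 2`, which costs at most a factor `2`.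
  have hJ2 : J / p ≤ 2 * logSqBound C₂ C₄ N := by
    rw [div_le_iff₀ hp0]
    have : 0 ≤ J := by rw [hJ]; exact integral_nonneg fun _ => sq_nonneg _
    nlinarith
  -- The expression to be bounded is the conditional variance, the mean square around `I / p`; the
  -- lower bound applies with this value as the constant `c`.
  have hV : (∫ w in (exceptional Z T N)ᶜ, (Real.log (avgEnergy Z w) - I / p) ^ 2 ∂P) / p =
      J / p - (I / p) ^ 2 := by
    have hi1 : IntegrableOn (fun w => Real.log (avgEnergy Z w) ^ 2) (exceptional Z T N)ᶜ P :=
      h.integrableOn_sq_log_avgEnergy (by omega)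
    have hi2 : IntegrableOn (fun w => 2 * (I / p) * Real.log (avgEnergy Z w))
        (exceptional Z T N)ᶜ P := (h.integrableOn_log_avgEnergy (by omega)).const_mul _
    have hi3 : IntegrableOn (fun w => Real.log (avgEnergy Z w) ^ 2 -
        2 * (I / p) * Real.log (avgEnergy Z w)) (exceptional Z T N)ᶜ P := hi1.sub hi2
    have he : ∀ w : Fin N → W, (Real.log (avgEnergy Z w) - I / p) ^ 2 =
        Real.log (avgEnergy Z w) ^ 2 - 2 * (I / p) * Real.log (avgEnergy Z w) + (I / p) ^ 2 :=
      fun w => by ring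
    simp only [he]
    rw [integral_add hi3 (integrable_const _).integrableOn, integral_sub hi1 hi2,
      integral_const_mul, setIntegral_const, hPp, smul_eq_mul, ← hI, ← hJ]
    field_simp
    ring
  have hVge : s₀ ^ N / 16 ≤ J / p - (I / p) ^ 2 := by
    rw [← hV, le_div_iff₀ hp0]
    have h6 := h.setIntegral_sq_log_sub_ge (N := N) (by omega) h3 (I / p)
    have : 0 < s₀ ^ N / 16 := by positivity
    nlinarith
  have hsN : s₀ ^ N_max ≤ s₀ ^ N := pow_le_pow_of_le_one hs.le h.small_le_one hN_max
  refine ⟨?_, ?_, ?_, ?_⟩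
  · have h6 : s₀ ^ 2 / (2048 * N_max ^ 2) ≤ s₀ ^ 2 / (2048 * N ^ 2) := by
      have : (N : ℝ) ≤ N_max := by exact_mod_cast hN_max
      gcongr
    have h7 : 0 < s₀ ^ 2 / (2048 * (N : ℝ) ^ 2) := by positivity
    rw [le_div_iff₀ hp0]
    nlinarith
  · have h6 : (-I / p) ^ 2 ≤ (ε / 2) ^ 2 := by
      have h7 : (-I / p) ^ 2 = (I / p) ^ 2 := by rw [neg_div, neg_sq]
      have : 0 < s₀ ^ N / 16 := by positivity
      linarith
    exact le_of_abs_le (by rw [← abs_of_pos (by positivity : 0 < ε / 2)]; exact sq_le_sq.1 h6)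
  · linarith
  · linarith [sq_nonneg (I / p)]

end IsChannel

/-! ### From independent channels to a walk in log-space. -/

lemma measurableSet_mem_exceptional {Ω W : Type*} [MeasurableSpace Ω] [MeasurableSpace W] [Neg W]
    [MeasurableNeg W] {Z : Ω → W → ℝ} {T : Set W} {N : ℕ} {f : Ω → Fin N → W}
    (hZ : Measurable (Function.uncurry Z)) (hT : MeasurableSet T) (hf : Measurable f) :
    MeasurableSet {ω | f ω ∈ exceptional (Z ω) T N} := by
  have hc : ∀ c, Measurable fun ω => f ω c := fun c => (measurable_pi_apply c).comp hf
  have h1 : ∀ c, Measurable fun ω => Z ω (f ω c) := fun c => hZ.comp (measurable_id.prodMk (hc c))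
  have h2 : ∀ c, Measurable fun ω => Z ω (-f ω c) :=
    fun c => hZ.comp (measurable_id.prodMk (hc c).neg)
  have hw : MeasurableSet {ω | ∀ c, 3 * Z ω (f ω c) < Z ω (-f ω c)} := by
    rw [Set.ofPred_forall]
    exact MeasurableSet.iInter fun c => measurableSet_lt ((h1 c).const_mul 3) (h2 c)
  have ha : MeasurableSet {ω | ∀ c, 3 * Z ω (-f ω c) < Z ω (f ω c)} := by
    rw [Set.ofPred_forall]
    exact MeasurableSet.iInter fun c => measurableSet_lt ((h2 c).const_mul 3) (h1 c)
  have hs : MeasurableSet {ω | ∀ c, Z ω (-f ω c) < Z ω (f ω c) ∨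
      (Z ω (f ω c) = Z ω (-f ω c) ∧ f ω c ∈ T)} := by
    rw [Set.ofPred_forall]
    exact MeasurableSet.iInter fun c => (measurableSet_lt (h2 c) (h1 c)).union
      ((measurableSet_eq_fun (h1 c) (h2 c)).inter (hc c hT))
  convert hw.union (hs.diff ha) using 1
  ext ω
  simp [exceptional, weakSet, strongSet, antiWeakSet, Set.mem_pi]

/-- A random process that is multiplied at each step with the averaged energy of independent
channels is a walk in log-space. -/
theorem exists_isLogWalk {X : ℕ → Type*} [∀ k, MeasurableSpace (X k)] {μ : ∀ k, Measure (X k)}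
    [∀ k, IsProbabilityMeasure (μ k)] {W : ℕ → Type*} [∀ k, MeasurableSpace (W k)]
    [∀ k, InvolutiveNeg (W k)] [∀ k, MeasurableNeg (W k)] {γ : ∀ k, Measure (W k)}
    [∀ k, IsProbabilityMeasure (γ k)] {N : ℕ → ℕ} {Φ : ∀ k, X k → Fin (N k) → W k}
    (hΦ : ∀ k, MeasurePreserving (Φ k) (μ k) (Measure.pi fun _ => γ k))
    {q : ℕ → (∀ k, X k) → ℝ} (hq : ∀ k, Measurable (q k))
    (hq' : ∀ k, DependsOn (q k) (Set.Iio k))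
    {G : ℕ → Set (∀ k, X k)} (hG : ∀ k, MeasurableSet (G k))
    (hG' : ∀ k, DependsOn (fun ω => ω ∈ G k) (Set.Iio k)) (hG0 : G 0 = Set.univ)
    (hGq : ∀ k, ∀ ω ∈ G k, 0 < q k ω)
    {Z : ∀ k, (∀ k, X k) → W k → ℝ} (hZ : ∀ k, Measurable (Function.uncurry (Z k)))
    (hZ' : ∀ k, DependsOn (Z k) (Set.Iio k)) {T S : ∀ k, Set (W k)}
    (hT : ∀ k, MeasurableSet (T k)) {C₂ C₄ s₀ ε : ℝ} {N_max : ℕ} (hε : 0 < ε)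
    (hchan : ∀ k, ∀ ω ∈ G k, IsChannel (γ k) (Z k ω) (T k) (S k) C₂ C₄ s₀)
    (hstep : ∀ k, ∀ ω ∈ G k, ∀ w,
      q (k + 1) (Function.update ω k w) = q k ω * avgEnergy (Z k ω) (Φ k w))
    (hGstep : ∀ k, ∀ ω ∈ G k, ∀ᵐ w ∂μ k, 0 < avgEnergy (Z k ω) (Φ k w) →
      Function.update ω k w ∈ G (k + 1))
    (hN : ∀ k, LargeWidth C₂ C₄ ε (N k)) (hN_max : ∀ k, N k ≤ N_max) :
    ∃ A : ℕ → Set (∀ k, X k), (∀ k, A k ⊆ G k) ∧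
      IsLogWalk μ A (fun k ω => Real.log (q (k + 1) ω) - Real.log (q k ω))
        (fun k => 1 - (2 : ℝ)⁻¹ ^ N k) (s₀ ^ 2 / (2048 * N_max ^ 2)) (ε / 2)
        (s₀ ^ N_max / 16) (ε / 2) := by
  let E : ∀ k, Set (∀ k, X k) := fun k => {ω | Φ k (ω k) ∈ exceptional (Z k ω) (T k) (N k)}
  -- Intersecting with `G (k + 1)` makes the hypotheses of the next layer hold surely. It does not
  -- change the conditional probability, since `G (k + 1)` holds almost surely off the exceptional
  -- event.
  let A : ℕ → Set (∀ k, X k) := fun k =>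
    Nat.rec Set.univ (fun k B => B ∩ ((E k)ᶜ ∩ G (k + 1))) k
  have hA : ∀ k, A (k + 1) = A k ∩ ((E k)ᶜ ∩ G (k + 1)) := fun k => rfl
  have hAG : ∀ k, A k ⊆ G k := by
    rintro (_ | k)
    · rw [hG0]; exact Set.subset_univ _
    · rw [hA]; exact fun ω h => h.2.2
  have hNpos : ∀ k, 0 < N k := fun k => by have := (hN k).1; omega
  have hAdep : ∀ k, DependsOn (fun ω => ω ∈ A k) (Set.Iio k) := by
    intro k
    induction k with
    | zero => exact fun _ _ _ => rfl
    | succ k ih =>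
      intro ω ω' h
      have h0 : ∀ i ∈ Set.Iio k, ω i = ω' i := fun i hi => h i (Nat.lt_succ_of_lt hi)
      have h1 : (ω ∈ A k) = (ω' ∈ A k) := ih h0
      have h2 : (ω ∈ G (k + 1)) = (ω' ∈ G (k + 1)) := hG' (k + 1) h
      have h3 : Z k ω = Z k ω' := hZ' k h0
      have h4 : ω k = ω' k := h k (Nat.lt_succ_self k)
      simp only [hA, Set.mem_inter_iff, Set.mem_compl_iff, h1, h2, E, Set.mem_ofPred_eq, h3, h4]
  have hslice : ∀ k, ∀ ω ∈ A k, ∀ w, Function.update ω k w ∈ A (k + 1) ↔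
      Φ k w ∉ exceptional (Z k ω) (T k) (N k) ∧ Function.update ω k w ∈ G (k + 1) := by
    intro k ω hω w
    have h1 : (Function.update ω k w ∈ A k) = (ω ∈ A k) := dependsOn_update (hAdep k) ω w
    have h2 : Z k (Function.update ω k w) = Z k ω := dependsOn_update (hZ' k) ω w
    rw [hA, Set.mem_inter_iff, h1, Set.mem_inter_iff, Set.mem_compl_iff]
    simp only [E, Set.mem_ofPred_eq, h2, Function.update_self, hω, true_and]
  have hae : ∀ k, ∀ ω ∈ A k, ({w | Function.update ω k w ∈ A (k + 1)} : Set (X k)) =ᵐ[μ k]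
      Φ k ⁻¹' (exceptional (Z k ω) (T k) (N k))ᶜ := by
    intro k ω hω
    have h1 := (hΦ k).quasiMeasurePreserving.ae
      ((hchan k ω (hAG k hω)).avgEnergy_pos (hNpos k))
    filter_upwards [h1, hGstep k ω (hAG k hω)] with w hw1 hw2
    refine propext ?_
    change Function.update ω k w ∈ A (k + 1) ↔ Φ k w ∉ exceptional (Z k ω) (T k) (N k)
    rw [hslice k ω hω]
    exact ⟨fun h => h.1, fun h => ⟨h, hw2 (hw1 h)⟩⟩
  have hlog : ∀ k, ∀ ω ∈ A k, ∀ w, Function.update ω k w ∈ A (k + 1) →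
      Real.log (q (k + 1) (Function.update ω k w)) - Real.log (q k (Function.update ω k w)) =
        Real.log (avgEnergy (Z k ω) (Φ k w)) := by
    intro k ω hω w hw
    have h1 := hGq (k + 1) _ (hAG (k + 1) hw)
    rw [hstep k ω (hAG k hω)] at h1 ⊢
    rw [dependsOn_update (hq' k), Real.log_mul (hGq k ω (hAG k hω)).ne'
      (right_ne_zero_of_mul h1.ne')]
    ring
  have hAmeas : ∀ k, MeasurableSet (A k) := by
    intro k
    induction k with
    | zero => exact MeasurableSet.univ
    | succ k ih =>
      rw [hA]
      exact ih.inter ((measurableSet_mem_exceptional (hZ k) (hT k)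
        ((hΦ k).measurable.comp (measurable_pi_apply k))).compl.inter (hG _))
  have hmeasE : ∀ k, ∀ ω ∈ A k, MeasurableSet (exceptional (Z k ω) (T k) (N k))ᶜ :=
    fun k ω hω => ((hchan k ω (hAG k hω)).measurableSet_exceptional (N k)).compl
  have hmlog : ∀ k, ∀ ω ∈ A k, Measurable fun w => Real.log (avgEnergy (N := N k) (Z k ω) w) :=
    fun k ω hω => (hchan k ω (hAG k hω)).measurable_avgEnergy.log
  have hsm : ∀ k, ∀ ω, MeasurableSet {w | Function.update ω k w ∈ A (k + 1)} :=
    fun k ω => measurable_update ω (hAmeas (k + 1))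
  -- Up to a null set, the slice is the preimage under `Φ k` of the complement of a fixed
  -- exceptional set, so conditional integrals are integrals over independent channels.
  have hint : ∀ k, ∀ ω ∈ A k, ∀ g : ℝ → ℝ, Measurable g →
      ∫ w in {w | Function.update ω k w ∈ A (k + 1)},
        g (Real.log (q (k + 1) (Function.update ω k w)) -
          Real.log (q k (Function.update ω k w))) ∂μ k =
      ∫ w in (exceptional (Z k ω) (T k) (N k))ᶜ, g (Real.log (avgEnergy (Z k ω) w))
        ∂(Measure.pi fun _ => γ k) := by
    intro k ω hω g hg
    rw [setIntegral_congr_fun (g := fun w => g (Real.log (avgEnergy (Z k ω) (Φ k w)))) (hsm k ω)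
      fun w hw => by simp only [hlog k ω hω w hw], setIntegral_congr_set (hae k ω hω),
      ← (hΦ k).map_eq]
    exact (setIntegral_map (hmeasE k ω hω)
      (hg.comp (hmlog k ω hω)).aestronglyMeasurable (hΦ k).measurable.aemeasurable).symm
  have hbounds : ∀ k, ∀ ω ∈ A k, _ := fun k ω hω =>
    (hchan k ω (hAG k hω)).log_avgEnergy_bounds hε (hN k) (hN_max k)
      (hint k ω hω (fun t => t) measurable_id) (hint k ω hω (fun t => t ^ 2) (by fun_prop))
  refine ⟨A, hAG, ?_⟩
  refine
    { zero := rfl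
      subset := fun k => by rw [hA]; exact Set.inter_subset_left
      measurableSet := hAmeas
      dependsOn := hAdep
      measurable := fun k => (hq _).log.sub (hq _).log
      dependsOn_log := fun k ω ω' h => ?_
      pos := fun k => ?_
      measure_section := fun k ω hω => ?_
      integrableOn := fun k ω hω => ?_
      mean_le := fun k ω hω => (hbounds k ω hω).1
      le_mean := fun k ω hω => (hbounds k ω hω).2.1
      var_le := fun k ω hω => (hbounds k ω hω).2.2.1
      le_var := fun k ω hω => (hbounds k ω hω).2.2.2 }
  · simp only
    rw [hq' (k + 1) h, hq' k fun i hi => h i (Nat.lt_succ_of_lt hi)]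
  · rw [sub_pos]
    exact pow_lt_one₀ (by norm_num) (by norm_num) (hNpos k).ne'
  · rw [measureReal_congr (hae k ω hω), (hΦ k).measureReal_preimage
      (hmeasE k ω hω).nullMeasurableSet]
    exact (hchan k ω (hAG k hω)).measure_compl_exceptional (hNpos k)
  · rw [integrableOn_congr_fun (g := fun w => Real.log (avgEnergy (Z k ω) (Φ k w)) ^ 2)
      (fun w hw => by simp only [hlog k ω hω w hw]) (hsm k ω),
      integrableOn_congr_set_ae (hae k ω hω)]
    have h1 := (hchan k ω (hAG k hω)).integrableOn_sq_log_avgEnergy (hNpos k)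
    exact ((hΦ k).restrict_preimage (hmeasE k ω hω)).integrable_comp_of_integrable h1

/-! ### A kernel as a family of independent Gaussian channels. -/

/-- The weights of an output channel. -/
def chan {d k C C' : ℕ} (ω : Kernel d k C C') (c : Fin C') : (Fin d → Fin k) × Fin C → ℝ :=
  fun i => ω i.1 i.2 c

/-- Both iterated product measures are curried forms of a single product measure over all the
entries of the kernel. -/
lemma measurePreserving_chan (d k C C' : ℕ) :
    MeasurePreserving (fun (ω : Kernel d k C C') (c : Fin C') => chan ω c) (heLayer d k C C')
      (Measure.pi fun _ : Fin C' => Measure.pi fun _ : (Fin d → Fin k) × Fin C =>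
        gaussianReal 0 (2 / ((k : ℝ≥0) ^ d * (C : ℝ≥0)))) := by
  set g := gaussianReal 0 (2 / ((k : ℝ≥0) ^ d * (C : ℝ≥0)))
  set M : Measure (((Fin d → Fin k) × Fin C) × Fin C' → ℝ) := Measure.infinitePi fun _ => g
  have hΦ : Measurable (fun (ω : Kernel d k C C') (c : Fin C') => chan ω c) := by
    unfold chan
    fun_prop
  have h1 : M.map (fun ω κ c c' => ω ((κ, c), c')) = heLayer d k C C' := by
    have h2 := Measure.infinitePi_map_curry
      (fun (_ : (Fin d → Fin k) × Fin C) (_ : Fin C') => g)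
    have h3 := Measure.infinitePi_map_curry
      (fun (_ : Fin d → Fin k) (_ : Fin C) => Measure.infinitePi fun _ : Fin C' => g)
    rw [← h2, Measure.map_map (by fun_prop) (by fun_prop)] at h3
    simp only [Measure.infinitePi_eq_pi] at h3
    rw [heLayer, ← h3]
    simp only [M, Measure.infinitePi_eq_pi]
    rfl
  have h4 : M.map (fun ω c' i => ω (i, c')) = Measure.pi fun _ : Fin C' =>
      Measure.pi fun _ : (Fin d → Fin k) × Fin C => g := by
    have h2 := Measure.infinitePi_map_curry
      (fun (_ : Fin C') (_ : (Fin d → Fin k) × Fin C) => g)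
    have h5 := Measure.infinitePi_map_piCongrLeft (fun _ : Fin C' × ((Fin d → Fin k) × Fin C) => g)
      (Equiv.prodComm ((Fin d → Fin k) × Fin C) (Fin C'))
    rw [← h5, Measure.map_map (by fun_prop) (by fun_prop)] at h2
    simp only [Measure.infinitePi_eq_pi] at h2
    rw [← h2]
    simp only [M, Measure.infinitePi_eq_pi]
    congr 1
  refine ⟨hΦ, ?_⟩
  rw [← h1, Measure.map_map hΦ (by fun_prop), ← h4]
  rfl

/-! ### The uniform position as an additional random datum. -/

section PosLaw

variable {d n : ℕ} [NeZero n] {D : Type*} [MeasurableSpace D] {Q : Measure D}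
  [IsProbabilityMeasure Q]

variable (d n) in
/-- The law of a uniform position. -/
noncomputable def posLaw : Measure (Pos d n) := (PMF.uniformOfFintype (Pos d n)).toMeasure

instance : IsProbabilityMeasure (posLaw d n) := by unfold posLaw; infer_instance

lemma integral_posLaw (f : Pos d n → ℝ) :
    ∫ α, f α ∂(posLaw d n) = Finset.expect Finset.univ f := by
  rw [posLaw, PMF.integral_eq_sum, Finset.expect_eq_sum_div_card, Finset.sum_div]
  refine Finset.sum_congr rfl fun α _ => ?_
  simp [div_eq_inv_mul]

lemma integrable_prod_posLaw {F : D × Pos d n → ℝ} (hF : Measurable F)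
    (hi : ∀ α, Integrable (fun z => F (z, α)) Q) : Integrable F (Q.prod (posLaw d n)) :=
  (integrable_prod_iff' hF.aestronglyMeasurable).2
    ⟨Filter.Eventually.of_forall hi, Integrable.of_finite⟩

lemma integral_prod_posLaw {F : D × Pos d n → ℝ} (hF : Measurable F)
    (hi : ∀ α, Integrable (fun z => F (z, α)) Q) :
    ∫ y, F y ∂(Q.prod (posLaw d n)) = Finset.expect Finset.univ fun α => ∫ z, F (z, α) ∂Q := by
  rw [integral_prod_symm _ (integrable_prod_posLaw hF hi), integral_posLaw]

end PosLaw

/-! ### Propagation of signal and noise in terms of receptive fields. -/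

section Network

variable {d n : ℕ} {N K : ℕ → ℕ}

/-- The receptive field of the tensor `x` at position `α`. -/
def recField {k C : ℕ} (x : Tensor d n C) (α : Pos d n) : (Fin d → Fin k) × Fin C → ℝ :=
  fun i => x (shift α i.1) i.2

lemma conv_eq_dot {k C C' : ℕ} (ω : Kernel d k C C') (x : Tensor d n C) (α : Pos d n)
    (c : Fin C') : conv ω x α c = dot (chan ω c) (recField x α) := by
  rw [conv, dot, Fintype.sum_prod_type]
  rfl

lemma signal_succ (ω : Weights d N K) (x : Tensor d n (N 0)) (l : ℕ) (α : Pos d n)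
    (c : Fin (N (l + 1))) : signal ω (zeroBiases N) x (l + 1) α c =
      relu (dot (chan (ω l) c) (recField (signal ω (zeroBiases N) x l) α)) := by
  simp only [signal, affine, zeroBiases, add_zero, conv_eq_dot]

lemma noise_succ (ω : Weights d N K) (x dx : Tensor d n (N 0)) (l : ℕ) (α : Pos d n)
    (c : Fin (N (l + 1))) : noise ω (zeroBiases N) x dx (l + 1) α c =
      reluDeriv (dot (chan (ω l) c) (recField (signal ω (zeroBiases N) x l) α)) *
        dot (chan (ω l) c) (recField (noise ω (zeroBiases N) x dx l) α) := by
  simp only [noise, affine, zeroBiases, add_zero, conv_eq_dot]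

lemma signal_congr {ω ω' : Weights d N K} (x : Tensor d n (N 0)) {l : ℕ}
    (h : ∀ i ∈ Set.Iio l, ω i = ω' i) :
    signal ω (zeroBiases N) x l = signal ω' (zeroBiases N) x l := by
  induction l with
  | zero => rfl
  | succ l ih =>
    funext α c
    rw [signal_succ, signal_succ, ih fun i hi => h i (Nat.lt_succ_of_lt hi),
      h l (Nat.lt_succ_self l)]

lemma noise_congr {ω ω' : Weights d N K} (x dx : Tensor d n (N 0)) {l : ℕ}
    (h : ∀ i ∈ Set.Iio l, ω i = ω' i) :
    noise ω (zeroBiases N) x dx l = noise ω' (zeroBiases N) x dx l := by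
  induction l with
  | zero => rfl
  | succ l ih =>
    have h' : ∀ i ∈ Set.Iio l, ω i = ω' i := fun i hi => h i (Nat.lt_succ_of_lt hi)
    funext α c
    rw [noise_succ, noise_succ, ih h', signal_congr x h', h l (Nat.lt_succ_self l)]

lemma measurable_chan {k C C' : ℕ} (c : Fin C') :
    Measurable fun ω : Kernel d k C C' => chan ω c := by
  unfold chan
  fun_prop

lemma measurable_recField {k C : ℕ} (α : Pos d n) :
    Measurable fun x : Tensor d n C => (recField x α : (Fin d → Fin k) × Fin C → ℝ) := by
  unfold recField
  fun_prop

lemma measurable_relu : Measurable relu := measurable_id.max measurable_const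

lemma measurable_signal (l : ℕ) : Measurable fun p : Weights d N K × Tensor d n (N 0) =>
    signal p.1 (zeroBiases N) p.2 l := by
  induction l with
  | zero => exact measurable_snd
  | succ l ih =>
    refine measurable_pi_lambda _ fun α => measurable_pi_lambda _ fun c => ?_
    simp only [signal_succ]
    exact measurable_relu.comp (measurable_dot
      ((measurable_chan c).comp ((measurable_pi_apply l).comp measurable_fst))
      ((measurable_recField α).comp ih))

lemma measurable_noise (l : ℕ) :
    Measurable fun p : Weights d N K × (Tensor d n (N 0) × Tensor d n (N 0)) =>
      noise p.1 (zeroBiases N) p.2.1 p.2.2 l := by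
  induction l with
  | zero => exact measurable_snd.comp measurable_snd
  | succ l ih =>
    refine measurable_pi_lambda _ fun α => measurable_pi_lambda _ fun c => ?_
    simp only [noise_succ]
    have h1 : Measurable fun p : Weights d N K × (Tensor d n (N 0) × Tensor d n (N 0)) =>
        chan (p.1 l) c := (measurable_chan c).comp ((measurable_pi_apply l).comp measurable_fst)
    have h2 : Measurable fun p : Weights d N K × (Tensor d n (N 0) × Tensor d n (N 0)) =>
        signal p.1 (zeroBiases N) p.2.1 l :=
      (measurable_signal l).comp (measurable_fst.prodMk (measurable_fst.comp measurable_snd))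
    exact (measurable_reluDeriv.comp (measurable_dot h1 ((measurable_recField α).comp h2))).mul
      (measurable_dot h1 ((measurable_recField α).comp ih))

lemma measurable_noise_apply (ω : Weights d N K) (l : ℕ) :
    Measurable fun z : Tensor d n (N 0) × Tensor d n (N 0) =>
      noise ω (zeroBiases N) z.1 z.2 l :=
  (measurable_noise l).comp (measurable_prodMk_left (x := ω))

variable {Q : Measure (Tensor d n (N 0) × Tensor d n (N 0))}

lemma memLp_dot {D ι : Type*} [Fintype ι] [MeasurableSpace D] {Q : Measure D} {f : D → ι → ℝ}
    (hf : ∀ i, MemLp (fun z => f z i) 2 Q) (w : ι → ℝ) : MemLp (fun z => dot w (f z)) 2 Q := by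
  unfold dot
  exact memLp_finsetSum _ fun i _ => (hf i).const_mul _

lemma memLp_noise (hQ : ∀ α c, MemLp (fun z => z.2 α c) 2 Q) (ω : Weights d N K) (l : ℕ)
    (α : Pos d n) (c : Fin (N l)) :
    MemLp (fun z => noise ω (zeroBiases N) z.1 z.2 l α c) 2 Q := by
  induction l generalizing α with
  | zero => exact hQ α c
  | succ l ih =>
    have h1 : MemLp (fun z : Tensor d n (N 0) × Tensor d n (N 0) => dot (chan (ω l) c)
        (recField (noise ω (zeroBiases N) z.1 z.2 l) α)) 2 Q :=
      memLp_dot (f := fun z : Tensor d n (N 0) × Tensor d n (N 0) =>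
        recField (noise ω (zeroBiases N) z.1 z.2 l) α) (fun i => ih (shift α i.1) i.2) _
    have h2 : Measurable fun z : Tensor d n (N 0) × Tensor d n (N 0) =>
        noise ω (zeroBiases N) z.1 z.2 (l + 1) α c := by
      have h3 : Measurable fun z : Tensor d n (N 0) × Tensor d n (N 0) =>
          noise ω (zeroBiases N) z.1 z.2 (l + 1) := measurable_noise_apply ω (l + 1)
      rw [measurable_pi_iff] at h3
      exact measurable_pi_iff.1 (h3 α) c
    refine h1.mono h2.aestronglyMeasurable (Filter.Eventually.of_forall fun z => ?_)
    rw [noise_succ, norm_mul, Real.norm_of_nonneg (reluDeriv_nonneg _)]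
    exact mul_le_of_le_one_left (norm_nonneg _) (reluDeriv_le_one _)

/-- The receptive fields of the signal. -/
noncomputable def signalField (ω : Weights d N K) (l : ℕ)
    (y : (Tensor d n (N 0) × Tensor d n (N 0)) × Pos d n) :
    (Fin d → Fin (K (l + 1))) × Fin (N l) → ℝ :=
  recField (signal ω (zeroBiases N) y.1.1 l) y.2

/-- The receptive fields of the noise. -/
noncomputable def noiseField (ω : Weights d N K) (l : ℕ)
    (y : (Tensor d n (N 0) × Tensor d n (N 0)) × Pos d n) :
    (Fin d → Fin (K (l + 1))) × Fin (N l) → ℝ :=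
  recField (noise ω (zeroBiases N) y.1.1 y.1.2 l) y.2

variable [NeZero n]

lemma measurable_signalField (l : ℕ) :
    Measurable fun p : Weights d N K × ((Tensor d n (N 0) × Tensor d n (N 0)) × Pos d n) =>
      signalField p.1 l p.2 := by
  have h : Measurable fun p : (Weights d N K × (Tensor d n (N 0) × Tensor d n (N 0))) × Pos d n =>
      signalField p.1.1 l (p.1.2, p.2) :=
    measurable_from_prod_countable_left fun α => (measurable_recField α).comp
      ((measurable_signal l).comp (measurable_fst.prodMk (measurable_fst.comp measurable_snd)))
  exact h.comp ((measurable_fst.prodMk (measurable_fst.comp measurable_snd)).prodMk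
    (measurable_snd.comp measurable_snd))

lemma measurable_noiseField (l : ℕ) :
    Measurable fun p : Weights d N K × ((Tensor d n (N 0) × Tensor d n (N 0)) × Pos d n) =>
      noiseField p.1 l p.2 := by
  have h : Measurable fun p : (Weights d N K × (Tensor d n (N 0) × Tensor d n (N 0))) × Pos d n =>
      noiseField p.1.1 l (p.1.2, p.2) :=
    measurable_from_prod_countable_left fun α => (measurable_recField α).comp (measurable_noise l)
  exact h.comp ((measurable_fst.prodMk (measurable_fst.comp measurable_snd)).prodMk
    (measurable_snd.comp measurable_snd))

/-- The second moment of the noise, for data of law `Q`. -/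
noncomputable def noiseMoment (Q : Measure (Tensor d n (N 0) × Tensor d n (N 0))) (l : ℕ)
    (ω : Weights d N K) : ℝ :=
  nu Q 2 fun z => noise ω (zeroBiases N) z.1 z.2 l

lemma dependsOn_noiseMoment (l : ℕ) :
    DependsOn (noiseMoment (K := K) Q l) (Set.Iio l) := by
  intro ω ω' h
  simp only [noiseMoment, noise_congr _ _ h]

variable [IsProbabilityMeasure Q]

lemma measurable_noiseMoment (l : ℕ) : Measurable (noiseMoment (K := K) Q l) := by
  unfold noiseMoment nu nuC
  simp only [Finset.expect_eq_sum_div_card]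
  refine (Finset.measurable_sum _ fun c _ => ((Finset.measurable_sum _ fun α _ => ?_)).div_const
    _).div_const _
  have h : Measurable fun p : Weights d N K × (Tensor d n (N 0) × Tensor d n (N 0)) =>
      noise p.1 (zeroBiases N) p.2.1 p.2.2 l α c ^ 2 :=
    ((measurable_pi_apply c).comp ((measurable_pi_apply α).comp (measurable_noise l))).pow_const 2
  exact (h.stronglyMeasurable.integral_prod_right (ν := Q)).measurable

lemma memLp_noiseField (hQ : ∀ α c, MemLp (fun z => z.2 α c) 2 Q) (ω : Weights d N K) (l : ℕ)
    (i : (Fin d → Fin (K (l + 1))) × Fin (N l)) :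
    MemLp (fun y => noiseField ω l y i) 2 (Q.prod (posLaw d n)) := by
  have hm : Measurable fun y => noiseField (n := n) ω l y i :=
    (measurable_pi_apply i).comp ((measurable_noiseField l).comp measurable_prodMk_left)
  rw [memLp_two_iff_integrable_sq hm.aestronglyMeasurable]
  exact integrable_prod_posLaw (hm.pow_const 2) fun α =>
    (memLp_noise hQ ω l (shift α i.1) i.2).integrable_sq

/-- With periodic boundary conditions, reading at a fixed offset is a translation of the grid, hence
a bijection of the positions. -/
lemma expect_shift {k : ℕ} (κ : Fin d → Fin k) (f : Pos d n → ℝ) :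
    (Finset.expect Finset.univ fun α => f (shift α κ)) = Finset.expect Finset.univ f := by
  refine Fintype.expect_equiv (Equiv.addRight
    fun i => ((κ i : ℕ) : ZMod n) - (((k - 1) / 2 : ℕ) : ZMod n)) _ _ fun α => ?_
  congr 1
  funext i
  simp [shift, add_sub_assoc]

/-- The receptive fields have the same mean energy as the tensor. -/
lemma integral_noiseField_sq (hQ : ∀ α c, MemLp (fun z => z.2 α c) 2 Q) (ω : Weights d N K)
    (l : ℕ) (hN : 0 < N l) :
    ∫ y, ∑ i, noiseField ω l y i ^ 2 ∂(Q.prod (posLaw d n)) =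
      Fintype.card ((Fin d → Fin (K (l + 1))) × Fin (N l)) * noiseMoment Q l ω := by
  have hm : ∀ i, Measurable fun y => noiseField (n := n) ω l y i ^ 2 := fun i =>
    ((measurable_pi_apply i).comp
      ((measurable_noiseField l).comp measurable_prodMk_left)).pow_const 2
  rw [integral_finsetSum _ fun i _ => (memLp_noiseField hQ ω l i).integrable_sq]
  have h1 : ∀ i : (Fin d → Fin (K (l + 1))) × Fin (N l),
      ∫ y, noiseField ω l y i ^ 2 ∂(Q.prod (posLaw d n)) =
        nuC Q 2 (fun z => noise ω (zeroBiases N) z.1 z.2 l) i.2 := by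
    intro i
    rw [integral_prod_posLaw (hm i) fun α =>
      (memLp_noise hQ ω l (shift α i.1) i.2).integrable_sq]
    exact expect_shift i.1 fun α => ∫ z, noise ω (zeroBiases N) z.1 z.2 l α i.2 ^ 2 ∂Q
  have hN' : (N l : ℝ) ≠ 0 := by positivity
  simp only [h1]
  rw [Fintype.sum_prod_type]
  simp only [Finset.sum_const, noiseMoment, nu, Finset.expect_eq_sum_div_card, Fintype.card_prod,
    Finset.card_univ, Fintype.card_fin, nsmul_eq_mul, Nat.cast_mul]
  field_simp

/-- Once the position is part of the data, a channel of the next layer is a single linear form of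
the receptive field, gated by the derivative, and its second moment is a channel energy. -/
lemma noiseMoment_succ (hQ : ∀ α c, MemLp (fun z => z.2 α c) 2 Q) (ω : Weights d N K) (l : ℕ) :
    noiseMoment Q (l + 1) ω = avgEnergy
      (channelEnergy (Q.prod (posLaw d n)) (signalField ω l) (noiseField ω l))
      (fun c => chan (ω l) c) := by
  rw [noiseMoment, nu, avgEnergy, Finset.expect_eq_sum_div_card, Finset.card_univ,
    Fintype.card_fin]
  congr 1
  refine Finset.sum_congr rfl fun c _ => ?_
  have hs := (measurable_signalField (d := d) (n := n) (N := N) (K := K) l).comp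
    (measurable_prodMk_left (x := ω))
  have hn := (measurable_noiseField (d := d) (n := n) (N := N) (K := K) l).comp
    (measurable_prodMk_left (x := ω))
  have he : ∀ α, ∀ z : Tensor d n (N 0) × Tensor d n (N 0),
      reluDeriv (dot (chan (ω l) c) (signalField ω l (z, α))) ^ 2 *
        dot (chan (ω l) c) (noiseField ω l (z, α)) ^ 2 =
      noise ω (zeroBiases N) z.1 z.2 (l + 1) α c ^ 2 := fun α z => by
    rw [noise_succ, mul_pow]; rfl
  rw [channelEnergy, integral_prod_posLaw]
  · simp only [he]
    rfl
  · exact ((measurable_reluDeriv.comp (measurable_dot measurable_const hs)).pow_const 2).mul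
      ((measurable_dot measurable_const hn).pow_const 2)
  · intro α
    simp only [he]
    exact (memLp_noise hQ ω (l + 1) α c).integrable_sq

end Network

/-! ### A uniform lower bound on the probability of small weights. -/

/-- A lower bound on the probability that all the weights of a channel are small, for channels
with at most `M` weights. -/
noncomputable def minSmallProb (M : ℕ) : ℝ := ∏ D ∈ Finset.Icc 1 M, smallProb D

lemma minSmallProb_pos (M : ℕ) : 0 < minSmallProb M :=
  Finset.prod_pos fun _ hD => smallProb_pos (Finset.mem_Icc.1 hD).1

lemma minSmallProb_le {M D : ℕ} (hD : 0 < D) (hDM : D ≤ M) : minSmallProb M ≤ smallProb D := by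
  have hm : D ∈ Finset.Icc 1 M := Finset.mem_Icc.2 ⟨hD, hDM⟩
  rw [minSmallProb, ← Finset.mul_prod_erase _ _ hm]
  exact mul_le_of_le_one_right (smallProb_pos hD).le (Finset.prod_le_one
    (fun i hi => (smallProb_pos (Finset.mem_Icc.1 (Finset.mem_of_mem_erase hi)).1).le)
    fun i _ => smallProb_le_one i)

/-! ### Support of the noise, and diffusion of its second moment. -/

section Network

variable {d n : ℕ} [NeZero n] {N K : ℕ → ℕ}
  {Q : Measure (Tensor d n (N 0) × Tensor d n (N 0))}

/-- The parameters for which the noise vanishes almost surely where the feature vector of the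
signal vanishes. -/
def supported (Q : Measure (Tensor d n (N 0) × Tensor d n (N 0))) (l : ℕ) :
    Set (Weights d N K) :=
  {ω | ∀ᵐ z ∂Q, ∀ α, signal ω (zeroBiases N) z.1 l α = 0 →
    noise ω (zeroBiases N) z.1 z.2 l α = 0}

lemma measurableSet_supportedAt (l : ℕ) :
    MeasurableSet {p : Weights d N K × (Tensor d n (N 0) × Tensor d n (N 0)) |
      ∀ α, signal p.1 (zeroBiases N) p.2.1 l α = 0 →
        noise p.1 (zeroBiases N) p.2.1 p.2.2 l α = 0} := by
  have h1 : ∀ α, Measurable fun p : Weights d N K × (Tensor d n (N 0) × Tensor d n (N 0)) =>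
      signal p.1 (zeroBiases N) p.2.1 l α := fun α => measurable_pi_iff.1
    ((measurable_signal l).comp (measurable_fst.prodMk (measurable_fst.comp measurable_snd))) α
  have h2 : ∀ α, Measurable fun p : Weights d N K × (Tensor d n (N 0) × Tensor d n (N 0)) =>
      noise p.1 (zeroBiases N) p.2.1 p.2.2 l α :=
    fun α => measurable_pi_iff.1 (measurable_noise l) α
  rw [Set.ofPred_forall]
  refine MeasurableSet.iInter fun α => ?_
  have h3 := (h1 α (measurableSet_singleton 0)).compl.union (h2 α (measurableSet_singleton 0))
  convert h3 using 1
  ext p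
  simp [imp_iff_not_or]

lemma measurableSet_supportedAt_update (ω : Weights d N K) (k l : ℕ) :
    MeasurableSet {p : Kernel d (K (k + 1)) (N k) (N (k + 1)) ×
      (Tensor d n (N 0) × Tensor d n (N 0)) |
        (fun w (z : Tensor d n (N 0) × Tensor d n (N 0)) => ∀ α,
          signal (Function.update ω k w) (zeroBiases N) z.1 l α = 0 →
            noise (Function.update ω k w) (zeroBiases N) z.1 z.2 l α = 0) p.1 p.2} :=
  (((measurable_update ω).comp measurable_fst).prodMk measurable_snd) (measurableSet_supportedAt l)

lemma dependsOn_supported (l : ℕ) :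
    DependsOn (fun ω => ω ∈ supported (K := K) Q l) (Set.Iio l) := by
  intro ω ω' h
  simp only [supported, Set.mem_ofPred_eq, noise_congr _ _ h, signal_congr _ h]

variable [IsProbabilityMeasure Q]

lemma measurableSet_supported (l : ℕ) : MeasurableSet (supported (K := K) Q l) :=
  measurable_measure_prodMk_left (ν := Q) (measurableSet_supportedAt (K := K) l).compl
    (measurableSet_singleton 0)

lemma ae_chan {k C C' : ℕ} {p : ((Fin d → Fin k) × Fin C → ℝ) → Prop} (c : Fin C')
    (hp : ∀ᵐ w ∂(Measure.pi fun _ : (Fin d → Fin k) × Fin C =>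
      gaussianReal 0 (2 / ((k : ℝ≥0) ^ d * (C : ℝ≥0)))), p w) :
    ∀ᵐ ω ∂(heLayer d k C C'), p (chan ω c) :=
  ((measurePreserving_eval _ c).comp (measurePreserving_chan d k C C')).quasiMeasurePreserving.ae hp

/-- For fixed data, either the receptive field of the signal vanishes, and then so does that of the
noise, or almost surely no pre-activation is zero, and then a zero output means a negative
pre-activation with zero derivative. Fubini's theorem exchanges the two almost sure quantifiers. -/
lemma ae_update_mem_supported {k : ℕ} (hN : 0 < N k) (hK : 0 < K (k + 1)) {ω : Weights d N K}
    (hω : ω ∈ supported Q k) :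
    ∀ᵐ w ∂(heLayer d (K (k + 1)) (N k) (N (k + 1))),
      Function.update ω k w ∈ supported Q (k + 1) := by
  refine (Measure.ae_ae_comm (measurableSet_supportedAt_update ω k (k + 1))).2 ?_
  filter_upwards [hω] with z hz
  set x := signal ω (zeroBiases N) z.1 k with hx
  set v := noise ω (zeroBiases N) z.1 z.2 k with hv
  have hs : (2 / ((K (k + 1) : ℝ≥0) ^ d * (N k : ℝ≥0))) ≠ 0 := by positivity
  have h1 : ∀ᵐ w ∂(heLayer d (K (k + 1)) (N k) (N (k + 1))), ∀ α c,
      (recField x α : (Fin d → Fin (K (k + 1))) × Fin (N k) → ℝ) = 0 ∨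
        dot (chan w c) (recField x α) ≠ 0 := by
    rw [ae_all_iff]
    intro α
    rw [ae_all_iff]
    intro c
    by_cases h0 : (recField x α : (Fin d → Fin (K (k + 1))) × Fin (N k) → ℝ) = 0
    · exact Filter.Eventually.of_forall fun _ => Or.inl h0
    · filter_upwards [ae_chan (C' := N (k + 1)) c (ae_dot_ne_zero hs h0)] with w hw using Or.inr hw
  filter_upwards [h1] with w hw α hα
  have hsig : signal (Function.update ω k w) (zeroBiases N) z.1 k = x :=
    signal_congr _ fun i hi => Function.update_of_ne (ne_of_lt hi) _ _
  have hnoi : noise (Function.update ω k w) (zeroBiases N) z.1 z.2 k = v :=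
    noise_congr _ _ fun i hi => Function.update_of_ne (ne_of_lt hi) _ _
  funext c
  have hα' := congrFun hα c
  rw [signal_succ, hsig, Function.update_self] at hα'
  rw [noise_succ, hsig, hnoi, Function.update_self]
  rcases hw α c with h0 | h0
  · have hv0 : (recField v α : (Fin d → Fin (K (k + 1))) × Fin (N k) → ℝ) = 0 := by
      funext i
      have h3 : x (shift α i.1) = 0 := by
        funext c'
        exact congrFun h0 (i.1, c')
      exact congrFun (hz _ h3) i.2
    rw [hv0]
    simp [dot]
  · have h3 : dot (chan w c) (recField x α) < 0 :=
      lt_of_le_of_ne (max_eq_right_iff.1 hα') h0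
    rw [reluDeriv, if_pos h3, zero_mul]
    rfl

/-- The second moment of the noise diffuses in log-space. -/
theorem logDiffusion_noiseMoment (hQ : ∀ α c, MemLp (fun z => z.2 α c) 2 Q)
    (hQ0 : 0 < nu Q 2 fun z => z.2) (hQs : ∀ᵐ z ∂Q, ∀ α, z.1 α = 0 → z.2 α = 0)
    {ε : ℝ} (hε : 0 < ε) {N_max : ℕ} (hN0 : 0 < N 0)
    (hN : ∀ l, LargeWidth (4 * gaussFourth.toReal) gaussNeg.toReal ε (N (l + 1)))
    (hN_max : ∀ l, N l ≤ N_max) (hK : ∀ l, 1 ≤ l → 1 ≤ K l ∧ K l ≤ n) :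
    LogDiffusion (K := K) (noiseMoment Q)
      (minSmallProb (n ^ d * N_max) ^ 2 / (2048 * N_max ^ 2)) (ε / 2)
      (minSmallProb (n ^ d * N_max) ^ N_max / 16) (ε / 2) := by
  have hNpos : ∀ l, 0 < N l := by
    rintro (_ | l)
    · exact hN0
    · have := (hN l).1; omega
  have hKpos : ∀ l, 0 < K (l + 1) := fun l => (hK (l + 1) (Nat.succ_pos l)).1
  have hstep : ∀ l, ∀ ω : Weights d N K, 0 < noiseMoment Q l ω → ∀ w,
      noiseMoment Q (l + 1) (Function.update ω l w) = noiseMoment Q l ω *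
        avgEnergy (fun w => channelEnergy (Q.prod (posLaw d n)) (signalField ω l)
          (noiseField ω l) w / noiseMoment Q l ω) (fun c => chan w c) := by
    intro l ω hω w
    have h0 : noiseMoment Q l ω ≠ 0 := hω.ne'
    have h : ∀ i ∈ Set.Iio l, Function.update ω l w i = ω i :=
      fun i hi => Function.update_of_ne (ne_of_lt hi) _ _
    have h1 : signalField (n := n) (Function.update ω l w) l = signalField ω l := by
      funext y
      rw [signalField, signal_congr _ h, signalField]
    have h2 : noiseField (n := n) (Function.update ω l w) l = noiseField ω l := by
      funext y
      rw [noiseField, noise_congr _ _ h, noiseField]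
    rw [noiseMoment_succ hQ, h1, h2, Function.update_self, avgEnergy, avgEnergy, ← Finset.sum_div]
    field_simp
  refine Exists.elim (exists_isLogWalk
    (μ := fun l => heLayer d (K (l + 1)) (N l) (N (l + 1)))
    (W := fun l => (Fin d → Fin (K (l + 1))) × Fin (N l) → ℝ)
    (γ := fun l => Measure.pi fun _ : (Fin d → Fin (K (l + 1))) × Fin (N l) =>
      gaussianReal 0 (2 / ((K (l + 1) : ℝ≥0) ^ d * (N l : ℝ≥0))))
    (N := fun l => N (l + 1)) (Φ := fun l ω c => chan ω c)
    (fun l => measurePreserving_chan d (K (l + 1)) (N l) (N (l + 1)))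
    (q := noiseMoment Q) measurable_noiseMoment dependsOn_noiseMoment
    -- Positivity allows the energies to be normalized by the current moment, and the support
    -- condition gives them mean one.
    (G := fun l => {ω | 0 < noiseMoment Q l ω} ∩ supported Q l)
    (fun l => (measurableSet_lt measurable_const (measurable_noiseMoment l)).inter
      (measurableSet_supported l))
    (fun l ω ω' h => by
      have h1 : (ω ∈ supported Q l) = (ω' ∈ supported Q l) := dependsOn_supported l h
      simp only [Set.mem_inter_iff, Set.mem_ofPred_eq, dependsOn_noiseMoment l h, h1])
    (Set.eq_univ_of_forall fun ω => ⟨hQ0, hQs⟩) (fun l ω hω => hω.1)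
    (Z := fun l ω w => channelEnergy (Q.prod (posLaw d n)) (signalField ω l) (noiseField ω l) w /
      noiseMoment Q l ω)
    (fun l => ?_) (fun l ω ω' h => ?_) (T := fun l => tieSet _) (S := fun l => smallSet _)
    (fun l => measurableSet_lt measurable_const (measurable_dot measurable_id measurable_const))
    (C₂ := 4 * gaussFourth.toReal) (C₄ := gaussNeg.toReal)
    (s₀ := minSmallProb (n ^ d * N_max)) (N_max := N_max) hε (fun l ω hω => ?_)
    (fun l ω hω w => ?_) (fun l ω hω => ?_) hN (fun l => hN_max (l + 1)))
    fun A hA => logDiffusion_of_isLogWalk hA.2 fun l ω hω => (hA.1 l hω).1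
  · have hs : Measurable fun p : (Weights d N K × ((Fin d → Fin (K (l + 1))) × Fin (N l) → ℝ)) ×
        ((Tensor d n (N 0) × Tensor d n (N 0)) × Pos d n) => signalField p.1.1 l p.2 :=
      (measurable_signalField l).comp
        ((measurable_fst.comp measurable_fst).prodMk measurable_snd)
    have hn : Measurable fun p : (Weights d N K × ((Fin d → Fin (K (l + 1))) × Fin (N l) → ℝ)) ×
        ((Tensor d n (N 0) × Tensor d n (N 0)) × Pos d n) => noiseField p.1.1 l p.2 :=
      (measurable_noiseField l).comp
        ((measurable_fst.comp measurable_fst).prodMk measurable_snd)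
    have hw : Measurable fun p : (Weights d N K × ((Fin d → Fin (K (l + 1))) × Fin (N l) → ℝ)) ×
        ((Tensor d n (N 0) × Tensor d n (N 0)) × Pos d n) => p.1.2 :=
      measurable_snd.comp measurable_fst
    have h1 := ((measurable_reluDeriv.comp (measurable_dot hw hs)).pow_const 2).mul
      ((measurable_dot hw hn).pow_const 2)
    exact (h1.stronglyMeasurable.integral_prod_right (ν := Q.prod (posLaw d n))).measurable.div
      ((measurable_noiseMoment l).comp measurable_fst)
  · funext w
    have h1 : signalField (n := n) ω l = signalField ω' l := by
      funext y
      rw [signalField, signal_congr _ h, signalField]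
    have h2 : noiseField (n := n) ω l = noiseField ω' l := by
      funext y
      rw [noiseField, noise_congr _ _ h, noiseField]
    simp only [h1, h2, dependsOn_noiseMoment l h]
  · have : Nonempty (Fin (N l)) := ⟨⟨0, hNpos l⟩⟩
    have : Nonempty (Fin (K (l + 1))) := ⟨⟨0, hKpos l⟩⟩
    have hcard : Fintype.card ((Fin d → Fin (K (l + 1))) × Fin (N l)) = K (l + 1) ^ d * N l := by
      simp
    refine isChannel_channelEnergy
      ((measurable_signalField l).comp (measurable_prodMk_left (x := ω)))
      ((measurable_noiseField l).comp (measurable_prodMk_left (x := ω)))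
      (memLp_noiseField hQ ω l) ?_ hω.1 (integral_noiseField_sq hQ ω l (hNpos l)) ?_
      (minSmallProb_pos _) (minSmallProb_le Fintype.card_pos ?_)
    · filter_upwards [Measure.quasiMeasurePreserving_fst.ae hω.2] with y hy hy0
      funext i
      have h3 : signal ω (zeroBiases N) y.1.1 l (shift y.2 i.1) = 0 := by
        funext c'
        exact congrFun hy0 (i.1, c')
      exact congrFun (hy _ h3) i.2
    · rw [hcard]
      push_cast
      rfl
    · rw [hcard]
      -- A channel has `K ^ d * N l` weights, at most `n ^ d * N_max`; this is where the lower
      -- bounds on drift and variance come to depend on `d`, `n` and the maximal width.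
      exact Nat.mul_le_mul (Nat.pow_le_pow_left (hK (l + 1) (Nat.succ_pos l)).2 d) (hN_max l)
  · exact hstep l ω hω.1 w
  · filter_upwards [ae_update_mem_supported (hNpos l) (hKpos l) hω.2] with w hw hpos
    refine ⟨?_, hw⟩
    rw [Set.mem_ofPred_eq, hstep l ω hω.1 w]
    exact mul_pos hω.1 hpos

end Network

/-! ### Reduction of the signal and of the centered noise to a non-central noise moment. -/

lemma LogDiffusion.mono {d : ℕ} {N K : ℕ → ℕ} {q : ℕ → Weights d N K → ℝ}
    {m₁ m₂ v₁ v₂ m₁' v₁' : ℝ} (h : LogDiffusion q m₁ m₂ v₁ v₂) (hm : m₁' ≤ m₁) (hv : v₁' ≤ v₁) :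
    LogDiffusion q m₁' m₂ v₁' v₂ := by
  obtain ⟨A, m, s, h⟩ := h
  refine ⟨A, m, s, fun l hl => ?_⟩
  obtain ⟨h1, h2, h3, h4, h5, h6, h7, h8, h9⟩ := h l hl
  exact ⟨h1, h2, h3, h4, fun ω hω => ⟨(h5 ω hω).1, (h5 ω hω).2.1, hm.trans (h5 ω hω).2.2.1,
    (h5 ω hω).2.2.2⟩, h6, h7, hv.trans h8, h9⟩

lemma gaussFourth_pos : 0 < gaussFourth.toReal := by
  refine ENNReal.toReal_pos (fun h => ?_) gaussFourth_lt_top.ne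
  rw [gaussFourth, lintegral_eq_zero_iff (by fun_prop)] at h
  have := nullSingletonClass_gaussianReal (μ := 0) (v := 1) one_ne_zero
  have h1 : ∀ᵐ x ∂(gaussianReal 0 1), x ≠ 0 :=
    compl_mem_ae_iff.2 (measure_singleton (0 : ℝ))
  obtain ⟨x, hx, hx0⟩ := (h.and h1).exists
  have h2 : 0 < ENNReal.ofReal (x ^ 2) ^ 2 := by positivity
  exact h2.ne' hx

lemma integral_comp_measurePreserving {X Y : Type*} [MeasurableSpace X] [MeasurableSpace Y]
    {μ : Measure X} {ν : Measure Y} {f : X → Y} (hf : MeasurePreserving f μ ν) {g : Y → ℝ}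
    (hg : Measurable g) : ∫ x, g (f x) ∂μ = ∫ y, g y ∂ν := by
  rw [← hf.map_eq, integral_map hf.measurable.aemeasurable hg.aestronglyMeasurable]

section Laws

variable {d n : ℕ} [NeZero n] {N K : ℕ → ℕ}

lemma relu_eq_reluDeriv_mul (t : ℝ) : relu t = reluDeriv t * t := by
  rcases lt_trichotomy t 0 with h | h | h
  · rw [relu, reluDeriv, if_pos h, zero_mul, max_eq_right h.le]
  · simp [relu, h]
  · rw [relu, reluDeriv, if_neg h.le.not_gt, if_neg h.ne', one_mul, max_eq_left h.le]

/-- The signal propagates as the noise that equals the signal. -/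
lemma noise_self (ω : Weights d N K) (x : Tensor d n (N 0)) (l : ℕ) :
    noise ω (zeroBiases N) x x l = signal ω (zeroBiases N) x l := by
  induction l with
  | zero => rfl
  | succ l ih =>
    funext α c
    rw [noise_succ, signal_succ, ih, relu_eq_reluDeriv_mul]

variable {C : ℕ} {Px : Measure (Tensor d n (N 0))} [IsProbabilityMeasure Px] {ρ : Measure ℝ}
  [IsProbabilityMeasure ρ]

instance : IsProbabilityMeasure (iidNoise d n C ρ) := by unfold iidNoise; infer_instance

instance : IsProbabilityMeasure (dataLaw Px ρ) := by unfold dataLaw; infer_instance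

lemma measurable_prodMk_self {X : Type*} [MeasurableSpace X] : Measurable fun x : X => (x, x) :=
  measurable_id.prodMk measurable_id

/-- On the diagonal law of `(x, x)` the propagated noise is the signal itself, so the part about the
signal becomes an instance of the part about the noise. -/
lemma nuSignal_eq (l : ℕ) (ω : Weights d N K) :
    nuSignal Px ρ l ω = noiseMoment (Px.map fun x => (x, x)) l ω := by
  simp only [nuSignal, noiseMoment, nu, nuC]
  refine Finset.expect_congr rfl fun c _ => Finset.expect_congr rfl fun α _ => ?_
  have hm : Measurable fun z : Tensor d n (N 0) × Tensor d n (N 0) =>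
      noise ω (zeroBiases N) z.1 z.2 l α c ^ 2 :=
    (measurable_pi_iff.1 (measurable_pi_iff.1 (measurable_noise_apply ω l) α) c).pow_const 2
  rw [integral_map measurable_prodMk_self.aemeasurable hm.aestronglyMeasurable, dataLaw,
    integral_fun_fst (fun x => signal ω (zeroBiases N) x l α c ^ 2)]
  simp [noise_self]

lemma measurePreserving_noise_entry (α : Pos d n) (c : Fin (N 0)) :
    MeasurePreserving (fun z : Tensor d n (N 0) × Tensor d n (N 0) => z.2 α c)
      (dataLaw Px ρ) ρ :=
  ((measurePreserving_eval (fun _ : Fin (N 0) => ρ) c).comp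
    (measurePreserving_eval (fun _ : Pos d n => Measure.pi fun _ : Fin (N 0) => ρ) α)).comp
      measurePreserving_snd

/-- For a fixed signal the noise at any layer is linear in the input noise, whose entries are
centered. Only centering is needed here. -/
lemma integral_noise_iidNoise (hρ : Integrable (fun t : ℝ => t) ρ) (hρ0 : ∫ t, t ∂ρ = 0)
    (ω : Weights d N K) (x : Tensor d n (N 0)) (l : ℕ) (α : Pos d n) (c : Fin (N l)) :
    Integrable (fun dx => noise ω (zeroBiases N) x dx l α c) (iidNoise d n (N 0) ρ) ∧
      ∫ dx, noise ω (zeroBiases N) x dx l α c ∂(iidNoise d n (N 0) ρ) = 0 := by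
  induction l generalizing α with
  | zero =>
    have h : MeasurePreserving (fun dx : Tensor d n (N 0) => dx α c) (iidNoise d n (N 0) ρ) ρ :=
      (measurePreserving_eval (fun _ : Fin (N 0) => ρ) c).comp
        (measurePreserving_eval (fun _ : Pos d n => Measure.pi fun _ : Fin (N 0) => ρ) α)
    refine ⟨h.integrable_comp_of_integrable hρ, ?_⟩
    exact (integral_comp_measurePreserving h measurable_id).trans hρ0
  | succ l ih =>
    have hi : ∀ i : (Fin d → Fin (K (l + 1))) × Fin (N l), Integrable (fun dx => chan (ω l) c i *
        recField (noise ω (zeroBiases N) x dx l) α i) (iidNoise d n (N 0) ρ) :=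
      fun i => (ih (shift α i.1) i.2).1.const_mul _
    simp only [noise_succ, dot]
    refine ⟨(integrable_finsetSum _ fun i _ => hi i).const_mul _, ?_⟩
    rw [integral_const_mul, integral_finsetSum _ fun i _ => hi i]
    refine mul_eq_zero_of_right _ (Finset.sum_eq_zero fun i _ => ?_)
    rw [integral_const_mul]
    exact mul_eq_zero_of_right _ (ih (shift α i.1) i.2).2

/-- Integrating over the input noise first shows that each channel mean is zero, so central and
non-central second moments agree. -/
lemma muNoise_eq (hρ : MemLp (fun t : ℝ => t) 2 ρ) (hρ0 : ∫ t, t ∂ρ = 0) (l : ℕ)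
    (ω : Weights d N K) : muNoise Px ρ l ω = noiseMoment (dataLaw Px ρ) l ω := by
  have hQ : ∀ α c, MemLp (fun z => z.2 α c) 2 (dataLaw Px ρ) := fun α c =>
    hρ.comp_measurePreserving (measurePreserving_noise_entry α c)
  have h0 : ∀ c, nuC (dataLaw Px ρ) 1 (fun z => noise ω (zeroBiases N) z.1 z.2 l) c = 0 := by
    intro c
    refine (Finset.expect_congr rfl fun α _ => ?_).trans (Finset.expect_const_zero Finset.univ)
    have h1 : Integrable (fun z : Tensor d n (N 0) × Tensor d n (N 0) =>
        noise ω (zeroBiases N) z.1 z.2 l α c) (Px.prod (iidNoise d n (N 0) ρ)) :=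
      (memLp_noise hQ ω l α c).integrable one_le_two
    simp only [pow_one]
    rw [dataLaw, integral_prod _ h1]
    simp only [(integral_noise_iidNoise (hρ.integrable one_le_two) hρ0 ω _ l α c).2,
      integral_zero]
  simp only [muNoise, mu, muC, h0, sub_zero]
  rfl

end Laws

end VanillaNet

open VanillaNet in
theorem theorem1 (ε : ℝ) (hε : 0 < ε) :
    ∃ N₀ : ℕ, ∀ (d n : ℕ) [NeZero n] (N_max : ℕ),
      ∃ m_min m_max v_min v_max : ℝ,
        (0 < m_min ∧ m_min ≤ m_max ∧ m_max < ε) ∧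
        (0 < v_min ∧ v_min ≤ v_max ∧ v_max < ε) ∧
        ∀ (N K : ℕ → ℕ), 0 < N 0 → (∀ l, 1 ≤ l → N₀ ≤ N l) → (∀ l, N l ≤ N_max) →
          (∀ l, 1 ≤ l → 1 ≤ K l ∧ K l ≤ n) →
        ∀ (Px : Measure (Tensor d n (N 0))) [IsProbabilityMeasure Px]
          (ρ : Measure ℝ) [IsProbabilityMeasure ρ],
          (∀ α c, MemLp (fun x : Tensor d n (N 0) => x α c) 2 Px) →
          0 < nu Px 2 (fun x : Tensor d n (N 0) => x) →
          MemLp (fun t : ℝ => t) 2 ρ → ∫ t, t ∂ρ = 0 → 0 < ∫ t, t ^ 2 ∂ρ →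
          LogDiffusion (K := K) (nuSignal Px ρ) m_min m_max v_min v_max ∧
          ((∀ α, ∀ᵐ x ∂Px, x α ≠ 0) →
            LogDiffusion (K := K) (muNoise Px ρ) m_min m_max v_min v_max) := by
  obtain ⟨N₀, hN₀⟩ := exists_largeWidth (C₂ := 4 * gaussFourth.toReal)
    (mul_pos four_pos gaussFourth_pos) gaussNeg.toReal hε
  refine ⟨N₀, fun d n _ N_max => ?_⟩
  -- The bound `N_max + 1` keeps the constant `m` positive even when `N_max = 0`, where the
  -- denominator would otherwise vanish.
  set s₀ := minSmallProb (n ^ d * (N_max + 1)) with hs₀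
  have hs : 0 < s₀ := minSmallProb_pos _
  set m := s₀ ^ 2 / (2048 * ((N_max + 1 : ℕ) : ℝ) ^ 2) with hm
  set v := s₀ ^ (N_max + 1) / 16 with hv
  have hm0 : 0 < m := by positivity
  have hv0 : 0 < v := by positivity
  -- The minimum with `ε / 2` guarantees that the lower constants do not exceed the upper ones, even
  -- if no net satisfies the width bounds.
  refine ⟨min m (ε / 2), ε / 2, min v (ε / 2), ε / 2,
    ⟨lt_min hm0 (half_pos hε), min_le_right _ _, half_lt_self hε⟩,
    ⟨lt_min hv0 (half_pos hε), min_le_right _ _, half_lt_self hε⟩, ?_⟩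
  intro N K hN0 hN hN_max hK Px _ ρ _ hPx hPx0 hρ hρ0 hρ2
  have hlarge := fun l => hN₀ (N (l + 1)) (hN (l + 1) (Nat.succ_pos l))
  have hN_max' : ∀ l, N l ≤ N_max + 1 := fun l => (hN_max l).trans (Nat.le_succ _)
  constructor
  · have hq : (nuSignal Px ρ : ℕ → Weights d N K → ℝ) =
        noiseMoment (Px.map fun x => (x, x)) := by
      funext l ω
      exact nuSignal_eq l ω
    have : IsProbabilityMeasure (Px.map fun x => (x, x)) :=
      Measure.isProbabilityMeasure_map measurable_prodMk_self.aemeasurable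
    have hm2 : ∀ α c, Measurable fun z : Tensor d n (N 0) × Tensor d n (N 0) => z.2 α c :=
      fun α c => measurable_pi_iff.1 (measurable_pi_iff.1 measurable_snd α) c
    rw [hq]
    refine (logDiffusion_noiseMoment (fun α c => ?_) ?_ ?_ hε hN0 hlarge hN_max' hK).mono
      (min_le_left _ _) (min_le_left _ _)
    · exact (memLp_map_measure_iff (hm2 α c).aestronglyMeasurable
        measurable_prodMk_self.aemeasurable).2 (hPx α c)
    · convert hPx0 using 1
      refine Finset.expect_congr rfl fun c _ => Finset.expect_congr rfl fun α _ => ?_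
      rw [integral_map measurable_prodMk_self.aemeasurable ((hm2 α c).pow_const 2).aestronglyMeasurable]
    · rw [ae_all_iff]
      intro α
      refine (ae_map_iff measurable_prodMk_self.aemeasurable ?_).2
        (Filter.Eventually.of_forall fun x hx => hx)
      have h1 : Measurable fun z : Tensor d n (N 0) × Tensor d n (N 0) => z.1 α :=
        measurable_pi_iff.1 measurable_fst α
      have h2 : Measurable fun z : Tensor d n (N 0) × Tensor d n (N 0) => z.2 α :=
        measurable_pi_iff.1 measurable_snd α
      convert (h1 (measurableSet_singleton 0)).compl.union (h2 (measurableSet_singleton 0)) using 1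
      ext p
      simp [imp_iff_not_or]
  · intro hx
    have hq : (muNoise Px ρ : ℕ → Weights d N K → ℝ) = noiseMoment (dataLaw Px ρ) := by
      funext l ω
      exact muNoise_eq hρ hρ0 l ω
    rw [hq]
    refine (logDiffusion_noiseMoment (fun α c => ?_) ?_ ?_ hε hN0 hlarge hN_max' hK).mono
      (min_le_left _ _) (min_le_left _ _)
    · exact hρ.comp_measurePreserving (measurePreserving_noise_entry α c)
    · have h1 : ∀ (α : Pos d n) (c : Fin (N 0)),
          ∫ z, z.2 α c ^ 2 ∂(dataLaw Px ρ) = ∫ t, t ^ 2 ∂ρ :=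
        fun α c => integral_comp_measurePreserving (measurePreserving_noise_entry α c)
          (measurable_id.pow_const 2)
      have : Nonempty (Fin (N 0)) := ⟨⟨0, hN0⟩⟩
      simp only [nu, nuC, h1, Finset.expect_const Finset.univ_nonempty]
      exact hρ2
    -- At the input the support condition is void, since the feature vectors of `x` are almost
    -- surely non-zero.
    · filter_upwards [Measure.quasiMeasurePreserving_fst.ae (ae_all_iff.2 hx)] with z hz α h0
      exact absurd h0 (hz α)
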